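/- Let $n\ge 1$, let $\hat O=\mathbb{C}[[x_1,\dots,x_n]]$ and let $\mathcal{O}_0=\mathbb{C}\{x_1,\dots,x_n\}\subset\hat O$ be the ring of convergent power series (germs at $0$ of analytic functions). Let $h_{(0,1)}(\hat D)$ be the $\mathbb{C}$-algebra generated by $\hat O$, $\partial_1,\dots,\partial_n$ and a variable $h$, in which $\partial_i c-c\,\partial_i=\frac{\partial c}{\partial x_i}h$ for $c\in\hat O$ are the only non-trivial commutation relations; its elements are written uniquely as finite sums $P=\sum_{\beta,k}c_{\beta,k}(x)\,\partial^\beta h^k$ with $c_{\beta,k}\in\hat O$. Let $h_{(0,1)}(\mathcal{D}_0)$ be the subring of those $P$ with all $c_{\beta,k}\in\mathcal{O}_0$. An element $P$ is homogeneous if $|\beta|+k$ is constant over the pairs with $c_{\beta,k}\neq 0$; a left ideal is homogeneous if it can be generated by homogeneous elements. Let $U_{loc}=\{u\in\mathbb{R}^n : u_i\le 0\ \forall i\}$ and $W_{loc}=\{(u,v)\in\mathbb{R}^{2n} : u_i\le 0,\ u_i+v_i\ge 0\ \forall i\}$. A weight $u\in U_{loc}$ gives the monomial $x^\alpha$ the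 weight $u\cdot\alpha$, and a weight $w=(u,v)\in W_{loc}$ gives $x^\alpha\partial^\beta h^k$ the weight $u\cdot\alpha+v\cdot\beta$. For a ring $R$ among $\mathcal{O}_0,\hat O$ (with weights in $W=U_{loc}$) or $h_{(0,1)}(\mathcal{D}_0),h_{(0,1)}(\hat D)$ (with weights in $W=W_{loc}$) and $w\in W$, let $F^w_t$ (resp. $F^w_{<t}$), $t\in\mathbb{R}$, be the set of elements of $R$ all of whose monomials have weight $\le t$ (resp. $<t$), and let $\mathrm{gr}^w(R)=\bigoplus_t F^w_t/F^w_{<t}$. Sending the class of $P$ in $F^w_t/F^w_{<t}$ to the part of weight $t$ of $P$ embeds $\mathrm{gr}^w(R)$ into the space of all formal sums of monomials; through this embedding the rings $\mathrm{gr}^w(R)$ for different $w$, and their subsets, are compared (two of them are equal if they have the same elements and the same operations). For a left ideal $I$ of $R$ let $\mathrm{in}_w(I)\subset\mathrm{gr}^w(R)$ be the left ideal generated by the classes in $F^w_t/F^w_{<t}$ of the elements of $I\cap F^w_t$, $t\in\mathbb{R}$, i.e. by the initial forms of the elements of $I$. The Gröbner cone of $w\in W$ is $$C_I[w]=\{w'\in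 W : \mathrm{gr}^{w}(R)=\mathrm{gr}^{w'}(R)\ \text{and}\ \mathrm{in}_{w}(I)=\mathrm{in}_{w'}(I)\},$$ and the (open) Gröbner fan of $I$ on $W$ is $\mathcal{E}(I,W)=\{C_I[w] : w\in W\}$. Then: 1. For every ideal $I$ of $\mathcal{O}_0$, $\mathcal{E}(I,U_{loc})=\mathcal{E}(\hat O\cdot I,U_{loc})$. 2. For every homogeneous left ideal $I$ of $h_{(0,1)}(\mathcal{D}_0)$, $\mathcal{E}(I,W_{loc})=\mathcal{E}(h_{(0,1)}(\hat D)\cdot I,W_{loc})$. -/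

import Mathlib

noncomputable section

namespace GrobnerFan

open scoped DirectSum

/-! ## Weight filtrations, associated graded rings, initial ideals and Gröbner fans

The rings below consist of series, and `c a e` is the coefficient of the series `a` at the
exponent `e`.  A weight function `wt` on the exponents defines the order of `a` as the maximum of
`wt e` over the support of `a`. -/

/-- `wt` is an admissible weight function: orders are submultiplicative and the order of `1` is
at most `0`, so that the order filtration is a ring filtration. -/
class IsWeight {R E : Type*} [Ring R] (c : R →+ (E → ℂ)) (wt : E → ℝ) : Prop where
  one_le : ∀ e, c 1 e ≠ 0 → wt e ≤ 0
  mul_le : ∀ a b e, c (a * b) e ≠ 0 →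
    ∃ e₁ e₂, c a e₁ ≠ 0 ∧ c b e₂ ≠ 0 ∧ wt e ≤ wt e₁ + wt e₂

section Graded

variable {R E : Type*} [Ring R] (c : R →+ (E → ℂ)) (wt : E → ℝ)

/-- `F_t`: the elements of order at most `t`. -/
def filt (t : ℝ) : AddSubgroup R where
  carrier := {a | ∀ e, c a e ≠ 0 → wt e ≤ t}
  zero_mem' := by simp
  add_mem' := by
    intro a b ha hb e he
    by_cases h : c a e = 0
    · exact hb e (by simpa [h] using he)
    · exact ha e h
  neg_mem' := by
    intro a ha e he
    exact ha e (by simpa using he)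

/-- `F_{<t}`: the elements of order less than `t`. -/
def filtLT (t : ℝ) : AddSubgroup R where
  carrier := {a | ∀ e, c a e ≠ 0 → wt e < t}
  zero_mem' := by simp
  add_mem' := by
    intro a b ha hb e he
    by_cases h : c a e = 0
    · exact hb e (by simpa [h] using he)
    · exact ha e h
  neg_mem' := by
    intro a ha e he
    exact ha e (by simpa using he)

/-- `F_t / F_{<t}`. -/
abbrev GrPiece (t : ℝ) : Type _ := filt c wt t ⧸ (filtLT c wt t).addSubgroupOf (filt c wt t)

/-- The associated graded ring `⨁ t, F_t / F_{<t}`; its ring structure is given below. -/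
abbrev Gr : Type _ := ⨁ t : ℝ, GrPiece c wt t

/-- The class in `F_t / F_{<t}` of an element of `F_t` (the initial form of the element if its
order is `t`, and zero if its order is less than `t`). -/
def symb (t : ℝ) : filt c wt t →+ GrPiece c wt t := QuotientAddGroup.mk' _

theorem symb_surjective (t : ℝ) : Function.Surjective (symb c wt t) :=
  QuotientAddGroup.mk'_surjective _

theorem symb_eq_zero_iff {t : ℝ} (a : filt c wt t) :
    symb c wt t a = 0 ↔ (a : R) ∈ filtLT c wt t := by
  simp [symb, AddSubgroup.mem_addSubgroupOf]

theorem symb_mk_eq {s t : ℝ} (h : s = t) (a : filt c wt s) (b : filt c wt t)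
    (hab : (a : R) = b) :
    GradedMonoid.mk (A := GrPiece c wt) s (symb c wt s a)
      = GradedMonoid.mk (A := GrPiece c wt) t (symb c wt t b) := by
  subst h
  rw [Subtype.ext hab]

section Mul

variable [IsWeight c wt]

theorem one_mem_filt : (1 : R) ∈ filt c wt 0 := IsWeight.one_le

theorem mul_mem_filt {s t : ℝ} {a b : R} (ha : a ∈ filt c wt s) (hb : b ∈ filt c wt t) :
    a * b ∈ filt c wt (s + t) := by
  intro e he
  obtain ⟨e₁, e₂, h₁, h₂, h⟩ := IsWeight.mul_le (wt := wt) a b e he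
  exact h.trans (add_le_add (ha e₁ h₁) (hb e₂ h₂))

theorem mul_mem_filtLT_left {s t : ℝ} {a b : R} (ha : a ∈ filtLT c wt s)
    (hb : b ∈ filt c wt t) : a * b ∈ filtLT c wt (s + t) := by
  intro e he
  obtain ⟨e₁, e₂, h₁, h₂, h⟩ := IsWeight.mul_le (wt := wt) a b e he
  exact h.trans_lt (add_lt_add_of_lt_of_le (ha e₁ h₁) (hb e₂ h₂))

theorem mul_mem_filtLT_right {s t : ℝ} {a b : R} (ha : a ∈ filt c wt s)
    (hb : b ∈ filtLT c wt t) : a * b ∈ filtLT c wt (s + t) := by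
  intro e he
  obtain ⟨e₁, e₂, h₁, h₂, h⟩ := IsWeight.mul_le (wt := wt) a b e he
  exact h.trans_lt (add_lt_add_of_le_of_lt (ha e₁ h₁) (hb e₂ h₂))

/-- The product `F_s / F_{<s} × F_t / F_{<t} → F_{s+t} / F_{<s+t}` induced by that of `R`. -/
def grMul (s t : ℝ) : GrPiece c wt s →+ GrPiece c wt t →+ GrPiece c wt (s + t) :=
  QuotientAddGroup.lift _
    (AddMonoidHom.mk'
      (fun a => QuotientAddGroup.lift _
        (AddMonoidHom.mk' (fun b => symb c wt (s + t) ⟨a * b, mul_mem_filt c wt a.2 b.2⟩)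
          (by
            intro b b'
            rw [← map_add]
            congr 1
            exact Subtype.ext (mul_add _ _ _)))
        (by
          intro b hb
          exact (symb_eq_zero_iff c wt _).2
            (mul_mem_filtLT_right c wt a.2 (AddSubgroup.mem_addSubgroupOf.1 hb))))
      (by
        intro a a'
        ext b
        change symb c wt (s + t) _ = symb c wt (s + t) _ + symb c wt (s + t) _
        rw [← map_add]
        congr 1
        exact Subtype.ext (add_mul _ _ _)))
    (by
      intro a ha
      rw [AddMonoidHom.mem_ker]
      ext b
      exact (symb_eq_zero_iff c wt _).2
        (mul_mem_filtLT_left c wt (AddSubgroup.mem_addSubgroupOf.1 ha) b.2))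

theorem grMul_symb {s t : ℝ} (a : filt c wt s) (b : filt c wt t) :
    grMul c wt s t (symb c wt s a) (symb c wt t b)
      = symb c wt (s + t) ⟨a * b, mul_mem_filt c wt a.2 b.2⟩ := rfl

instance : GradedMonoid.GOne (GrPiece c wt) where
  one := symb c wt 0 ⟨1, one_mem_filt c wt⟩

instance : GradedMonoid.GMul (GrPiece c wt) where
  mul {s t} a b := grMul c wt s t a b

instance : GradedMonoid.GMonoid (GrPiece c wt) where
  one_mul := by
    rintro ⟨t, a⟩
    obtain ⟨a, rfl⟩ := symb_surjective c wt t a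
    exact symb_mk_eq c wt (zero_add t) _ _ (one_mul _)
  mul_one := by
    rintro ⟨t, a⟩
    obtain ⟨a, rfl⟩ := symb_surjective c wt t a
    exact symb_mk_eq c wt (add_zero t) _ _ (mul_one _)
  mul_assoc := by
    rintro ⟨r, a⟩ ⟨s, b⟩ ⟨t, d⟩
    obtain ⟨a, rfl⟩ := symb_surjective c wt r a
    obtain ⟨b, rfl⟩ := symb_surjective c wt s b
    obtain ⟨d, rfl⟩ := symb_surjective c wt t d
    exact symb_mk_eq c wt (add_assoc r s t) _ _ (mul_assoc _ _ _)

instance : DirectSum.GSemiring (GrPiece c wt) where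
  mul_zero _ := map_zero _
  zero_mul _ := by change grMul c wt _ _ 0 _ = 0; simp
  mul_add _ _ _ := map_add _ _ _
  add_mul _ _ _ := by change grMul c wt _ _ (_ + _) _ = _; rw [map_add]; rfl
  natCast m := m • symb c wt 0 ⟨1, one_mem_filt c wt⟩
  natCast_zero := zero_nsmul _
  natCast_succ _ := succ_nsmul _ _

instance : DirectSum.GRing (GrPiece c wt) where
  intCast m := m • symb c wt 0 ⟨1, one_mem_filt c wt⟩
  intCast_ofNat _ := natCast_zsmul _ _
  intCast_negSucc_ofNat _ := negSucc_zsmul _ _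

/-- The initial ideal: the left ideal of the associated graded ring generated by the classes in
`F_t / F_{<t}` of the elements of `I ∩ F_t`, for all `t`, i.e. by the initial forms of the elements
of `I`. -/
def initialIdeal (I : Ideal R) : Ideal (Gr c wt) :=
  Ideal.span {x | ∃ (t : ℝ) (a : filt c wt t), (a : R) ∈ I ∧
    x = DirectSum.of (GrPiece c wt) t (symb c wt t a)}

end Mul

/-- The part of weight `t` of an element of `F_t`, as a family of coefficients. -/
def levelPart (t : ℝ) : filt c wt t →+ (E → ℂ) where
  toFun a e := open Classical in if wt e = t then c a e else 0
  map_zero' := by ext e; simp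
  map_add' a b := by ext e; by_cases h : wt e = t <;> simp [h]

/-- The canonical embedding of the associated graded ring into the families of coefficients: the
class of `a` in `F_t / F_{<t}` is sent to the part of weight `t` of the series `a`.  Through it,
the elements of the associated graded rings for different weights are compared. -/
def normalForm : Gr c wt →+ (E → ℂ) :=
  DirectSum.toAddMonoid fun t => QuotientAddGroup.lift _ (levelPart c wt t) (by
    intro a ha
    rw [AddMonoidHom.mem_ker]
    ext e
    have ha' : (a : R) ∈ filtLT c wt t := AddSubgroup.mem_addSubgroupOf.1 ha
    by_cases h : wt e = t
    · by_contra hne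
      exact (ha' e (by simpa [levelPart, h] using hne)).ne h
    · simp [levelPart, h])

theorem normalForm_of_symb {t : ℝ} (a : filt c wt t) :
    normalForm c wt (DirectSum.of (GrPiece c wt) t (symb c wt t a)) = levelPart c wt t a :=
  DirectSum.toAddMonoid_of _ _ _

theorem normalForm_apply (x : Gr c wt) (e : E) (a : filt c wt (wt e))
    (ha : x (wt e) = symb c wt (wt e) a) : normalForm c wt x e = c a e := by
  classical
  have key : ∀ x : Gr c wt, normalForm c wt x e
      = normalForm c wt (DirectSum.of (GrPiece c wt) (wt e) (x (wt e))) e := by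
    intro x
    induction x using DirectSum.induction_on with
    | zero => simp
    | add x y hx hy =>
      rw [map_add, DirectSum.add_apply, map_add, map_add, Pi.add_apply, Pi.add_apply, hx, hy]
    | of t y =>
      by_cases h : t = wt e
      · subst h; simp
      · obtain ⟨b, rfl⟩ := symb_surjective c wt t y
        rw [DirectSum.of_eq_of_ne _ _ _ (Ne.symm h), map_zero, map_zero, normalForm_of_symb]
        simp [levelPart, Ne.symm h]
  rw [key, ha, normalForm_of_symb]
  simp [levelPart]

theorem normalForm_injective : Function.Injective (normalForm c wt) := by
  refine (injective_iff_map_eq_zero _).2 fun x hx => ?_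
  refine DFinsupp.ext fun t => ?_
  obtain ⟨a, ha⟩ := symb_surjective c wt t (x t)
  rw [← ha]
  refine (symb_eq_zero_iff c wt a).2 fun e he => ?_
  refine lt_of_le_of_ne (a.2 e he) fun h => he ?_
  subst h
  rw [← normalForm_apply c wt x e a ha.symm, hx]
  rfl

/-- The associated graded rings for two weights are equal: they have the same elements, and the
same addition and multiplication, after the canonical embedding. -/
def SameGr (wt' : E → ℝ) [IsWeight c wt] [IsWeight c wt'] : Prop :=
  ∃ φ : Gr c wt ≃+* Gr c wt', ∀ x, normalForm c wt' (φ x) = normalForm c wt x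

/-- Equality of the associated graded rings, and of the initial ideals of `I` in them. -/
def SameInitial (wt' : E → ℝ) [IsWeight c wt] [IsWeight c wt'] (I : Ideal R) : Prop :=
  SameGr c wt wt' ∧
    normalForm c wt '' (initialIdeal c wt I) = normalForm c wt' '' (initialIdeal c wt' I)

end Graded

section Fan

variable {R E V : Type*} [Ring R] (c : R →+ (E → ℂ)) {W : Set V} (wt : W → E → ℝ)
  [∀ w, IsWeight c (wt w)]

/-- The Gröbner cone `C_I[w]`: the weight vectors `w'` of `W` for which the associated graded ring
and the initial ideal of `I` are the same as for `w`.  In the noncommutative case `Ideal R` is the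
type of left ideals. -/
def grobnerCone (I : Ideal R) (w : W) : Set V :=
  {w' | ∃ h : w' ∈ W, SameInitial c (wt w) (wt ⟨w', h⟩) I}

/-- The open Gröbner fan `E(I, W)`: the set of all Gröbner cones. -/
def grobnerFan (I : Ideal R) : Set (Set V) := Set.range (grobnerCone c wt I)

end Fan

/-! ## Formal and convergent power series -/

/-- The ring `ℂ[[x₁, …, xₙ]]`. -/
abbrev FormalSeries (n : ℕ) : Type := MvPowerSeries (Fin n) ℂ

/-- The power series converges absolutely on some polydisc of positive radius around `0`. -/
def IsConvergent {n : ℕ} (f : FormalSeries n) : Prop :=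
  ∃ r : ℝ, 0 < r ∧ Summable fun α : Fin n →₀ ℕ => ‖MvPowerSeries.coeff α f‖ * r ^ α.degree

theorem IsConvergent.exists_le {n : ℕ} {f : FormalSeries n} (hf : IsConvergent f) :
    ∃ r : ℝ, 0 < r ∧ ∀ s : ℝ, 0 ≤ s → s ≤ r →
      Summable fun α : Fin n →₀ ℕ => ‖MvPowerSeries.coeff α f‖ * s ^ α.degree := by
  obtain ⟨r, hr, h⟩ := hf
  refine ⟨r, hr, fun s hs hsr => h.of_nonneg_of_le (fun α => by positivity) fun α => ?_⟩
  gcongr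

theorem isConvergent_C {n : ℕ} (a : ℂ) : IsConvergent (MvPowerSeries.C a : FormalSeries n) := by
  classical
  refine ⟨1, one_pos, summable_of_ne_finset_zero (s := {0}) fun α hα => ?_⟩
  have hα' : α ≠ 0 := by simpa using hα
  simp [MvPowerSeries.coeff_C, hα']

theorem IsConvergent.add {n : ℕ} {f g : FormalSeries n} (hf : IsConvergent f)
    (hg : IsConvergent g) : IsConvergent (f + g) := by
  obtain ⟨r, hr, h⟩ := hf.exists_le
  obtain ⟨s, hs, h'⟩ := hg.exists_le
  have hm : 0 < min r s := lt_min hr hs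
  refine ⟨min r s, hm, ((h _ hm.le (min_le_left _ _)).add
    (h' _ hm.le (min_le_right _ _))).of_nonneg_of_le (fun α => by positivity) fun α => ?_⟩
  rw [map_add, ← add_mul]
  gcongr
  exact norm_add_le _ _

theorem IsConvergent.neg {n : ℕ} {f : FormalSeries n} (hf : IsConvergent f) :
    IsConvergent (-f) := by
  obtain ⟨r, hr, h⟩ := hf
  exact ⟨r, hr, by simpa using h⟩

theorem IsConvergent.mul {n : ℕ} {f g : FormalSeries n} (hf : IsConvergent f)
    (hg : IsConvergent g) : IsConvergent (f * g) := by
  classical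
  obtain ⟨r, hr, h⟩ := hf.exists_le
  obtain ⟨s, hs, h'⟩ := hg.exists_le
  have hm : 0 < min r s := lt_min hr hs
  set m := min r s
  set F : (Fin n →₀ ℕ) → ℝ := fun α => ‖MvPowerSeries.coeff α f‖ * m ^ α.degree with hF
  set G : (Fin n →₀ ℕ) → ℝ := fun α => ‖MvPowerSeries.coeff α g‖ * m ^ α.degree with hG
  have hF0 : 0 ≤ F := fun α => by positivity
  have hG0 : 0 ≤ G := fun α => by positivity
  have h1 : Summable F := h m hm.le (min_le_left _ _)
  have h2 : Summable G := h' m hm.le (min_le_right _ _)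
  have h3 := summable_sum_mul_antidiagonal_of_summable_mul (f := F) (g := G)
    (h1.mul_of_nonneg h2 hF0 hG0)
  refine ⟨m, hm, h3.of_nonneg_of_le (fun α => by positivity) fun α => ?_⟩
  rw [MvPowerSeries.coeff_mul]
  have h4 : ∀ p ∈ Finset.HasAntidiagonal.antidiagonal α, F p.1 * G p.2
      = ‖MvPowerSeries.coeff p.1 f * MvPowerSeries.coeff p.2 g‖ * m ^ α.degree := by
    intro p hp
    rw [← Finset.HasAntidiagonal.mem_antidiagonal.1 hp, map_add, pow_add, norm_mul]
    simp only [hF, hG]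
    ring
  rw [Finset.sum_congr rfl h4, ← Finset.sum_mul]
  exact mul_le_mul_of_nonneg_right (norm_sum_le _ _) (by positivity)

theorem IsConvergent.pderiv {n : ℕ} {f : FormalSeries n} (hf : IsConvergent f) (i : Fin n) :
    IsConvergent (MvPowerSeries.pderiv ℂ i f) := by
  obtain ⟨r, hr, h⟩ := hf
  have hinj : Function.Injective fun α : Fin n →₀ ℕ => α + Finsupp.single i 1 :=
    add_left_injective _
  refine ⟨r / 2, by positivity, ((h.comp_injective hinj).mul_left (2 / r)).of_nonneg_of_le
    (fun α => by positivity) fun α => ?_⟩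
  have h1 : ((α i : ℝ) + 1) ≤ 2 * 2 ^ α.degree := by
    have h2 : α i + 1 ≤ 2 ^ (α i + 1) := Nat.lt_two_pow_self.le
    have h3 : (2 : ℕ) ^ (α i + 1) ≤ 2 ^ (α.degree + 1) :=
      Nat.pow_le_pow_right (by norm_num) (Nat.succ_le_succ (Finsupp.le_degree i α))
    have h4 := h2.trans h3
    rw [pow_succ, mul_comm] at h4
    exact_mod_cast h4
  have h5 : ‖((α i : ℂ) + 1)‖ = (α i : ℝ) + 1 := by
    rw [← Nat.cast_succ, Complex.norm_natCast, Nat.cast_succ]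
  simp only [Function.comp_apply]
  rw [MvPowerSeries.coeff_pderiv, norm_mul, h5, map_add, Finsupp.degree_single, pow_succ, div_pow]
  calc _ ≤ ‖MvPowerSeries.coeff (α + Finsupp.single i 1) f‖ * (2 * 2 ^ α.degree)
          * (r ^ α.degree / 2 ^ α.degree) := by gcongr
    _ = _ := by field_simp

/-- The ring of convergent power series, i.e. of germs at `0 ∈ ℂⁿ` of analytic functions. -/
def convergentSeries (n : ℕ) : Subring (FormalSeries n) where
  carrier := {f | IsConvergent f}
  zero_mem' := by simpa using isConvergent_C (n := n) 0
  one_mem' := by simpa using isConvergent_C (n := n) 1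
  add_mem' := IsConvergent.add
  neg_mem' := IsConvergent.neg
  mul_mem' := IsConvergent.mul

/-- The coefficients of a formal power series. -/
def coeffO (n : ℕ) : FormalSeries n →+ ((Fin n →₀ ℕ) → ℂ) where
  toFun f α := MvPowerSeries.coeff α f
  map_zero' := by ext; simp
  map_add' _ _ := by ext; simp

/-- The coefficients of a convergent power series. -/
def coeffO₀ (n : ℕ) : convergentSeries n →+ ((Fin n →₀ ℕ) → ℂ) :=
  (coeffO n).comp (convergentSeries n).subtype.toAddMonoidHom

/-- The local weight vectors for the commutative rings. -/
def Uloc (n : ℕ) : Set (Fin n → ℝ) := {u | ∀ i, u i ≤ 0}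

/-- The weight `u · α` of the exponent `α`. -/
def weightO {n : ℕ} (u : Uloc n) (α : Fin n →₀ ℕ) : ℝ := ∑ i, u.1 i * α i

theorem weightO_add {n : ℕ} (u : Uloc n) (α β : Fin n →₀ ℕ) :
    weightO u (α + β) = weightO u α + weightO u β := by
  simp [weightO, mul_add, Finset.sum_add_distrib]

instance {n : ℕ} (u : Uloc n) : IsWeight (coeffO n) (weightO u) where
  one_le e he := by
    classical
    have : e = 0 := by
      by_contra h
      exact he (by simp [coeffO, MvPowerSeries.coeff_one, h])
    simp [this, weightO]
  mul_le a b e he := by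
    classical
    have he' : ∑ p ∈ Finset.HasAntidiagonal.antidiagonal e,
        MvPowerSeries.coeff p.1 a * MvPowerSeries.coeff p.2 b ≠ 0 := by
      rw [← MvPowerSeries.coeff_mul]
      exact he
    obtain ⟨p, hp, hne⟩ := Finset.exists_ne_zero_of_sum_ne_zero he'
    refine ⟨p.1, p.2, left_ne_zero_of_mul hne, right_ne_zero_of_mul hne, le_of_eq ?_⟩
    rw [← weightO_add, Finset.HasAntidiagonal.mem_antidiagonal.1 hp]

instance {n : ℕ} (u : Uloc n) : IsWeight (coeffO₀ n) (weightO u) where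
  one_le e he := IsWeight.one_le (c := coeffO n) e he
  mul_le a b e he := IsWeight.mul_le (c := coeffO n) a.1 b.1 e he

/-! ## The homogenized rings of differential operators

An element is written uniquely as a finite sum of terms `c(x) ∂^β h^k`; it is represented by the
finitely supported family of the `c`, indexed by the pairs `(β, k)`. -/

/-- The `(0,1)`-homogenized ring of differential operators over `ℂ[[x₁, …, xₙ]]`: the `ℂ`-algebra
generated by `ℂ[[x]]`, `∂₁, …, ∂ₙ` and a central variable `h`, in which the `∂ᵢ` commute with each
other and `∂ᵢ c - c ∂ᵢ = (∂c/∂xᵢ) h` for `c ∈ ℂ[[x]]`.  Its ring structure is given below. -/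
def HD (n : ℕ) : Type := ((Fin n →₀ ℕ) × ℕ) →₀ FormalSeries n

namespace HD

variable {n : ℕ}

instance : AddCommGroup (HD n) := inferInstanceAs (AddCommGroup (_ →₀ FormalSeries n))
instance : Module ℂ (HD n) := inferInstanceAs (Module ℂ (_ →₀ FormalSeries n))

/-- The coefficient in `ℂ[[x]]` of `∂^β h^k`. -/
def coef (P : HD n) (b : (Fin n →₀ ℕ) × ℕ) : FormalSeries n := P.toFun b

/-- The term `c ∂^β h^k`, for `b = (β, k)`. -/
def term (b : (Fin n →₀ ℕ) × ℕ) : FormalSeries n →ₗ[ℂ] HD n := Finsupp.lsingle b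

@[ext] theorem ext {P Q : HD n} (h : ∀ b, coef P b = coef Q b) : P = Q := Finsupp.ext h

@[simp] theorem coef_zero (b) : coef (0 : HD n) b = 0 := rfl
@[simp] theorem coef_add (P Q : HD n) (b) : coef (P + Q) b = coef P b + coef Q b := rfl
@[simp] theorem coef_neg (P : HD n) (b) : coef (-P) b = -coef P b := rfl
theorem coef_term (b : (Fin n →₀ ℕ) × ℕ) (c : FormalSeries n) (b') :
    coef (term b c) b' = open Classical in if b = b' then c else 0 := Finsupp.single_apply

/-- Linear maps out of the ring, given on the terms. -/
def lift {M : Type*} [AddCommMonoid M] [Module ℂ M]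
    (φ : ((Fin n →₀ ℕ) × ℕ) → FormalSeries n →ₗ[ℂ] M) : HD n →ₗ[ℂ] M := Finsupp.lsum ℂ φ

@[simp] theorem lift_term {M : Type*} [AddCommMonoid M] [Module ℂ M]
    (φ : ((Fin n →₀ ℕ) × ℕ) → FormalSeries n →ₗ[ℂ] M) (b) (c : FormalSeries n) :
    lift φ (term b c) = φ b c := Finsupp.lsum_single _ _ _ _

theorem linearMap_ext {M : Type*} [AddCommMonoid M] [Module ℂ M] {φ ψ : HD n →ₗ[ℂ] M}
    (h : ∀ b c, φ (term b c) = ψ (term b c)) : φ = ψ := Finsupp.lhom_ext h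

/-- Left multiplication by `a ∈ ℂ[[x]]`: it sends `c ∂^β h^k` to `(a c) ∂^β h^k`. -/
def mulC : FormalSeries n →ₗ[ℂ] Module.End ℂ (HD n) where
  toFun a := lift fun b => (term b).comp (LinearMap.mulLeft ℂ a)
  map_add' a a' := linearMap_ext fun b c => by simp [add_mul]
  map_smul' z a := linearMap_ext fun b c => by simp

@[simp] theorem mulC_term (a : FormalSeries n) (b c) : mulC a (term b c) = term b (a * c) := by
  simp [mulC]

/-- Multiplication by `h`: it sends `c ∂^β h^k` to `c ∂^β h^(k+1)`. -/
def mulH : Module.End ℂ (HD n) := lift fun b => term (b.1, b.2 + 1)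

@[simp] theorem mulH_term (b) (c : FormalSeries n) :
    mulH (term b c) = term (b.1, b.2 + 1) c := by
  simp [mulH]

/-- Left multiplication by `∂ᵢ`: by the commutation relation `∂ᵢ c = c ∂ᵢ + (∂c/∂xᵢ) h` it sends
`c ∂^β h^k` to `c ∂^(β+eᵢ) h^k + (∂c/∂xᵢ) ∂^β h^(k+1)`. -/
def mulD (i : Fin n) : Module.End ℂ (HD n) :=
  lift fun b => term (b.1 + Finsupp.single i 1, b.2)
    + (term (b.1, b.2 + 1)).comp (MvPowerSeries.pderiv ℂ i).toLinearMap

@[simp] theorem mulD_term (i : Fin n) (b) (c : FormalSeries n) :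
    mulD i (term b c) = term (b.1 + Finsupp.single i 1, b.2) c
      + term (b.1, b.2 + 1) (MvPowerSeries.pderiv ℂ i c) := by
  simp [mulD]

theorem mulD_comm (i j : Fin n) : Commute (mulD i) (mulD j) := by
  refine linearMap_ext fun b c => ?_
  have h : MvPowerSeries.pderiv ℂ i (MvPowerSeries.pderiv ℂ j c)
      = MvPowerSeries.pderiv ℂ j (MvPowerSeries.pderiv ℂ i c) := by
    classical
    ext d
    simp only [MvPowerSeries.coeff_pderiv]
    by_cases hij : i = j
    · subst hij; rfl
    · have h1 : (Finsupp.single i 1 : Fin n →₀ ℕ) j = 0 := by simp [hij]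
      have h2 : (Finsupp.single j 1 : Fin n →₀ ℕ) i = 0 := by simp [Ne.symm hij]
      rw [Finsupp.add_apply, Finsupp.add_apply, h1, h2, add_right_comm d]
      push_cast
      ring
  simp only [Module.End.mul_apply, mulD_term, map_add, h, add_right_comm b.1]
  abel

theorem mulH_mulD (i : Fin n) : Commute mulH (mulD i) :=
  linearMap_ext fun b c => by simp

theorem mulH_mulC (a : FormalSeries n) : Commute mulH (mulC a) :=
  linearMap_ext fun b c => by simp

theorem mulC_mul (a a' : FormalSeries n) : mulC (a * a') = mulC a * mulC a' :=
  linearMap_ext fun b c => by simp [mul_assoc]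

@[simp] theorem mulC_one : mulC (1 : FormalSeries n) = 1 :=
  linearMap_ext fun b c => by simp

theorem mulD_mulC (i : Fin n) (a : FormalSeries n) :
    mulD i * mulC a = mulC a * mulD i + mulC (MvPowerSeries.pderiv ℂ i a) * mulH :=
  linearMap_ext fun b c => by
    simp [Derivation.leibniz, mul_comm c, add_assoc]

/-- Left multiplication by `∂^β = ∂₁^β₁ ⋯ ∂ₙ^βₙ`. -/
def mulDPow (β : Fin n →₀ ℕ) : Module.End ℂ (HD n) :=
  Finset.univ.noncommProd (fun i => mulD i ^ β i)
    fun i _ j _ _ => (mulD_comm i j).pow_pow (β i) (β j)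

@[simp] theorem mulDPow_zero : mulDPow (0 : Fin n →₀ ℕ) = 1 := by
  refine (Finset.noncommProd_eq_pow_card _ _ _ 1 fun i _ => ?_).trans (one_pow _)
  exact pow_zero _

theorem mulDPow_add (β γ : Fin n →₀ ℕ) : mulDPow (β + γ) = mulDPow β * mulDPow γ := by
  refine Eq.trans ?_ (Finset.noncommProd_mul_distrib (s := Finset.univ) (fun i => mulD i ^ β i)
    (fun i => mulD i ^ γ i) (fun i _ j _ _ => (mulD_comm i j).pow_pow _ _)
    (fun i _ j _ _ => (mulD_comm i j).pow_pow _ _)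
    (fun i _ j _ _ => (mulD_comm i j).pow_pow _ _))
  exact Finset.noncommProd_congr rfl (fun i _ => pow_add _ _ _) _

theorem mulDPow_single (i : Fin n) : mulDPow (Finsupp.single i 1) = mulD i := by
  classical
  have key : ∀ (f : Fin n → Module.End ℂ (HD n))
      (hf : ((Finset.univ : Finset (Fin n)) : Set (Fin n)).Pairwise (Function.onFun Commute f)),
      (∀ j, j ≠ i → f j = 1) → Finset.univ.noncommProd f hf = f i := by
    intro f hf h1
    refine (Finset.noncommProd_erase_mul Finset.univ (Finset.mem_univ i) f hf
      (hf.mono (Finset.coe_subset.2 (Finset.erase_subset _ _)))).symm.trans ?_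
    have h := Finset.noncommProd_eq_pow_card (Finset.univ.erase i) f
      (hf.mono (Finset.coe_subset.2 (Finset.erase_subset _ _))) 1
      fun j hj => h1 j (Finset.ne_of_mem_erase hj)
    exact (congrArg (· * f i) h).trans (by simp)
  refine (key _ _ fun j hj => ?_).trans ?_
  · simp [hj.symm]
  · simp

theorem mulDPow_commute {A : Module.End ℂ (HD n)} (hA : ∀ i, Commute A (mulD i))
    (β : Fin n →₀ ℕ) : Commute A (mulDPow β) :=
  Finset.noncommProd_commute _ _ _ _ fun i _ => (hA i).pow_right _

theorem mulDPow_term (β γ : Fin n →₀ ℕ) (k : ℕ) :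
    mulDPow β (term (γ, k) (1 : FormalSeries n)) = term (γ + β, k) 1 := by
  induction β using Finsupp.induction_linear generalizing γ with
  | zero => simp
  | add β β' h h' => rw [mulDPow_add, Module.End.mul_apply, h', h, add_right_comm, add_assoc]
  | single i m =>
    induction m generalizing γ with
    | zero => simp
    | succ m ih =>
      rw [add_comm m 1, Finsupp.single_add, mulDPow_add, Module.End.mul_apply, ih, mulDPow_single,
        mulD_term, MvPowerSeries.pderiv_one]
      simp [add_assoc, add_comm (Finsupp.single i 1)]

/-- Left multiplication by an element: the operator `Q ↦ P Q` for `P = ∑ c ∂^β h^k`. -/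
def mulLeft : HD n →ₗ[ℂ] Module.End ℂ (HD n) :=
  lift fun b => (LinearMap.mulRight ℂ (mulDPow b.1 * mulH ^ b.2)).comp mulC

theorem mulLeft_term (b) (c : FormalSeries n) :
    mulLeft (term b c) = mulC c * (mulDPow b.1 * mulH ^ b.2) := by
  simp [mulLeft, mul_assoc]

theorem mulLeft_mulC (a : FormalSeries n) (Q : HD n) :
    mulLeft (mulC a Q) = mulC a * mulLeft Q := by
  suffices h : mulLeft.comp (mulC a) = (LinearMap.mulLeft ℂ (mulC a)).comp mulLeft by
    simpa only [LinearMap.comp_apply, LinearMap.mulLeft_apply] using LinearMap.congr_fun h Q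
  refine linearMap_ext fun b c => ?_
  simp [mulLeft_term, mulC_mul, mul_assoc]

theorem commute_aux {M : Type*} [Monoid M] {H A B : M} (hA : Commute H A) (hB : Commute H B)
    (k : ℕ) : A * (B * H ^ (k + 1)) = H * (A * (B * H ^ k)) := by
  rw [pow_succ', ← mul_assoc, ← mul_assoc, ← (hA.mul_right hB).eq, mul_assoc, mul_assoc]

theorem mulLeft_mulH (Q : HD n) : mulLeft (mulH Q) = mulH * mulLeft Q := by
  suffices h : mulLeft.comp (mulH (n := n))
      = (LinearMap.mulLeft ℂ (mulH (n := n))).comp mulLeft from LinearMap.congr_fun h Q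
  refine linearMap_ext fun b c => ?_
  simp only [LinearMap.comp_apply, mulH_term, mulLeft_term, LinearMap.mulLeft_apply]
  exact commute_aux (mulH_mulC c) (mulDPow_commute mulH_mulD b.1) b.2

theorem mulLeft_mulD (i : Fin n) (Q : HD n) : mulLeft (mulD i Q) = mulD i * mulLeft Q := by
  suffices h : mulLeft.comp (mulD i) = (LinearMap.mulLeft ℂ (mulD i)).comp mulLeft by
    simpa only [LinearMap.comp_apply, LinearMap.mulLeft_apply] using LinearMap.congr_fun h Q
  refine linearMap_ext fun b c => ?_
  simp only [LinearMap.comp_apply, mulD_term, map_add, mulLeft_term, LinearMap.mulLeft_apply]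
  rw [commute_aux (mulH_mulC _) (mulDPow_commute mulH_mulD b.1) b.2, ← mul_assoc (mulD i),
    mulD_mulC, add_mul, add_comm b.1, mulDPow_add, mulDPow_single, ← (mulH_mulC _).eq]
  simp only [mul_assoc]

theorem mulLeft_mulLeft (P Q : HD n) : mulLeft (mulLeft P Q) = mulLeft P * mulLeft Q := by
  have hD : ∀ (β : Fin n →₀ ℕ) (Q : HD n), mulLeft (mulDPow β Q) = mulDPow β * mulLeft Q := by
    intro β
    induction β using Finsupp.induction_linear with
    | zero => simp
    | add β β' h h' => intro Q; rw [mulDPow_add, Module.End.mul_apply, h, h', mul_assoc]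
    | single i m =>
      induction m with
      | zero => simp
      | succ m ih =>
        intro Q
        rw [Finsupp.single_add, mulDPow_add, Module.End.mul_apply, ih, mulDPow_single,
          mulLeft_mulD, mul_assoc]
  have hH : ∀ (k : ℕ) (Q : HD n), mulLeft ((mulH ^ k) Q) = mulH ^ k * mulLeft Q := by
    intro k
    induction k with
    | zero => simp
    | succ k ih => intro Q; rw [pow_succ, Module.End.mul_apply, ih, mulLeft_mulH, mul_assoc]
  suffices h : mulLeft.comp ((LinearMap.applyₗ Q).comp mulLeft)
      = (LinearMap.mulRight ℂ (mulLeft Q)).comp mulLeft from LinearMap.congr_fun h P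
  refine linearMap_ext fun b c => ?_
  simp only [LinearMap.comp_apply, LinearMap.applyₗ_apply_apply, mulLeft_term,
    LinearMap.mulRight_apply, Module.End.mul_apply, mulLeft_mulC, hD, hH, mul_assoc]

instance : One (HD n) := ⟨term 0 1⟩
instance : Mul (HD n) := ⟨fun P Q => mulLeft P Q⟩

theorem one_def : (1 : HD n) = term 0 1 := rfl
theorem mul_def (P Q : HD n) : P * Q = mulLeft P Q := rfl

theorem mulH_pow_term (k : ℕ) (b) (c : FormalSeries n) :
    (mulH ^ k) (term b c) = term (b.1, b.2 + k) c := by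
  induction k generalizing b with
  | zero => simp
  | succ k ih => rw [pow_succ, Module.End.mul_apply, mulH_term, ih, add_assoc, add_comm 1]

instance : Ring (HD n) :=
  { (inferInstance : AddCommGroup (HD n)), (inferInstance : One (HD n)),
    (inferInstance : Mul (HD n)) with
    left_distrib := fun P Q Q' => (mulLeft P).map_add Q Q'
    right_distrib := fun P P' Q => by simp [mul_def]
    zero_mul := fun Q => by simp [mul_def]
    mul_zero := fun P => (mulLeft P).map_zero
    mul_assoc := fun P Q S => by simp only [mul_def, mulLeft_mulLeft, Module.End.mul_apply]
    one_mul := fun Q => by simp [mul_def, one_def, mulLeft_term]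
    mul_one := fun P => by
      suffices h : (LinearMap.applyₗ (term 0 1)).comp mulLeft = LinearMap.id from
        LinearMap.congr_fun h P
      refine linearMap_ext fun b c => ?_
      have h0 : (0 : (Fin n →₀ ℕ) × ℕ) = (0, 0) := rfl
      simp [mulLeft_term, mulH_pow_term, mulDPow_term, h0] }

/-! The defining relations. -/

/-- The inclusion of `ℂ[[x]]`. -/
def C : FormalSeries n →+* HD n where
  toFun a := term 0 a
  map_one' := rfl
  map_zero' := map_zero _
  map_add' := map_add _
  map_mul' a a' := by simp [mul_def, mulLeft_term]

/-- The generator `∂ᵢ`. -/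
def del (i : Fin n) : HD n := term (Finsupp.single i 1, 0) 1

/-- The generator `h`. -/
def h : HD n := term (0, 1) 1

theorem C_mul (a : FormalSeries n) (Q : HD n) : C a * Q = mulC a Q := by
  simp [C, mul_def, mulLeft_term]

theorem del_mul (i : Fin n) (Q : HD n) : del i * Q = mulD i Q := by
  simp [del, mul_def, mulLeft_term, mulDPow_single]

theorem h_mul (Q : HD n) : h * Q = mulH Q := by
  simp [h, mul_def, mulLeft_term]

theorem del_mul_C (i : Fin n) (a : FormalSeries n) :
    del i * C a - C a * del i = C (MvPowerSeries.pderiv ℂ i a) * h := by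
  rw [del_mul, C_mul, C_mul]
  simp [C, del, h]

theorem del_mul_del (i j : Fin n) : del i * del j = del j * del i := by
  rw [del_mul, del_mul]
  simp [del, add_comm]

theorem h_comm (Q : HD n) : h * Q = Q * h := by
  rw [h_mul, mul_def]
  suffices H : (mulH (n := n)) = (LinearMap.applyₗ h).comp mulLeft from LinearMap.congr_fun H Q
  refine linearMap_ext fun b c => ?_
  simp [h, mulLeft_term, mulH_pow_term, mulDPow_term, add_comm]

theorem eq_sum_term (P : HD n) : P = ∑ b ∈ P.support, term b (coef P b) :=
  (Finsupp.sum_single P).symm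

/-- The unique writing `P = ∑ c ∂^β h^k`. -/
theorem term_eq (b : (Fin n →₀ ℕ) × ℕ) (c : FormalSeries n) :
    term b c = C c * term (b.1, 0) 1 * h ^ b.2 := by
  have hk : ∀ k : ℕ, (h : HD n) ^ k = term (0, k) 1 := by
    intro k
    induction k with
    | zero => rfl
    | succ k ih => rw [pow_succ', ih, h_mul, mulH_term]
  rw [hk, mul_assoc, C_mul, mul_def, mulLeft_term]
  simp [mulDPow_term]

end HD

/-- Exponents `(α, (β, k))` of the monomials `x^α ∂^β h^k`. -/
abbrev ExpD (n : ℕ) : Type := (Fin n →₀ ℕ) × ((Fin n →₀ ℕ) × ℕ)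

/-- The coefficients of an element of the homogenized ring. -/
def coeffD (n : ℕ) : HD n →+ (ExpD n → ℂ) where
  toFun P e := MvPowerSeries.coeff e.1 (P.coef e.2)
  map_zero' := by ext; simp
  map_add' _ _ := by ext; simp

theorem coeffD_apply {n : ℕ} (P : HD n) (e : ExpD n) :
    coeffD n P e = MvPowerSeries.coeff e.1 (P.coef e.2) := rfl

theorem coeffD_term_ne {n : ℕ} {b} {c : FormalSeries n} {e : ExpD n}
    (he : coeffD n (HD.term b c) e ≠ 0) : e.2 = b ∧ MvPowerSeries.coeff e.1 c ≠ 0 := by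
  classical
  rw [coeffD_apply, HD.coef_term] at he
  by_cases hb : b = e.2
  · exact ⟨hb.symm, by simpa [hb] using he⟩
  · simp [hb] at he

theorem coeffD_linear_ne {n : ℕ} (A : HD n →ₗ[ℂ] HD n) (Q : HD n) {e : ExpD n}
    (he : coeffD n (A Q) e ≠ 0) : ∃ b, coeffD n (A (HD.term b (Q.coef b))) e ≠ 0 := by
  rw [HD.eq_sum_term Q, map_sum, map_sum, Finset.sum_apply] at he
  obtain ⟨b, -, hb⟩ := Finset.exists_ne_zero_of_sum_ne_zero he
  exact ⟨b, hb⟩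

/-- The local weight vectors `w = (u, v)` for the rings of differential operators. -/
def Wloc (n : ℕ) : Set ((Fin n → ℝ) × (Fin n → ℝ)) := {w | ∀ i, w.1 i ≤ 0 ∧ 0 ≤ w.1 i + w.2 i}

/-- The weight `u · α + v · β` of the exponent `(α, β, k)`; the variable `h` has weight `0`. -/
def weightD {n : ℕ} (w : Wloc n) (e : ExpD n) : ℝ :=
  ∑ i, w.1.1 i * e.1 i + ∑ i, w.1.2 i * e.2.1 i

/-- The operator `A` raises orders by at most `s`. -/
def Shifts {n : ℕ} (w : Wloc n) (s : ℝ) (A : Module.End ℂ (HD n)) : Prop :=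
  ∀ Q e, coeffD n (A Q) e ≠ 0 → ∃ e', coeffD n Q e' ≠ 0 ∧ weightD w e ≤ s + weightD w e'

theorem Shifts.one {n : ℕ} (w : Wloc n) : Shifts w 0 1 := fun Q e he => ⟨e, he, by simp⟩

theorem Shifts.mul {n : ℕ} {w : Wloc n} {s t : ℝ} {A B : Module.End ℂ (HD n)}
    (hA : Shifts w s A) (hB : Shifts w t B) : Shifts w (s + t) (A * B) := by
  intro Q e he
  obtain ⟨e', h', hl⟩ := hA (B Q) e he
  obtain ⟨e'', h'', hl'⟩ := hB Q e' h'
  exact ⟨e'', h'', by linarith⟩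

theorem shifts_mulH {n : ℕ} (w : Wloc n) : Shifts w 0 HD.mulH := by
  intro Q e he
  obtain ⟨b, hb⟩ := coeffD_linear_ne _ Q he
  rw [HD.mulH_term] at hb
  obtain ⟨h1, h2⟩ := coeffD_term_ne hb
  exact ⟨(e.1, b), h2, by simp [weightD, h1]⟩

theorem shifts_mulD {n : ℕ} (w : Wloc n) (i : Fin n) : Shifts w (w.1.2 i) (HD.mulD i) := by
  classical
  intro Q e he
  obtain ⟨b, hb⟩ := coeffD_linear_ne _ Q he
  rw [HD.mulD_term, map_add, Pi.add_apply] at hb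
  by_cases h0 : coeffD n (HD.term (b.1 + Finsupp.single i 1, b.2) (Q.coef b)) e = 0
  · rw [h0, zero_add] at hb
    obtain ⟨h1, h2⟩ := coeffD_term_ne hb
    rw [MvPowerSeries.coeff_pderiv] at h2
    refine ⟨(e.1 + Finsupp.single i 1, b), left_ne_zero_of_mul h2, ?_⟩
    have h3 := (w.2 i).2
    simp only [weightD, h1, Finsupp.add_apply, Nat.cast_add, mul_add, Finset.sum_add_distrib,
      Finsupp.single_apply, Nat.cast_ite, Nat.cast_one, Nat.cast_zero, mul_ite, mul_one, mul_zero,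
      Finset.sum_ite_eq, Finset.mem_univ, if_true]
    linarith
  · obtain ⟨h1, h2⟩ := coeffD_term_ne h0
    refine ⟨(e.1, b), h2, le_of_eq ?_⟩
    simp only [weightD, h1, Finsupp.add_apply, Nat.cast_add, mul_add, Finset.sum_add_distrib,
      Finsupp.single_apply, Nat.cast_ite, Nat.cast_one, Nat.cast_zero, mul_ite, mul_one, mul_zero,
      Finset.sum_ite_eq, Finset.mem_univ, if_true]
    ring

theorem shifts_mulH_pow {n : ℕ} (w : Wloc n) (k : ℕ) : Shifts w 0 (HD.mulH ^ k) := by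
  induction k with
  | zero => exact Shifts.one w
  | succ k ih => simpa [pow_succ] using ih.mul (shifts_mulH w)

theorem shifts_mulDPow {n : ℕ} (w : Wloc n) (β : Fin n →₀ ℕ) :
    Shifts w (∑ i, w.1.2 i * β i) (HD.mulDPow β) := by
  classical
  induction β using Finsupp.induction_linear with
  | zero => simpa using Shifts.one w
  | add β β' h h' =>
    simpa [HD.mulDPow_add, mul_add, Finset.sum_add_distrib] using h.mul h'
  | single i m =>
    induction m with
    | zero => simpa using Shifts.one w
    | succ m ih =>
      have := ih.mul (shifts_mulD w i)
      rw [Finsupp.single_add, HD.mulDPow_add, HD.mulDPow_single]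
      simpa [Finsupp.single_apply, mul_add, Finset.sum_add_distrib] using this

instance {n : ℕ} (w : Wloc n) : IsWeight (coeffD n) (weightD w) where
  one_le e he := by
    classical
    rw [HD.one_def] at he
    obtain ⟨h1, h2⟩ := coeffD_term_ne he
    have h3 : e.1 = 0 := by
      by_contra h
      exact h2 (by simp [MvPowerSeries.coeff_one, h])
    simp [weightD, h1, h3]
  mul_le P Q e he := by
    classical
    obtain ⟨b, hb⟩ := coeffD_linear_ne ((LinearMap.applyₗ Q).comp HD.mulLeft) P he
    rw [LinearMap.comp_apply, LinearMap.applyₗ_apply_apply, HD.mulLeft_term,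
      Module.End.mul_apply] at hb
    obtain ⟨b', hb'⟩ := coeffD_linear_ne _ _ hb
    rw [HD.mulC_term] at hb'
    obtain ⟨h1, h2⟩ := coeffD_term_ne hb'
    rw [MvPowerSeries.coeff_mul] at h2
    obtain ⟨p, hp, hne⟩ := Finset.exists_ne_zero_of_sum_ne_zero h2
    obtain ⟨e₂, h3, h4⟩ := ((shifts_mulDPow w b.1).mul (shifts_mulH_pow w b.2)) Q (p.2, b')
      (right_ne_zero_of_mul hne)
    refine ⟨(p.1, b), e₂, left_ne_zero_of_mul hne, h3, ?_⟩
    have h5 := Finset.HasAntidiagonal.mem_antidiagonal.1 hp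
    simp only [weightD, h1, ← h5, Finsupp.add_apply, Nat.cast_add, mul_add,
      Finset.sum_add_distrib] at h4 ⊢
    linarith

/-- The elements all of whose coefficients are convergent power series, as an additive group. -/
def convergentAddHD (n : ℕ) : AddSubgroup (HD n) where
  carrier := {P | ∀ b, IsConvergent (P.coef b)}
  zero_mem' b := by simpa using isConvergent_C (n := n) 0
  add_mem' hP hQ b := (hP b).add (hQ b)
  neg_mem' hP b := (hP b).neg

theorem term_mem_convergentAddHD {n : ℕ} (b) {c : FormalSeries n} (hc : IsConvergent c) :
    HD.term b c ∈ convergentAddHD n := by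
  classical
  intro b'
  rw [HD.coef_term]
  split_ifs
  · exact hc
  · simpa using isConvergent_C (n := n) 0

theorem map_mem_convergentAddHD {n : ℕ} (A : HD n →ₗ[ℂ] HD n)
    (hA : ∀ b c, IsConvergent c → A (HD.term b c) ∈ convergentAddHD n) {Q : HD n}
    (hQ : Q ∈ convergentAddHD n) : A Q ∈ convergentAddHD n := by
  rw [HD.eq_sum_term Q, map_sum]
  exact sum_mem fun b _ => hA b _ (hQ b)

theorem mulDPow_mem_convergentAddHD {n : ℕ} (β : Fin n →₀ ℕ) {Q : HD n}
    (hQ : Q ∈ convergentAddHD n) : HD.mulDPow β Q ∈ convergentAddHD n := by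
  induction β using Finsupp.induction_linear generalizing Q with
  | zero => simpa using hQ
  | add β β' h h' => rw [HD.mulDPow_add]; exact h (h' hQ)
  | single i m =>
    induction m generalizing Q with
    | zero => simpa using hQ
    | succ m ih =>
      rw [Finsupp.single_add, HD.mulDPow_add, HD.mulDPow_single]
      refine ih (map_mem_convergentAddHD _ (fun b c hc => ?_) hQ)
      rw [HD.mulD_term]
      exact add_mem (term_mem_convergentAddHD _ hc) (term_mem_convergentAddHD _ (hc.pderiv i))

/-- The `(0,1)`-homogenized ring of differential operators over the convergent power series: the
subring of the elements all of whose coefficients are convergent. -/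
def convergentHD (n : ℕ) : Subring (HD n) where
  __ := convergentAddHD n
  one_mem' := term_mem_convergentAddHD _ (by simpa using isConvergent_C (n := n) 1)
  mul_mem' {P Q} hP hQ := by
    refine map_mem_convergentAddHD ((LinearMap.applyₗ Q).comp HD.mulLeft) (fun b c hc => ?_) hP
    rw [LinearMap.comp_apply, LinearMap.applyₗ_apply_apply, HD.mulLeft_term]
    refine map_mem_convergentAddHD (HD.mulC c) (fun b' c' hc' => ?_)
      (mulDPow_mem_convergentAddHD b.1 (Q := (HD.mulH ^ b.2) Q) ?_)
    · rw [HD.mulC_term]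
      exact term_mem_convergentAddHD _ (hc.mul hc')
    · refine map_mem_convergentAddHD (HD.mulH ^ b.2) (fun b' c' hc' => ?_) hQ
      rw [HD.mulH_pow_term]
      exact term_mem_convergentAddHD _ hc'

/-- The coefficients of an element of the convergent homogenized ring. -/
def coeffD₀ (n : ℕ) : convergentHD n →+ (ExpD n → ℂ) :=
  (coeffD n).comp (convergentHD n).subtype.toAddMonoidHom

instance {n : ℕ} (w : Wloc n) : IsWeight (coeffD₀ n) (weightD w) where
  one_le e he := IsWeight.one_le (c := coeffD n) e he
  mul_le a b e he := IsWeight.mul_le (c := coeffD n) a.1 b.1 e he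

/-- Homogeneity with respect to the degree `|β| + k` of `x^α ∂^β h^k`. -/
def IsHomogeneous {n : ℕ} (P : HD n) : Prop :=
  ∃ d : ℕ, ∀ b, P.coef b ≠ 0 → b.1.degree + b.2 = d

/-- A left ideal of the convergent homogenized ring is homogeneous if it can be generated by
homogeneous elements. -/
def IsHomogeneousIdeal {n : ℕ} (I : Ideal (convergentHD n)) : Prop :=
  ∃ S : Set (convergentHD n), (∀ P ∈ S, IsHomogeneous (P : HD n)) ∧ Ideal.span S = I

end GrobnerFan

end

noncomputable section

namespace GrobnerFan

open scoped DirectSum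

/-! ### The graded ring seen through normal forms -/

section Abstract

variable {R E : Type*} [Ring R] (c : R →+ (E → ℂ)) (wt : E → ℝ)

/-! Write R₀ for the convergent ring, R for the formal one and Î for the left ideal R·I. It suffices
that the relation "same graded ring and same initial ideal" between two weights means the same thing
for (R₀, I) and for (R, Î); then the two fans agree cone by cone (`sameInitial_iff`).

Graded rings. Under the embedding, gr^w consists of the elements of the ring in which only finitely
many weights occur, and this class depends only on which u_i vanish. The product of power series
does not depend on the weight. For operators, the commutation relation between ∂_i and the
coefficients survives in gr^w when u_i + v_i = 0, and otherwise ∂_i becomes a commuting variable.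
Conversely the geometric series in x_i and the relation ∂_i x_i - x_i ∂_i = h detect these vanishing
conditions. The resulting criterion is the same over R₀ and over R (`sameGr_coeffO₀_iff`,
`sameGr_coeffD₀_iff`).

Initial ideals. Two facts let in_w(I) and in_w(Î) determine each other: in_w(Î) is generated by
in_w(I), and in_w(I) is the part of in_w(Î) with normal forms in R₀. They are filtered versions of
flatness and of faithful flatness of formal over convergent series. Because u ≤ 0, the conditions
"weight ≤ t" and "weight < t" on exponents are stable under multiplication by monomials in x, so
they cut out submodules. What is needed is that completion commutes with intersecting a module with
such a submodule (`SuppIn.mem_span_inf`), and that a convergent vector in a completed sum already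
lies in the sum (`exists_mem_sub_suppIn`).

Both rest on division with remainder in a free module of finite rank (`exists_division`). One
integer, a product of prime powers, orders the monomials and also defines weighted ℓ¹-norms, so the
same fixed point equation is contracting formally and, on small polydiscs, in norm. The bound on the
quotients gives an effective Artin–Rees argument (`mem_adicClosure_inf`).

For operators, the elements of a fixed degree |β| + k form a free module of finite rank over the
coefficient ring, and a homogeneous ideal contains the components of its elements. The module
statements are applied in each degree and the finitely many components are added up
(`isCompatible_HD`). -/

theorem of_mul_of_symb [IsWeight c wt] {s t : ℝ} (a : filt c wt s) (b : filt c wt t) :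
    DirectSum.of (GrPiece c wt) s (symb c wt s a) * DirectSum.of (GrPiece c wt) t (symb c wt t b)
      = DirectSum.of (GrPiece c wt) (s + t)
        (symb c wt (s + t) ⟨a * b, mul_mem_filt c wt a.2 b.2⟩) :=
  DirectSum.of_mul_of _ _

theorem levelPart_apply {t : ℝ} (a : filt c wt t) (e : E) :
    levelPart c wt t a e = open Classical in if wt e = t then c a e else 0 := rfl

/-- A homogeneous element of the associated graded ring lies in the initial ideal if and only if
it is the class of an element of the ideal. -/
theorem mem_initialIdeal [IsWeight c wt] {I : Ideal R} {x : Gr c wt} :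
    x ∈ initialIdeal c wt I ↔ ∀ t, ∃ a : filt c wt t, (a : R) ∈ I ∧ x t = symb c wt t a := by
  classical
  have add : ∀ x y : Gr c wt, (∀ t, ∃ a : filt c wt t, (a : R) ∈ I ∧ x t = symb c wt t a) →
      (∀ t, ∃ a : filt c wt t, (a : R) ∈ I ∧ y t = symb c wt t a) →
      ∀ t, ∃ a : filt c wt t, (a : R) ∈ I ∧ (x + y) t = symb c wt t a := by
    intro x y hx hy t
    obtain ⟨a, ha, hxa⟩ := hx t
    obtain ⟨b, hb, hyb⟩ := hy t
    exact ⟨a + b, I.add_mem ha hb, by rw [DirectSum.add_apply, hxa, hyb, map_add]⟩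
  have zero : ∀ t, ∃ a : filt c wt t, (a : R) ∈ I ∧ (0 : Gr c wt) t = symb c wt t a :=
    fun t => ⟨0, I.zero_mem, by simp⟩
  constructor
  · intro hx
    refine Submodule.closure_induction (p := fun x _ => ∀ t, ∃ a : filt c wt t,
      (a : R) ∈ I ∧ x t = symb c wt t a) zero (fun x y _ _ => add x y) ?_ hx
    rintro r _ ⟨t, a, ha, rfl⟩
    rw [smul_eq_mul]
    induction r using DirectSum.induction_on with
    | zero => rw [zero_mul]; exact zero
    | add r r' h h' => rw [add_mul]; exact add _ _ h h'
    | of s y =>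
      obtain ⟨b, rfl⟩ := symb_surjective c wt s y
      rw [of_mul_of_symb]
      intro t'
      by_cases h : s + t = t'
      · subst h
        exact ⟨_, I.mul_mem_left b ha, DirectSum.of_eq_same _ _⟩
      · exact ⟨0, I.zero_mem, by rw [DirectSum.of_eq_of_ne _ _ _ (Ne.symm h), map_zero]⟩
  · intro hx
    rw [← DirectSum.sum_support_of x]
    refine Ideal.sum_mem _ fun t _ => ?_
    obtain ⟨a, ha, h⟩ := hx t
    exact Ideal.subset_span ⟨t, a, ha, by rw [h]⟩

theorem exists_normalForm_eq_sum {T : Finset ℝ} (a : ∀ t, filt c wt t) :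
    normalForm c wt (∑ t ∈ T, DirectSum.of (GrPiece c wt) t (symb c wt t (a t)))
      = ∑ t ∈ T, levelPart c wt t (a t) := by
  rw [map_sum]
  exact Finset.sum_congr rfl fun t _ => normalForm_of_symb c wt (a t)

/-- The parts of given weight of the elements of the ring belong to the ring. -/
def HasLevels : Prop :=
  ∀ (t : ℝ) (p : R), ∃ q : R, ∀ e, c q e = open Classical in if wt e = t then c p e else 0

/-- Only finitely many weights occur in `f`. -/
def FinLevels (f : E → ℂ) : Prop := (wt '' {e | f e ≠ 0}).Finite

variable {c wt}

theorem FinLevels.add {f g : E → ℂ} (hf : FinLevels wt f) (hg : FinLevels wt g) :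
    FinLevels wt (f + g) := by
  refine (hf.union hg).subset ?_
  rintro _ ⟨e, he, rfl⟩
  by_cases h : f e = 0
  · exact Or.inr ⟨e, by simpa [h] using he, rfl⟩
  · exact Or.inl ⟨e, h, rfl⟩

theorem finLevels_normalForm (x : Gr c wt) : FinLevels wt (normalForm c wt x) := by
  induction x using DirectSum.induction_on with
  | zero => simp [FinLevels]
  | add x y hx hy => rw [map_add]; exact hx.add hy
  | of t y =>
    obtain ⟨a, rfl⟩ := symb_surjective c wt t y
    rw [normalForm_of_symb]
    refine (Set.finite_singleton t).subset ?_
    rintro _ ⟨e, he, rfl⟩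
    by_contra h
    exact he (if_neg fun h' => h h')

/-- Together with `finLevels_normalForm` and `HasLevels.exists_normalForm_eq` this identifies the
image of the graded ring: the coefficient families of ring elements in which finitely many weights
occur. -/
theorem HasLevels.normalForm_mem_range (hl : HasLevels c wt) (x : Gr c wt) :
    ∃ p, c p = normalForm c wt x := by
  induction x using DirectSum.induction_on with
  | zero => exact ⟨0, by simp⟩
  | add x y hx hy =>
    obtain ⟨p, hp⟩ := hx
    obtain ⟨q, hq⟩ := hy
    exact ⟨p + q, by rw [map_add, map_add, hp, hq]⟩
  | of t y =>
    obtain ⟨a, rfl⟩ := symb_surjective c wt t y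
    obtain ⟨q, hq⟩ := hl t a
    exact ⟨q, by rw [normalForm_of_symb]; ext e; exact hq e⟩

theorem HasLevels.exists_normalForm_eq (hl : HasLevels c wt) {p : R} (hp : FinLevels wt (c p)) :
    ∃ x, normalForm c wt x = c p := by
  classical
  choose q hq using fun t => hl t p
  have hqt : ∀ t, q t ∈ filt c wt t := by
    intro t e he
    rw [hq] at he
    by_contra h
    exact he (if_neg fun h' => h h'.le)
  refine ⟨_, (exists_normalForm_eq_sum c wt (T := hp.toFinset) fun t => ⟨q t, hqt t⟩).trans ?_⟩
  ext e
  rw [Finset.sum_apply]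
  by_cases he : c p e = 0
  · rw [he]
    refine Finset.sum_eq_zero fun t _ => ?_
    simp [levelPart_apply, hq, he]
  · rw [Finset.sum_eq_single (wt e)]
    · simp [levelPart_apply, hq]
    · intro t _ ht
      simp [levelPart_apply, Ne.symm ht]
    · intro h
      exact absurd (hp.mem_toFinset.2 ⟨e, he, rfl⟩) h

/-- `star` computes the product of the associated graded ring on the normal forms. -/
def IsSymbolProduct (c : R →+ (E → ℂ)) (wt : E → ℝ) [IsWeight c wt]
    (star : R → R → (E → ℂ)) : Prop :=
  ∀ s t (a : filt c wt s) (b : filt c wt t) (p q : R), c p = levelPart c wt s a →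
    c q = levelPart c wt t b →
    levelPart c wt (s + t) ⟨a * b, mul_mem_filt c wt a.2 b.2⟩ = star p q

/-- Both sides are biadditive, so everything reduces to a product of two symbols, where it is the
hypothesis on `star`. Injectivity of `c` makes `p` and `q` additive in `x` and `y`. -/
theorem normalForm_mul [IsWeight c wt] (hc : Function.Injective c) (hl : HasLevels c wt)
    {star : R →+ R →+ (E → ℂ)} (hs : IsSymbolProduct c wt fun p q => star p q)
    (x y : Gr c wt) (p q : R) (hp : c p = normalForm c wt x) (hq : c q = normalForm c wt y) :
    normalForm c wt (x * y) = star p q := by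
  induction x using DirectSum.induction_on generalizing p with
  | zero =>
    have : p = 0 := hc (by simpa using hp)
    simp [this]
  | add x x' hx hx' =>
    obtain ⟨p₁, h₁⟩ := hl.normalForm_mem_range x
    obtain ⟨p₂, h₂⟩ := hl.normalForm_mem_range x'
    have : p = p₁ + p₂ := hc (by rw [hp, map_add, map_add, h₁, h₂])
    rw [add_mul, map_add, hx p₁ h₁, hx' p₂ h₂, this, map_add, AddMonoidHom.add_apply]
  | of s u =>
    obtain ⟨a, rfl⟩ := symb_surjective c wt s u
    induction y using DirectSum.induction_on generalizing q with
    | zero =>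
      have : q = 0 := hc (by simpa using hq)
      simp [this]
    | add y y' hy hy' =>
      obtain ⟨q₁, h₁⟩ := hl.normalForm_mem_range y
      obtain ⟨q₂, h₂⟩ := hl.normalForm_mem_range y'
      have : q = q₁ + q₂ := hc (by rw [hq, map_add, map_add, h₁, h₂])
      rw [mul_add, map_add, hy q₁ h₁, hy' q₂ h₂, this, map_add]
    | of t v =>
      obtain ⟨b, rfl⟩ := symb_surjective c wt t v
      rw [normalForm_of_symb] at hp hq
      rw [of_mul_of_symb, normalForm_of_symb]
      exact hs s t a b p q hp hq

/-- The finiteness condition makes the two images equal as sets, and a single `star` computing both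
products makes the resulting bijection multiplicative. -/
theorem sameGr_of_symbolProduct {wt' : E → ℝ} [IsWeight c wt] [IsWeight c wt']
    (hc : Function.Injective c) (hl : HasLevels c wt) (hl' : HasLevels c wt')
    (hfin : ∀ p, FinLevels wt (c p) ↔ FinLevels wt' (c p))
    (star : R →+ R →+ (E → ℂ)) (hs : IsSymbolProduct c wt fun p q => star p q)
    (hs' : IsSymbolProduct c wt' fun p q => star p q) : SameGr c wt wt' := by
  have h1 : ∀ x : Gr c wt, ∃ y : Gr c wt', normalForm c wt' y = normalForm c wt x := by
    intro x
    obtain ⟨p, hp⟩ := hl.normalForm_mem_range x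
    rw [← hp]
    exact hl'.exists_normalForm_eq ((hfin p).1 (hp ▸ finLevels_normalForm x))
  have h2 : ∀ y : Gr c wt', ∃ x : Gr c wt, normalForm c wt x = normalForm c wt' y := by
    intro x
    obtain ⟨p, hp⟩ := hl'.normalForm_mem_range x
    rw [← hp]
    exact hl.exists_normalForm_eq ((hfin p).2 (hp ▸ finLevels_normalForm x))
  choose f hf using h1
  choose g hg using h2
  refine ⟨{ toFun := f, invFun := g, left_inv := ?_, right_inv := ?_, map_mul' := ?_,
            map_add' := ?_ }, hf⟩
  · intro x; exact normalForm_injective c wt (by rw [hg, hf])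
  · intro x; exact normalForm_injective c wt' (by rw [hf, hg])
  · intro x y
    obtain ⟨p, hp⟩ := hl.normalForm_mem_range x
    obtain ⟨q, hq⟩ := hl.normalForm_mem_range y
    refine normalForm_injective c wt' ?_
    rw [hf, normalForm_mul hc hl hs x y p q hp hq,
      normalForm_mul hc hl' hs' (f x) (f y) p q (by rw [hf, hp]) (by rw [hf, hq])]
  · intro x y; exact normalForm_injective c wt' (by rw [hf, map_add, map_add, hf, hf])

end Abstract

/-! ### Initial ideals under extension of the coefficient ring -/

section Extension

variable {R₀ R E : Type*} [Ring R₀] [Ring R]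

/-- The extension `j` of coefficient rings is compatible with the formation of the initial ideal
of `I`. -/
structure IsCompatible (c₀ : R₀ →+ (E → ℂ)) (c : R →+ (E → ℂ)) (j : R₀ →+* R)
    (wt : E → ℝ) (I : Ideal R₀) : Prop where
  hasLevels : HasLevels c₀ wt
  mem_closure : ∀ t, ∀ a ∈ I.map j, a ∈ filt c wt t → a ∈ AddSubgroup.closure
    {x | ∃ d ∈ filt c wt 0, ∃ a₀ ∈ I, a₀ ∈ filt c₀ wt t ∧ x = d * j a₀}
  exists_sub_mem : ∀ t, ∀ p ∈ filt c₀ wt t, ∀ a ∈ I.map j, a ∈ filt c wt t →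
    j p - a ∈ filtLT c wt t → ∃ a₀ ∈ I, a₀ ∈ filt c₀ wt t ∧ p - a₀ ∈ filtLT c₀ wt t

variable {c₀ : R₀ →+ (E → ℂ)} {c : R →+ (E → ℂ)} {j : R₀ →+* R} {wt wt' : E → ℝ}
  [IsWeight c₀ wt] [IsWeight c₀ wt'] [IsWeight c wt] [IsWeight c wt'] {I : Ideal R₀}

theorem normalForm_image_subset (hc : ∀ a, c (j a) = c₀ a) :
    normalForm c₀ wt '' (initialIdeal c₀ wt I) ⊆
      normalForm c wt '' (initialIdeal c wt (I.map j)) := by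
  classical
  rintro _ ⟨x, hx, rfl⟩
  choose a ha hxa using (mem_initialIdeal c₀ wt).1 hx
  have hja : ∀ t, j (a t) ∈ filt c wt t := fun t e he => (a t).2 e (by rwa [← hc])
  refine ⟨∑ t ∈ DFinsupp.support x,
    DirectSum.of (GrPiece c wt) t (symb c wt t ⟨j (a t), hja t⟩), ?_, ?_⟩
  · exact Ideal.sum_mem _ fun t _ => Ideal.subset_span
      ⟨t, _, Ideal.mem_map_of_mem j (ha t), rfl⟩
  · rw [exists_normalForm_eq_sum c wt (fun t => ⟨j (a t), hja t⟩)]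
    conv_rhs => rw [← DirectSum.sum_support_of x]
    simp only [hxa]
    rw [exists_normalForm_eq_sum]
    refine Finset.sum_congr rfl fun t _ => ?_
    ext e
    simp [levelPart_apply, hc]

/-- Contraction, the faithfully flat half. If the normal form of `x` comes from `p` in the small
ring, its weight `t` part `q t` agrees modulo lower order with some element of the extended ideal;
`exists_sub_mem` replaces that element by one of `I`. -/
theorem IsCompatible.normalForm_image (h : IsCompatible c₀ c j wt I) (hc : ∀ a, c (j a) = c₀ a) :
    normalForm c₀ wt '' (initialIdeal c₀ wt I) =
      normalForm c wt '' (initialIdeal c wt (I.map j)) ∩ Set.range c₀ := by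
  classical
  refine Set.Subset.antisymm (Set.subset_inter (normalForm_image_subset hc) ?_) ?_
  · rintro _ ⟨x, -, rfl⟩
    exact h.hasLevels.normalForm_mem_range x
  · rintro _ ⟨⟨x, hx, rfl⟩, p, hp⟩
    choose a ha hxa using (mem_initialIdeal c wt).1 hx
    choose q hq using fun t => h.hasLevels t p
    have hpe : ∀ e, c₀ p e = c (a (wt e)) e := fun e => by
      rw [hp, normalForm_apply c wt x e (a (wt e)) (hxa _)]
    have hqt : ∀ t, q t ∈ filt c₀ wt t := by
      intro t e he
      rw [hq] at he
      by_contra h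
      exact he (if_neg fun h' => h h'.le)
    have hsub : ∀ t, j (q t) - a t ∈ filtLT c wt t := by
      intro t e he
      rw [map_sub, Pi.sub_apply, hc, hq] at he
      by_cases h' : wt e = t
      · subst h'
        simp [hpe] at he
      · rw [if_neg h', zero_sub, neg_ne_zero] at he
        exact lt_of_le_of_ne ((a t).2 e he) h'
    choose b hb hbt hqb using fun t => h.exists_sub_mem t (q t) (hqt t) (a t) (ha t) (a t).2 (hsub t)
    refine ⟨∑ t ∈ DFinsupp.support x,
      DirectSum.of (GrPiece c₀ wt) t (symb c₀ wt t ⟨b t, hbt t⟩), ?_, ?_⟩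
    · exact Ideal.sum_mem _ fun t _ => Ideal.subset_span ⟨t, _, hb t, rfl⟩
    · rw [exists_normalForm_eq_sum c₀ wt (fun t => ⟨b t, hbt t⟩)]
      conv_rhs => rw [← DirectSum.sum_support_of x]
      simp only [hxa]
      rw [exists_normalForm_eq_sum]
      refine Finset.sum_congr rfl fun t _ => ?_
      ext e
      simp only [levelPart_apply]
      split_ifs with h'
      · have h1 : c₀ (q t - b t) e = 0 := by
          by_contra hne
          exact (hqb t e hne).ne h'
        rw [map_sub, Pi.sub_apply, sub_eq_zero, hq, if_pos h', hpe] at h1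
        rw [← h1, h']
      · rfl

/-- Generation, the flat half. An element of the extended ideal of order at most `t` is a sum of
products `d * j a₀` in which `d` has order at most 0 and `a₀` order at most `t`. No cancellation
above level `t` takes place, so its symbol is the sum of the products of the symbols. -/
theorem IsCompatible.initialIdeal_eq_span (h : IsCompatible c₀ c j wt I)
    (hc : ∀ a, c (j a) = c₀ a) :
    initialIdeal c wt (I.map j) =
      Ideal.span {x | normalForm c wt x ∈ normalForm c₀ wt '' (initialIdeal c₀ wt I)} := by
  apply le_antisymm
  · refine Ideal.span_le.2 ?_
    rintro _ ⟨t, ⟨a, hat⟩, ha, rfl⟩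
    have hmem := h.mem_closure t a ha hat
    have hle : AddSubgroup.closure
        {x | ∃ d ∈ filt c wt 0, ∃ a₀ ∈ I, a₀ ∈ filt c₀ wt t ∧ x = d * j a₀} ≤ filt c wt t := by
      rw [AddSubgroup.closure_le]
      rintro _ ⟨d, hd, a₀, -, hat₀, rfl⟩
      have h1 : j a₀ ∈ filt c wt t := fun e he => hat₀ e (by rwa [← hc])
      have := mul_mem_filt c wt hd h1
      rwa [zero_add] at this
    have key : ∀ a (ha : a ∈ AddSubgroup.closure
        {x | ∃ d ∈ filt c wt 0, ∃ a₀ ∈ I, a₀ ∈ filt c₀ wt t ∧ x = d * j a₀}),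
        DirectSum.of (GrPiece c wt) t (symb c wt t ⟨a, hle ha⟩) ∈
        Ideal.span {x | normalForm c wt x ∈ normalForm c₀ wt '' (initialIdeal c₀ wt I)} := by
      intro a ha
      induction ha using AddSubgroup.closure_induction with
      | mem x hx =>
        obtain ⟨d, hd, a₀, ha₀, hat₀, rfl⟩ := hx
        have h1 : j a₀ ∈ filt c wt t := fun e he => hat₀ e (by rwa [← hc])
        have h2 : DirectSum.of (GrPiece c wt) t (symb c wt t ⟨d * j a₀, hle (AddSubgroup.subset_closure
            ⟨d, hd, a₀, ha₀, hat₀, rfl⟩)⟩)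
            = DirectSum.of (GrPiece c wt) 0 (symb c wt 0 ⟨d, hd⟩) *
              DirectSum.of (GrPiece c wt) t (symb c wt t ⟨j a₀, h1⟩) := by
          rw [of_mul_of_symb]
          exact DirectSum.of_eq_of_gradedMonoid_eq (symb_mk_eq c wt (zero_add t).symm _ _ rfl)
        rw [h2]
        refine Ideal.mul_mem_left _ _ (Ideal.subset_span ?_)
        refine ⟨DirectSum.of (GrPiece c₀ wt) t (symb c₀ wt t ⟨a₀, hat₀⟩),
          Ideal.subset_span ⟨t, _, ha₀, rfl⟩, ?_⟩
        rw [normalForm_of_symb, normalForm_of_symb]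
        ext e
        simp [levelPart_apply, hc]
      | zero =>
        have : (⟨0, hle (zero_mem _)⟩ : filt c wt t) = 0 := rfl
        rw [this, map_zero, map_zero]
        exact zero_mem _
      | add x y hx hy hx' hy' =>
        have : (⟨x + y, hle (add_mem hx hy)⟩ : filt c wt t) = ⟨x, hle hx⟩ + ⟨y, hle hy⟩ := rfl
        rw [this, map_add, map_add]
        exact add_mem hx' hy'
      | neg x hx hx' =>
        have : (⟨-x, hle (neg_mem hx)⟩ : filt c wt t) = -⟨x, hle hx⟩ := rfl
        rw [this, map_neg, map_neg]
        exact neg_mem hx'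
    exact key a hmem
  · refine Ideal.span_le.2 fun x hx => ?_
    obtain ⟨y, hy, hxy⟩ := normalForm_image_subset hc hx
    rwa [← normalForm_injective c wt hxy]

/-- Going up, the isomorphism of graded rings carries generators to generators, since they are
described by normal forms alone. Going down, both initial ideals are cut out by the range of `c₀`.
-/
theorem sameInitial_iff (h : IsCompatible c₀ c j wt I) (h' : IsCompatible c₀ c j wt' I)
    (hc : ∀ a, c (j a) = c₀ a) (hgr : SameGr c₀ wt wt' ↔ SameGr c wt wt') :
    SameInitial c₀ wt wt' I ↔ SameInitial c wt wt' (I.map j) := by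
  refine ⟨fun H => ⟨hgr.1 H.1, ?_⟩, fun H => ⟨hgr.2 H.1, ?_⟩⟩
  · obtain ⟨φ, hφ⟩ := hgr.1 H.1
    have hmap : (initialIdeal c wt (I.map j)).map (φ : Gr c wt →+* Gr c wt')
        = initialIdeal c wt' (I.map j) := by
      rw [h.initialIdeal_eq_span hc, h'.initialIdeal_eq_span hc, ← H.2, Ideal.map_span]
      congr 1
      ext y
      constructor
      · rintro ⟨x, hx, rfl⟩
        rw [Set.mem_ofPred_eq] at hx ⊢
        rwa [RingEquiv.coe_toRingHom, hφ]
      · intro hy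
        refine ⟨φ.symm y, ?_, φ.apply_symm_apply y⟩
        rw [Set.mem_ofPred_eq] at hy ⊢
        rwa [← hφ, φ.apply_symm_apply]
    rw [← hmap]
    ext f
    constructor
    · rintro ⟨x, hx, rfl⟩
      exact ⟨φ x, Ideal.mem_map_of_mem _ hx, hφ x⟩
    · rintro ⟨y, hy, rfl⟩
      obtain ⟨x, hx, rfl⟩ := (Ideal.mem_map_iff_of_surjective (φ : Gr c wt →+* Gr c wt')
        φ.surjective).1 hy
      exact ⟨x, hx, (hφ x).symm⟩
  · rw [h.normalForm_image hc, h'.normalForm_image hc, H.2]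

end Extension


open scoped ENNReal

/-! ### Encoding monomials by products of primes -/

section Key

variable {n : ℕ}

/-- The value of the monomial `x^α` at the point whose coordinates are the first `n` primes. It is
multiplicative and separates the monomials. -/
def expNorm (α : Fin n →₀ ℕ) : ℕ := ∏ i : Fin n, (Nat.nth Nat.Prime i) ^ α i

theorem expNorm_add (α β : Fin n →₀ ℕ) : expNorm (α + β) = expNorm α * expNorm β := by
  simp [expNorm, pow_add, Finset.prod_mul_distrib]

theorem expNorm_pos (α : Fin n →₀ ℕ) : 0 < expNorm α :=
  Finset.prod_pos fun i _ => pow_pos (Nat.prime_nth_prime i).pos _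

theorem two_pow_degree_le_expNorm (α : Fin n →₀ ℕ) : 2 ^ α.degree ≤ expNorm α := by
  rw [Finsupp.degree_eq_sum, ← Finset.prod_pow_eq_pow_sum]
  exact Finset.prod_le_prod' fun i _ => Nat.pow_le_pow_left (Nat.prime_nth_prime i).two_le _

theorem expNorm_le_pow_degree (α : Fin n →₀ ℕ) :
    expNorm α ≤ (∏ i : Fin n, Nat.nth Nat.Prime i) ^ α.degree := by
  rw [Finsupp.degree_eq_sum, ← Finset.prod_pow_eq_pow_sum]
  refine Finset.prod_le_prod' fun i _ => Nat.pow_le_pow_left ?_ _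
  exact Finset.single_le_prod' (f := fun i : Fin n => Nat.nth Nat.Prime i)
    (fun i _ => (Nat.prime_nth_prime i).one_le) (Finset.mem_univ i)

variable {ι : Type*} [Fintype ι]

/-- The prime attached to a coordinate of a free module. -/
def coordPrime (n : ℕ) (j : ι) : ℕ := Nat.nth Nat.Prime (n + Fintype.equivFin ι j)

theorem coordPrime_pos (j : ι) : 0 < coordPrime n j := (Nat.prime_nth_prime _).pos

/-- The extension of `expNorm` to the monomials of a free module. -/
def key (e : (Fin n →₀ ℕ) × ι) : ℕ := expNorm e.1 * coordPrime n e.2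

theorem key_pos (e : (Fin n →₀ ℕ) × ι) : 0 < key e := mul_pos (expNorm_pos _) (coordPrime_pos _)

theorem key_add (β α : Fin n →₀ ℕ) (j : ι) : key (β + α, j) = expNorm β * key (α, j) := by
  simp [key, expNorm_add, mul_assoc]

/-- Unique factorization: the first `n` primes record the exponent and the later ones the
coordinate. Hence comparing keys is a total order on the monomials with finite initial segments,
compatible with multiplication. -/
theorem key_injective : Function.Injective (key : (Fin n →₀ ℕ) × ι → ℕ) := by
  classical
  have hinj := Nat.nth_injective Nat.infinite_setOfPred_prime
  rintro ⟨α, j⟩ ⟨β, k⟩ h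
  have hfact : ∀ (α : Fin n →₀ ℕ) (j : ι) (m : ℕ),
      (key (α, j)).factorization (Nat.nth Nat.Prime m) =
        ∑ i : Fin n, (if (i : ℕ) = m then α i else 0)
          + if n + (Fintype.equivFin ι j : ℕ) = m then 1 else 0 := by
    intro α j m
    rw [key, Nat.factorization_mul (expNorm_pos _).ne' (coordPrime_pos _).ne', Finsupp.add_apply,
      expNorm, Nat.factorization_prod (g := fun i : Fin n => Nat.nth Nat.Prime i ^ α i)
        fun i _ => (pow_pos (Nat.prime_nth_prime i).pos _).ne',
      Finsupp.finsetSum_apply, coordPrime, (Nat.prime_nth_prime _).factorization,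
      Finsupp.single_apply]
    simp only [(Nat.prime_nth_prime _).factorization_pow, Finsupp.single_apply, hinj.eq_iff]
  have hm : ∀ m, _ := fun m => (hfact α j m).symm.trans ((congrArg (fun a : ℕ =>
    a.factorization (Nat.nth Nat.Prime m)) h).trans (hfact β k m))
  have hα : α = β := by
    ext i
    have := hm i
    have h1 : ∀ j : ι, ¬ (n + (Fintype.equivFin ι j : ℕ) = i) := fun j => by omega
    simpa [h1, Fin.val_inj] using this
  have hj : j = k := by
    have := hm (n + Fintype.equivFin ι j)
    have h1 : ∀ i : Fin n, ¬ ((i : ℕ) = n + (Fintype.equivFin ι j : ℕ)) := fun i => by omega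
    simp only [h1, if_false, Finset.sum_const_zero, if_true, zero_add] at this
    split_ifs at this with h2
    exact ((Fintype.equivFin ι).injective (Fin.ext (by omega))).symm
  rw [hα, hj]

end Key

/-! ### Weighted ℓ¹-norms and convergence -/

section Norm

variable {n : ℕ}

/-- The weighted `ℓ¹`-norm of a power series on a polydisc that shrinks as `s` grows. -/
def wnorm (s : ℕ) (f : FormalSeries n) : ℝ≥0∞ :=
  ∑' α, ‖MvPowerSeries.coeff α f‖ₑ * (expNorm α : ℝ≥0∞)⁻¹ ^ s

theorem wnorm_add_le (s : ℕ) (f g : FormalSeries n) :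
    wnorm s (f + g) ≤ wnorm s f + wnorm s g := by
  rw [wnorm, wnorm, wnorm, ← ENNReal.tsum_add]
  refine ENNReal.tsum_le_tsum fun α => ?_
  rw [map_add, ← add_mul]
  gcongr
  exact enorm_add_le _ _

theorem wnorm_mono {s t : ℕ} (h : s ≤ t) (f : FormalSeries n) : wnorm t f ≤ wnorm s f := by
  refine ENNReal.tsum_le_tsum fun α => mul_le_mul_right ?_ _
  refine pow_le_pow_right_of_le_one' (ENNReal.inv_le_one.2 ?_) h
  exact_mod_cast expNorm_pos α

theorem wnorm_mul_le (s : ℕ) (f g : FormalSeries n) :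
    wnorm s (f * g) ≤ wnorm s f * wnorm s g := by
  classical
  have h : ∀ α, ‖MvPowerSeries.coeff α (f * g)‖ₑ * (expNorm α : ℝ≥0∞)⁻¹ ^ s ≤
      ∑' p : Finset.HasAntidiagonal.antidiagonal α,
        (‖MvPowerSeries.coeff p.1.1 f‖ₑ * (expNorm p.1.1 : ℝ≥0∞)⁻¹ ^ s) *
          (‖MvPowerSeries.coeff p.1.2 g‖ₑ * (expNorm p.1.2 : ℝ≥0∞)⁻¹ ^ s) := by
    intro α
    rw [MvPowerSeries.coeff_mul, Finset.tsum_subtype (Finset.HasAntidiagonal.antidiagonal α)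
      fun p => (‖MvPowerSeries.coeff p.1 f‖ₑ * (expNorm p.1 : ℝ≥0∞)⁻¹ ^ s) *
          (‖MvPowerSeries.coeff p.2 g‖ₑ * (expNorm p.2 : ℝ≥0∞)⁻¹ ^ s)]
    refine (mul_le_mul_left (enorm_sum_le _ _) _).trans ?_
    rw [Finset.sum_mul]
    refine Finset.sum_le_sum fun p hp => le_of_eq ?_
    rw [← Finset.HasAntidiagonal.mem_antidiagonal.1 hp, expNorm_add, enorm_mul, Nat.cast_mul,
      ENNReal.mul_inv (Or.inr (ENNReal.natCast_ne_top _)) (Or.inl (ENNReal.natCast_ne_top _)),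
      mul_pow]
    ring
  refine (ENNReal.tsum_le_tsum h).trans (le_of_eq ?_)
  rw [← ENNReal.tsum_sigma' (fun x : Σ α, Finset.HasAntidiagonal.antidiagonal α => 
      (‖MvPowerSeries.coeff x.2.1.1 f‖ₑ * (expNorm x.2.1.1 : ℝ≥0∞)⁻¹ ^ s) *
          (‖MvPowerSeries.coeff x.2.1.2 g‖ₑ * (expNorm x.2.1.2 : ℝ≥0∞)⁻¹ ^ s)),
    ← Finset.HasAntidiagonal.sigmaAntidiagonalEquivProd.symm.tsum_eq]
  simp only [Finset.HasAntidiagonal.sigmaAntidiagonalEquivProd_symm_apply_snd_coe]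
  rw [ENNReal.tsum_prod', wnorm, wnorm, ← ENNReal.tsum_mul_right]
  refine tsum_congr fun a => ?_
  rw [← ENNReal.tsum_mul_left]

/-- With `P` the product of the first `n` primes, `expNorm α` lies between `2 ^ |α|` and `P ^ |α|`.
So the weights `expNorm α ^ (-s)` lie between those of the polydiscs of radii `P ^ (-s)` and `2 ^
(-s)`, and the latter radius tends to 0. -/
theorem isConvergent_iff_exists_wnorm {f : FormalSeries n} :
    IsConvergent f ↔ ∃ s, wnorm s f ≠ ∞ := by
  have key : ∀ (r : ℝ), 0 ≤ r → ((Summable fun α : Fin n →₀ ℕ =>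
      ‖MvPowerSeries.coeff α f‖ * r ^ α.degree) ↔
      ∑' α : Fin n →₀ ℕ, ‖MvPowerSeries.coeff α f‖ₑ * ENNReal.ofReal r ^ α.degree ≠ ∞) := by
    intro r hr
    have h : ∀ α : Fin n →₀ ℕ, ‖MvPowerSeries.coeff α f‖ₑ * ENNReal.ofReal r ^ α.degree =
        ENNReal.ofReal (‖MvPowerSeries.coeff α f‖ * r ^ α.degree) := fun α => by
      rw [ENNReal.ofReal_mul (norm_nonneg _), ofReal_norm, ENNReal.ofReal_pow hr]
    simp only [h]
    refine ⟨fun H => H.tsum_ofReal_ne_top, fun H => ?_⟩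
    have := ENNReal.summable_toReal H
    simpa only [ENNReal.toReal_ofReal (mul_nonneg (norm_nonneg _) (pow_nonneg hr _))] using this
  constructor
  · rintro ⟨r, hr, h⟩
    rw [key r hr.le] at h
    obtain ⟨s, hs⟩ := exists_pow_lt_of_lt_one hr (by norm_num : (2⁻¹ : ℝ) < 1)
    refine ⟨s, ne_top_of_le_ne_top h (ENNReal.tsum_le_tsum fun α => ?_)⟩
    refine mul_le_mul_right ?_ _
    calc (expNorm α : ℝ≥0∞)⁻¹ ^ s ≤ ((2 ^ α.degree : ℕ) : ℝ≥0∞)⁻¹ ^ s := by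
          gcongr
          exact two_pow_degree_le_expNorm α
      _ = (ENNReal.ofReal (2⁻¹ ^ s)) ^ α.degree := by
          rw [ENNReal.ofReal_pow (by positivity), ENNReal.ofReal_inv_of_pos two_pos,
            ENNReal.ofReal_ofNat, ← pow_mul, mul_comm s, pow_mul, Nat.cast_pow, ENNReal.inv_pow]
          rfl
      _ ≤ _ := by gcongr
  · rintro ⟨s, hs⟩
    set P := ∏ i : Fin n, Nat.nth Nat.Prime i with hP
    have hP0 : 0 < P := Finset.prod_pos fun i _ => (Nat.prime_nth_prime i).pos
    refine ⟨(P : ℝ)⁻¹ ^ s, by positivity, ?_⟩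
    rw [key _ (by positivity)]
    refine ne_top_of_le_ne_top hs (ENNReal.tsum_le_tsum fun α => ?_)
    refine mul_le_mul_right ?_ _
    calc ENNReal.ofReal ((P : ℝ)⁻¹ ^ s) ^ α.degree = ((P ^ α.degree : ℕ) : ℝ≥0∞)⁻¹ ^ s := by
          rw [ENNReal.ofReal_pow (by positivity), ENNReal.ofReal_inv_of_pos (by positivity),
            ENNReal.ofReal_natCast, ← pow_mul, mul_comm s, pow_mul, Nat.cast_pow, ENNReal.inv_pow]
      _ ≤ _ := by
          gcongr
          exact expNorm_le_pow_degree α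

/-- The vectors of convergent power series. -/
def convergentVec (n : ℕ) (ι : Type*) : Submodule (convergentSeries n) (ι → FormalSeries n) where
  carrier := {v | ∀ j, IsConvergent (v j)}
  zero_mem' _ := (convergentSeries n).zero_mem
  add_mem' hv hw j := (hv j).add (hw j)
  smul_mem' c _ hv j := c.2.mul (hv j)

theorem mem_convergentVec {ι : Type*} {v : ι → FormalSeries n} :
    v ∈ convergentVec n ι ↔ ∀ j, IsConvergent (v j) := Iff.rfl

variable {ι : Type*} [Fintype ι]

/-- The weighted `ℓ¹`-norm on a free module. -/
def vnorm (s : ℕ) (v : ι → FormalSeries n) : ℝ≥0∞ :=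
  ∑' e : (Fin n →₀ ℕ) × ι, ‖MvPowerSeries.coeff e.1 (v e.2)‖ₑ * (key e : ℝ≥0∞)⁻¹ ^ s

theorem vnorm_eq_sum (s : ℕ) (v : ι → FormalSeries n) :
    vnorm s v = ∑ j, wnorm s (v j) * (coordPrime n j : ℝ≥0∞)⁻¹ ^ s := by
  rw [vnorm, ENNReal.tsum_prod', ENNReal.tsum_comm, tsum_fintype]
  refine Finset.sum_congr rfl fun j _ => ?_
  rw [wnorm, ← ENNReal.tsum_mul_right]
  refine tsum_congr fun α => ?_
  rw [key, Nat.cast_mul,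
    ENNReal.mul_inv (Or.inr (ENNReal.natCast_ne_top _)) (Or.inl (ENNReal.natCast_ne_top _)),
    mul_pow, mul_assoc]

theorem vnorm_ne_top_iff {s : ℕ} {v : ι → FormalSeries n} :
    vnorm s v ≠ ∞ ↔ ∀ j, wnorm s (v j) ≠ ∞ := by
  rw [vnorm_eq_sum, ENNReal.sum_ne_top]
  refine ⟨fun h j hj => h j (Finset.mem_univ j) ?_, fun h j _ => ENNReal.mul_ne_top (h j) ?_⟩
  · rw [hj, ENNReal.top_mul]
    exact pow_ne_zero _ (ENNReal.inv_ne_zero.2 (ENNReal.natCast_ne_top _))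
  · refine ENNReal.pow_ne_top (ENNReal.inv_ne_top.2 ?_)
    exact_mod_cast (coordPrime_pos j).ne'

theorem vnorm_add_le (s : ℕ) (v w : ι → FormalSeries n) :
    vnorm s (v + w) ≤ vnorm s v + vnorm s w := by
  rw [vnorm_eq_sum, vnorm_eq_sum, vnorm_eq_sum, ← Finset.sum_add_distrib]
  refine Finset.sum_le_sum fun j _ => ?_
  rw [← add_mul]
  gcongr
  exact wnorm_add_le _ _ _

theorem vnorm_zero (s : ℕ) : vnorm s (0 : ι → FormalSeries n) = 0 := by simp [vnorm]

theorem vnorm_neg (s : ℕ) (v : ι → FormalSeries n) : vnorm s (-v) = vnorm s v := by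
  simp [vnorm]

theorem vnorm_smul_le (s : ℕ) (q : FormalSeries n) (v : ι → FormalSeries n) :
    vnorm s (q • v) ≤ wnorm s q * vnorm s v := by
  rw [vnorm_eq_sum, vnorm_eq_sum, Finset.mul_sum]
  refine Finset.sum_le_sum fun j _ => ?_
  rw [← mul_assoc]
  gcongr
  exact wnorm_mul_le _ _ _

theorem vnorm_sum_le (s : ℕ) {K : Type*} (T : Finset K) (v : K → ι → FormalSeries n) :
    vnorm s (∑ k ∈ T, v k) ≤ ∑ k ∈ T, vnorm s (v k) := by
  classical
  induction T using Finset.induction_on with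
  | empty => simp [vnorm_zero]
  | insert k T hk ih =>
    rw [Finset.sum_insert hk, Finset.sum_insert hk]
    exact (vnorm_add_le _ _ _).trans (by gcongr)

theorem vnorm_mono {s t : ℕ} (h : s ≤ t) (v : ι → FormalSeries n) : vnorm t v ≤ vnorm s v := by
  rw [vnorm_eq_sum, vnorm_eq_sum]
  refine Finset.sum_le_sum fun j _ => mul_le_mul' (wnorm_mono h _) ?_
  refine pow_le_pow_right_of_le_one' (ENNReal.inv_le_one.2 ?_) h
  exact_mod_cast coordPrime_pos j

theorem mem_convergentVec_iff {v : ι → FormalSeries n} :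
    v ∈ convergentVec n ι ↔ ∃ s, vnorm s v ≠ ∞ := by
  simp only [mem_convergentVec, isConvergent_iff_exists_wnorm, vnorm_ne_top_iff]
  refine ⟨fun h => ?_, fun ⟨s, h⟩ j => ⟨s, h j⟩⟩
  choose s hs using h
  exact ⟨∑ j, s j, fun j => ne_top_of_le_ne_top (hs j)
    (wnorm_mono (Finset.single_le_sum (fun _ _ => Nat.zero_le _) (Finset.mem_univ j)) _)⟩

end Norm


open scoped ENNReal

/-! ### Splitting a vector along finitely many monomials -/

section Monomials

variable {n : ℕ} {ι : Type*}

theorem isConvergent_of_finite {f : FormalSeries n}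
    (h : {α | MvPowerSeries.coeff α f ≠ 0}.Finite) : IsConvergent f := by
  refine ⟨1, one_pos, summable_of_ne_finset_zero (s := h.toFinset) fun α hα => ?_⟩
  have : MvPowerSeries.coeff α f = 0 := by simpa using hα
  simp [this]

variable {K : Type*} (a : K → (Fin n →₀ ℕ) × ι)

open Classical in
/-- A choice of an index `k` such that `a k` divides the monomial `e`. -/
def divisor (e : (Fin n →₀ ℕ) × ι) : Option K :=
  if h : ∃ k, (a k).1 ≤ e.1 ∧ (a k).2 = e.2 then some h.choose else none

theorem le_of_divisor_eq_some {e : (Fin n →₀ ℕ) × ι} {k : K} (h : divisor a e = some k) :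
    (a k).1 ≤ e.1 ∧ (a k).2 = e.2 := by
  rw [divisor] at h
  split_ifs at h with h'
  rw [← Option.some_injective _ h]
  exact h'.choose_spec

theorem divisor_ne_none {e : (Fin n →₀ ℕ) × ι} {k : K} (h : (a k).1 ≤ e.1) (h' : (a k).2 = e.2) :
    divisor a e ≠ none := by
  rw [divisor, dif_pos ⟨k, h, h'⟩]
  exact Option.some_ne_none _

open Classical in
/-- The quotient by `a k` of the monomials assigned to `k`. -/
def monQuot (k : K) : (ι → FormalSeries n) →+ FormalSeries n where
  toFun v β := if divisor a (β + (a k).1, (a k).2) = some k then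
    MvPowerSeries.coeff (β + (a k).1) (v (a k).2) else 0
  map_zero' := by
    funext β
    by_cases h : divisor a (β + (a k).1, (a k).2) = some k
    · exact (if_pos h).trans (map_zero _)
    · exact if_neg h
  map_add' v w := by
    funext β
    by_cases h : divisor a (β + (a k).1, (a k).2) = some k
    · exact (if_pos h).trans ((map_add _ _ _).trans
        (congrArg₂ (· + ·) (if_pos h).symm (if_pos h).symm))
    · exact (if_neg h).trans ((add_zero _).symm.trans
        (congrArg₂ (· + ·) (if_neg h).symm (if_neg h).symm))

theorem coeff_monQuot (k : K) (v : ι → FormalSeries n) (β : Fin n →₀ ℕ) :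
    MvPowerSeries.coeff β (monQuot a k v) = open Classical in
      if divisor a (β + (a k).1, (a k).2) = some k then
      MvPowerSeries.coeff (β + (a k).1) (v (a k).2) else 0 := rfl

open Classical in
/-- The part of a vector made of the monomials that are divisible by no `a k`. -/
def monRem (v : ι → FormalSeries n) : ι → FormalSeries n :=
  fun j α => if divisor a (α, j) = none then MvPowerSeries.coeff α (v j) else 0

theorem coeff_monRem (v : ι → FormalSeries n) (α : Fin n →₀ ℕ) (j : ι) :
    MvPowerSeries.coeff α (monRem a v j) = open Classical in
      if divisor a (α, j) = none then MvPowerSeries.coeff α (v j) else 0 := rfl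

open Classical in
/-- The monomial with exponent `e` as a vector. -/
def monVec (e : (Fin n →₀ ℕ) × ι) : ι → FormalSeries n :=
  Pi.single e.2 (MvPowerSeries.monomial e.1 1)

theorem coeff_smul_monVec (q : FormalSeries n) (e : (Fin n →₀ ℕ) × ι) (α : Fin n →₀ ℕ) (j : ι) :
    MvPowerSeries.coeff α ((q • monVec e) j) = open Classical in
      if e.1 ≤ α ∧ e.2 = j then MvPowerSeries.coeff (α - e.1) q else 0 := by
  classical
  rw [Pi.smul_apply, smul_eq_mul, monVec]
  by_cases h : e.2 = j
  · subst h
    rw [Pi.single_eq_same, MvPowerSeries.coeff_mul_monomial]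
    simp
  · rw [Pi.single_eq_of_ne (Ne.symm h)]
    simp [h]

/-- `divisor` assigns each monomial to at most one `k`, so the monomials of `v` are partitioned and
none is counted twice. -/
theorem sum_monQuot_smul_add_monRem [Fintype K] (v : ι → FormalSeries n) :
    ∑ k, monQuot a k v • monVec (a k) + monRem a v = v := by
  classical
  ext j α
  rw [Pi.add_apply, map_add, Finset.sum_apply, map_sum, coeff_monRem]
  have h : ∀ k, MvPowerSeries.coeff α ((monQuot a k v • monVec (a k)) j) =
      if divisor a (α, j) = some k then MvPowerSeries.coeff α (v j) else 0 := by
    intro k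
    rw [coeff_smul_monVec]
    by_cases h : (a k).1 ≤ α ∧ (a k).2 = j
    · obtain ⟨h1, rfl⟩ := h
      rw [if_pos ⟨h1, rfl⟩, coeff_monQuot, tsub_add_cancel_of_le h1]
    · rw [if_neg h, if_neg fun h' => h (le_of_divisor_eq_some a h')]
  simp only [h]
  cases hd : divisor a (α, j) with
  | none => simp
  | some k => simp

theorem monVec_mem_convergentVec (e : (Fin n →₀ ℕ) × ι) : monVec e ∈ convergentVec n ι := by
  classical
  intro j
  refine isConvergent_of_finite ((Set.finite_singleton e.1).subset fun α hα => ?_)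
  rw [Set.mem_ofPred_eq, ← one_smul (FormalSeries n) (monVec e), coeff_smul_monVec] at hα
  split_ifs at hα with h
  · rw [MvPowerSeries.coeff_one] at hα
    split_ifs at hα with h'
    · exact le_antisymm (tsub_eq_zero_iff_le.1 h') h.1
    · exact absurd rfl hα
  · exact absurd rfl hα

variable [Fintype K] (f : K → ι → FormalSeries n)

/-- Replace the leading monomials by minus the rests of the `f k`. -/
def tailMap : (ι → FormalSeries n) →+ (ι → FormalSeries n) where
  toFun v := -∑ k, monQuot a k v • (f k - monVec (a k))
  map_zero' := by simp
  map_add' v w := by simp [add_smul, Finset.sum_add_distrib, add_comm]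

theorem tailMap_apply (v : ι → FormalSeries n) :
    tailMap a f v = -∑ k, monQuot a k v • (f k - monVec (a k)) := rfl

end Monomials

/-! ### The contraction behind the division algorithm -/

section Division

variable {n : ℕ} {ι : Type*} [Fintype ι]

/-- The vectors all of whose monomials have key at least `M`. -/
def lowSub (n : ℕ) (ι : Type*) [Fintype ι] (M : ℕ) :
    Submodule (FormalSeries n) (ι → FormalSeries n) where
  carrier := {v | ∀ α j, MvPowerSeries.coeff α (v j) ≠ 0 → M ≤ key (α, j)}
  zero_mem' := by simp
  add_mem' := by
    intro v w hv hw α j h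
    by_cases h' : MvPowerSeries.coeff α (v j) = 0
    · exact hw α j (by simpa [h'] using h)
    · exact hv α j h'
  smul_mem' := by
    classical
    intro c v hv α j h
    rw [Pi.smul_apply, smul_eq_mul, MvPowerSeries.coeff_mul] at h
    obtain ⟨p, hp, hne⟩ := Finset.exists_ne_zero_of_sum_ne_zero h
    rw [← Finset.HasAntidiagonal.mem_antidiagonal.1 hp, key_add]
    exact (hv _ _ (right_ne_zero_of_mul hne)).trans (Nat.le_mul_of_pos_left _ (expNorm_pos _))

theorem lowSub_anti {M M' : ℕ} (h : M ≤ M') : lowSub n ι M' ≤ lowSub n ι M :=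
  fun _ hv α j hne => h.trans (hv α j hne)

theorem eq_zero_of_forall_mem_lowSub {v : ι → FormalSeries n} (h : ∀ M, v ∈ lowSub n ι M) :
    v = 0 := by
  ext j α
  by_contra hne
  exact (Nat.lt_irrefl _) (h (key (α, j) + 1) α j hne)

theorem coeff_eq_of_sub_mem_lowSub {M : ℕ} {v w : ι → FormalSeries n}
    (h : v - w ∈ lowSub n ι M) {α : Fin n →₀ ℕ} {j : ι} (hM : key (α, j) < M) :
    MvPowerSeries.coeff α (v j) = MvPowerSeries.coeff α (w j) := by
  by_contra hne
  have := h α j (by rwa [Pi.sub_apply, map_sub, sub_ne_zero])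
  omega

theorem smul_mem_lowSub_of_coeff {q : FormalSeries n} {M : ℕ}
    (hq : ∀ β, MvPowerSeries.coeff β q ≠ 0 → M ≤ expNorm β) (v : ι → FormalSeries n) :
    q • v ∈ lowSub n ι M := by
  classical
  intro α j h
  rw [Pi.smul_apply, smul_eq_mul, MvPowerSeries.coeff_mul] at h
  obtain ⟨p, hp, hne⟩ := Finset.exists_ne_zero_of_sum_ne_zero h
  rw [← Finset.HasAntidiagonal.mem_antidiagonal.1 hp, key_add]
  exact (hq _ (left_ne_zero_of_mul hne)).trans (Nat.le_mul_of_pos_right _ (key_pos _))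

/-- `e` is the leading exponent of `v`: its coefficient is `1` and all the other monomials of `v`
have a larger key. -/
def IsLead (e : (Fin n →₀ ℕ) × ι) (v : ι → FormalSeries n) : Prop :=
  MvPowerSeries.coeff e.1 (v e.2) = 1 ∧
    ∀ α j, MvPowerSeries.coeff α (v j) ≠ 0 → (α, j) ≠ e → key e < key (α, j)

theorem IsLead.sub_monVec_mem {e : (Fin n →₀ ℕ) × ι} {v : ι → FormalSeries n} (h : IsLead e v) :
    v - monVec e ∈ lowSub n ι (key e + 1) := by
  classical
  intro α j hne
  rw [← one_smul (FormalSeries n) (monVec e), Pi.sub_apply, map_sub, coeff_smul_monVec] at hne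
  by_cases he : (α, j) = e
  · subst he
    rw [if_pos ⟨le_rfl, rfl⟩, tsub_self, h.1] at hne
    simp at hne
  · refine h.2 α j (fun h0 => hne ?_) he
    rw [h0, zero_sub, neg_eq_zero]
    split_ifs with h'
    · rw [MvPowerSeries.coeff_one, if_neg]
      intro h''
      exact he (Prod.ext (le_antisymm (tsub_eq_zero_iff_le.1 h'') h'.1) h'.2.symm)
    · rfl

variable {K : Type*} {a : K → (Fin n →₀ ℕ) × ι}

theorem le_of_coeff_monQuot_ne {M : ℕ} {v : ι → FormalSeries n} (hv : v ∈ lowSub n ι M) {k : K}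
    {β : Fin n →₀ ℕ} (h : MvPowerSeries.coeff β (monQuot a k v) ≠ 0) :
    M ≤ expNorm β * key (a k) := by
  rw [coeff_monQuot] at h
  have h' := hv (β + (a k).1) (a k).2 (fun h0 => h (by simp [h0]))
  rwa [key_add] at h'

/-- The key is multiplicative, so dividing by the monomial `a k` costs exactly the factor `key (a k)
^ s`, and distinct quotients come from distinct monomials of `v`. -/
theorem wnorm_monQuot_le (s : ℕ) (k : K) (v : ι → FormalSeries n) :
    wnorm s (monQuot a k v) ≤ vnorm s v * (key (a k) : ℝ≥0∞) ^ s := by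
  have hk : (key (a k) : ℝ≥0∞) ≠ 0 := by exact_mod_cast (key_pos _).ne'
  have hinj : Function.Injective fun β : Fin n →₀ ℕ => (β + (a k).1, (a k).2) :=
    fun β β' h => add_right_cancel (congrArg Prod.fst h)
  rw [vnorm, ← ENNReal.tsum_mul_right]
  refine le_trans (ENNReal.tsum_le_tsum fun β => ?_)
    (ENNReal.tsum_comp_le_tsum_of_injective hinj _)
  rw [coeff_monQuot]
  split_ifs
  · simp only [key_add]
    rw [mul_assoc]
    refine mul_le_mul_right (le_of_eq ?_) _
    rw [← mul_pow, Nat.cast_mul, ENNReal.mul_inv (Or.inr (ENNReal.natCast_ne_top _))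
      (Or.inl (ENNReal.natCast_ne_top _)), mul_assoc,
      ENNReal.inv_mul_cancel hk (ENNReal.natCast_ne_top _), mul_one]
  · simp

variable [Fintype K] {f : K → ι → FormalSeries n}

/-- A monomial of key at least `M` is replaced by multiples of tail monomials of `f k`, whose keys
exceed that of `a k`. Keys are integers, so each application gains at least 1: the map is
contracting for the key filtration. -/
theorem tailMap_mem_lowSub (hf : ∀ k, IsLead (a k) (f k)) {M : ℕ} {v : ι → FormalSeries n}
    (hv : v ∈ lowSub n ι M) : tailMap a f v ∈ lowSub n ι (M + 1) := by
  classical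
  refine neg_mem (sum_mem fun k _ => ?_)
  intro α j h
  rw [Pi.smul_apply, smul_eq_mul, MvPowerSeries.coeff_mul] at h
  obtain ⟨p, hp, hne⟩ := Finset.exists_ne_zero_of_sum_ne_zero h
  rw [← Finset.HasAntidiagonal.mem_antidiagonal.1 hp, key_add]
  have h1 := le_of_coeff_monQuot_ne hv (left_ne_zero_of_mul hne)
  have h2 := (hf k).sub_monVec_mem _ _ (right_ne_zero_of_mul hne)
  have h3 := Nat.mul_le_mul_left (expNorm p.1) h2
  have h4 := expNorm_pos p.1
  rw [mul_add, mul_one] at h3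
  omega

theorem vnorm_tailMap_le {s : ℕ}
    (hs : ∑ k, (key (a k) : ℝ≥0∞) ^ s * vnorm s (f k - monVec (a k)) ≤ 2⁻¹)
    (v : ι → FormalSeries n) : vnorm s (tailMap a f v) ≤ 2⁻¹ * vnorm s v := by
  rw [tailMap_apply, vnorm_neg]
  refine (vnorm_sum_le _ _ _).trans ?_
  calc ∑ k, vnorm s (monQuot a k v • (f k - monVec (a k)))
      ≤ ∑ k, vnorm s v * ((key (a k) : ℝ≥0∞) ^ s * vnorm s (f k - monVec (a k))) := by
        refine Finset.sum_le_sum fun k _ => (vnorm_smul_le _ _ _).trans ?_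
        rw [← mul_assoc]
        gcongr
        exact wnorm_monQuot_le s k v
    _ ≤ 2⁻¹ * vnorm s v := by
        rw [← Finset.mul_sum, mul_comm]
        gcongr

/-- The equation `v = g + T v` of the division algorithm has a solution, with estimates. -/
theorem exists_eq_add_tailMap (hf : ∀ k, IsLead (a k) (f k)) (g : ι → FormalSeries n) :
    ∃ v, v = g + tailMap a f v ∧ (∀ M, g ∈ lowSub n ι M → v ∈ lowSub n ι M) ∧
      ∀ s, ∑ k, (key (a k) : ℝ≥0∞) ^ s * vnorm s (f k - monVec (a k)) ≤ 2⁻¹ →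
        vnorm s v ≤ 2 * vnorm s g := by
  classical
  obtain ⟨G, hG0, hG⟩ : ∃ G : ℕ → ι → FormalSeries n, G 0 = 0 ∧
      ∀ m, G (m + 1) = g + tailMap a f (G m) :=
    ⟨fun m => Nat.rec 0 (fun _ w => g + tailMap a f w) m, rfl, fun _ => rfl⟩
  -- Iterating from 0, each step fixes the coefficients of one more key, so the coefficient at a
  -- monomial is constant from step `key + 1` on.
  have hstep : ∀ m, G (m + 1) - G m ∈ lowSub n ι m := by
    intro m
    induction m with
    | zero => exact fun _ _ _ => Nat.zero_le _
    | succ m ih =>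
      have h : G (m + 1 + 1) - G (m + 1) = tailMap a f (G (m + 1) - G m) := by
        rw [map_sub]
        linear_combination hG (m + 1) - hG m
      rw [h]
      exact tailMap_mem_lowSub hf ih
  have hle : ∀ m m', m ≤ m' → G m' - G m ∈ lowSub n ι m := by
    intro m m' h
    induction m', h using Nat.le_induction with
    | base => simp
    | succ m' h ih =>
      rw [← sub_add_sub_cancel _ (G m')]
      exact add_mem (lowSub_anti h (hstep m')) ih
  let v : ι → FormalSeries n := fun j α => MvPowerSeries.coeff α (G (key (α, j) + 1) j)
  have hv : ∀ α j, MvPowerSeries.coeff α (v j) = MvPowerSeries.coeff α (G (key (α, j) + 1) j) :=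
    fun _ _ => rfl
  have hvG : ∀ m α j, key (α, j) < m →
      MvPowerSeries.coeff α (v j) = MvPowerSeries.coeff α (G m j) := fun m α j h =>
    (coeff_eq_of_sub_mem_lowSub (hle (key (α, j) + 1) m h) (Nat.lt_succ_self _)).symm
  have hvm : ∀ m, v - G m ∈ lowSub n ι m := by
    intro m α j hne
    by_contra hlt
    exact hne (by rw [Pi.sub_apply, map_sub, hvG m α j (not_le.1 hlt), sub_self])
  refine ⟨v, ?_, ?_, ?_⟩
  · rw [← sub_eq_zero]
    refine eq_zero_of_forall_mem_lowSub fun M => ?_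
    have h1 : v - (g + tailMap a f v) = (v - G (M + 1)) - tailMap a f (v - G M) := by
      rw [hG, map_sub]
      abel
    rw [h1]
    exact sub_mem (lowSub_anti (Nat.le_succ M) (hvm _))
      (lowSub_anti (Nat.le_succ M) (tailMap_mem_lowSub hf (hvm M)))
  · intro M hg
    have hGM : ∀ m, G m ∈ lowSub n ι M := by
      intro m
      induction m with
      | zero => rw [hG0]; exact zero_mem _
      | succ m ih =>
        rw [hG]
        exact add_mem hg (lowSub_anti (Nat.le_succ M) (tailMap_mem_lowSub hf ih))
    intro α j hne
    exact hGM (key (α, j) + 1) α j ((hv α j).symm.trans_ne hne)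
  · intro s hs
    -- For such `s` the tail map has norm at most 1/2, so the bound `2 * vnorm s g` reproduces
    -- itself along the iteration.
    have hGs : ∀ m, vnorm s (G m) ≤ 2 * vnorm s g := by
      intro m
      induction m with
      | zero => rw [hG0, vnorm_zero]; exact zero_le
      | succ m ih =>
        rw [hG]
        calc _ ≤ vnorm s g + 2⁻¹ * (2 * vnorm s g) := (vnorm_add_le _ _ _).trans (by
                gcongr
                exact (vnorm_tailMap_le hs _).trans (by gcongr))
          _ = 2 * vnorm s g := by
                rw [← mul_assoc, ENNReal.inv_mul_cancel two_ne_zero ENNReal.ofNat_ne_top, one_mul,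
                  two_mul]
    -- The bound passes to the limit on each finite set of monomials, where `v` coincides with a
    -- late iterate. Thus the formal solution, chosen independently of `s`, is itself estimated.
    rw [vnorm, ENNReal.tsum_eq_iSup_sum]
    refine iSup_le fun T => ?_
    have hT : ∀ e ∈ T, key e < T.sup key + 1 := fun e he =>
      Nat.lt_succ_of_le (Finset.le_sup (f := key) he)
    have hsum : ∀ e ∈ T, ‖MvPowerSeries.coeff e.1 (v e.2)‖ₑ * (key e : ℝ≥0∞)⁻¹ ^ s =
        ‖MvPowerSeries.coeff e.1 (G (T.sup key + 1) e.2)‖ₑ * (key e : ℝ≥0∞)⁻¹ ^ s :=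
      fun e he => by rw [hvG _ e.1 e.2 (hT e he)]
    rw [Finset.sum_congr rfl hsum]
    exact (ENNReal.sum_le_tsum T).trans (hGs _)

/-- Shrinking the polydisc makes each tail small relative to its leading monomial, because all tail
monomials have strictly larger keys. -/
theorem exists_sum_vnorm_le (hf : ∀ k, IsLead (a k) (f k)) (hc : ∀ k, f k ∈ convergentVec n ι)
    {g : ι → FormalSeries n} (hg : g ∈ convergentVec n ι) :
    ∃ s, ∑ k, (key (a k) : ℝ≥0∞) ^ s * vnorm s (f k - monVec (a k)) ≤ 2⁻¹ ∧ vnorm s g ≠ ∞ := by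
  classical
  have hfin : ∀ k, ∃ s, vnorm s (f k - monVec (a k)) ≠ ∞ := fun k =>
    mem_convergentVec_iff.1 (sub_mem (hc k) (monVec_mem_convergentVec _))
  choose s hs using hfin
  obtain ⟨s', hs'⟩ := mem_convergentVec_iff.1 hg
  obtain ⟨s₀, hs1, hs₀⟩ : ∃ s₀, (∀ k, vnorm s₀ (f k - monVec (a k)) ≠ ∞) ∧ s' ≤ s₀ :=
    ⟨∑ k, s k + s', fun k => ne_top_of_le_ne_top (hs k) (vnorm_mono
      ((Finset.single_le_sum (fun _ _ => Nat.zero_le _) (Finset.mem_univ k)).trans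
        (Nat.le_add_right _ _)) _), Nat.le_add_left _ _⟩
  -- Passing from `s₀` to `s₀ + t` multiplies the tail norm by at most `(key + 1) ^ (-t)`, against a
  -- factor `key ^ t` in front. The ratio `key / (key + 1)` is less than 1.
  have hlim : Filter.Tendsto (fun t : ℕ => ∑ k, ((key (a k) : ℝ≥0∞) * (key (a k) + 1 : ℝ≥0∞)⁻¹) ^ t
      * ((key (a k) : ℝ≥0∞) ^ s₀ * vnorm s₀ (f k - monVec (a k)))) Filter.atTop (nhds 0) := by
    rw [← Finset.sum_const_zero (s := (Finset.univ : Finset K))]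
    refine tendsto_finsetSum _ fun k _ => ?_
    rw [← zero_mul ((key (a k) : ℝ≥0∞) ^ s₀ * vnorm s₀ (f k - monVec (a k)))]
    refine ENNReal.Tendsto.mul_const (ENNReal.tendsto_pow_atTop_nhds_zero_of_lt_one ?_) (Or.inr
      (ENNReal.mul_ne_top (ENNReal.pow_ne_top (ENNReal.natCast_ne_top _)) (hs1 k)))
    rw [← div_eq_mul_inv]
    refine ENNReal.div_lt_of_lt_mul ?_
    rw [one_mul]
    exact ENNReal.lt_add_right (ENNReal.natCast_ne_top _) one_ne_zero
  obtain ⟨t, ht⟩ := (hlim.eventually (gt_mem_nhds (show (0 : ℝ≥0∞) < 2⁻¹ by simp))).exists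
  refine ⟨s₀ + t, le_trans (Finset.sum_le_sum fun k _ => ?_) ht.le,
    ne_top_of_le_ne_top hs' (vnorm_mono ?_ _)⟩
  · have : vnorm (s₀ + t) (f k - monVec (a k)) ≤
        (key (a k) + 1 : ℝ≥0∞)⁻¹ ^ t * vnorm s₀ (f k - monVec (a k)) := by
      rw [vnorm, vnorm, ← ENNReal.tsum_mul_left]
      refine ENNReal.tsum_le_tsum fun e => ?_
      by_cases h0 : MvPowerSeries.coeff e.1 ((f k - monVec (a k)) e.2) = 0
      · rw [h0, enorm_zero, zero_mul]
        exact zero_le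
      · have h1 := (hf k).sub_monVec_mem _ _ h0
        rw [pow_add, mul_left_comm (_ ^ t), mul_comm (_ ^ t)]
        refine mul_le_mul_right (mul_le_mul_right ?_ _) _
        gcongr
        exact_mod_cast h1
    calc _ ≤ (key (a k) : ℝ≥0∞) ^ (s₀ + t) *
          ((key (a k) + 1 : ℝ≥0∞)⁻¹ ^ t * vnorm s₀ (f k - monVec (a k))) := by gcongr
      _ = _ := by rw [pow_add, mul_pow]; ring
  · omega

end Division


open scoped ENNReal

/-! ### Division with remainder -/

section DivisionTheorem

variable {n : ℕ} {ι : Type*} [Fintype ι] {K : Type*} [Fintype K]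
  {a : K → (Fin n →₀ ℕ) × ι} {f : K → ι → FormalSeries n}

/-- Division with remainder (Grauert, Hironaka) for formal and for convergent power series. -/
theorem exists_division (hf : ∀ k, IsLead (a k) (f k)) (g : ι → FormalSeries n) :
    ∃ (q : K → FormalSeries n) (r : ι → FormalSeries n), g = ∑ k, q k • f k + r ∧
      (∀ k α, (a k).1 ≤ α → MvPowerSeries.coeff α (r (a k).2) = 0) ∧
      (∀ M, g ∈ lowSub n ι M → ∀ k β, MvPowerSeries.coeff β (q k) ≠ 0 →
        M ≤ expNorm β * key (a k)) ∧
      ((∀ k, f k ∈ convergentVec n ι) → g ∈ convergentVec n ι →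
        (∀ k, IsConvergent (q k)) ∧ r ∈ convergentVec n ι) := by
  obtain ⟨v, hv, hlow, hnorm⟩ := exists_eq_add_tailMap hf g
  -- Since `g = v - tailMap v`, splitting `v` into its monomial parts and adding back the tails
  -- turns each monomial `a k` into the full divisor `f k`.
  have hg : g = ∑ k, monQuot a k v • f k + monRem a v := by
    have h1 := sum_monQuot_smul_add_monRem a v
    rw [tailMap_apply] at hv
    simp only [smul_sub, Finset.sum_sub_distrib] at hv
    linear_combination - hv - h1
  refine ⟨fun k => monQuot a k v, monRem a v, hg, ?_, ?_, ?_⟩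
  · intro k α h
    rw [coeff_monRem, if_neg (divisor_ne_none a (e := (α, (a k).2)) h rfl)]
  · intro M hM k β hβ
    exact le_of_coeff_monQuot_ne (hlow M hM) hβ
  · intro hc hgc
    obtain ⟨s, hs, hgs⟩ := exists_sum_vnorm_le hf hc hgc
    have hvs : vnorm s v ≠ ∞ := ne_top_of_le_ne_top
      (ENNReal.mul_ne_top ENNReal.ofNat_ne_top hgs) (hnorm s hs)
    have hq : ∀ k, IsConvergent (monQuot a k v) := fun k =>
      isConvergent_iff_exists_wnorm.2 ⟨s, ne_top_of_le_ne_top (ENNReal.mul_ne_top hvs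
        (ENNReal.pow_ne_top (ENNReal.natCast_ne_top _))) (wnorm_monQuot_le s k v)⟩
    refine ⟨hq, ?_⟩
    have hr : monRem a v = g - ∑ k, monQuot a k v • f k := by
      rw [eq_sub_iff_add_eq', ← hg]
    rw [hr]
    exact sub_mem hgc (sum_mem fun k _ =>
      (convergentVec n ι).smul_mem ⟨monQuot a k v, hq k⟩ (hc k))

end DivisionTheorem

/-! ### Standard bases and closures of modules of convergent vectors -/

section Limits

variable {n : ℕ} {ι : Type*} [Fintype ι]

/-- The vectors that are approximated to any order by the elements of `N`. -/
def adicClosure (N : Submodule (convergentSeries n) (ι → FormalSeries n)) :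
    AddSubgroup (ι → FormalSeries n) where
  carrier := {v | ∀ M, ∃ w ∈ N, v - w ∈ lowSub n ι M}
  zero_mem' M := ⟨0, N.zero_mem, by simp⟩
  add_mem' := by
    intro v v' hv hv' M
    obtain ⟨w, hw, h⟩ := hv M
    obtain ⟨w', hw', h'⟩ := hv' M
    exact ⟨w + w', N.add_mem hw hw', by rw [add_sub_add_comm]; exact add_mem h h'⟩
  neg_mem' := by
    intro v hv M
    obtain ⟨w, hw, h⟩ := hv M
    exact ⟨-w, N.neg_mem hw, by rw [neg_sub_neg, ← neg_sub]; exact neg_mem h⟩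

variable {N N₁ N₂ : Submodule (convergentSeries n) (ι → FormalSeries n)}

theorem mem_adicClosure {v : ι → FormalSeries n} :
    v ∈ adicClosure N ↔ ∀ M, ∃ w ∈ N, v - w ∈ lowSub n ι M := Iff.rfl

theorem le_adicClosure {v : ι → FormalSeries n} (hv : v ∈ N) : v ∈ adicClosure N :=
  fun _ => ⟨v, hv, by simp⟩

theorem adicClosure_mono (h : N₁ ≤ N₂) : adicClosure N₁ ≤ adicClosure N₂ := by
  intro v hv M
  obtain ⟨w, hw, h'⟩ := hv M
  exact ⟨w, h hw, h'⟩

theorem finite_setOf_expNorm_lt (M : ℕ) : {α : Fin n →₀ ℕ | expNorm α < M}.Finite := by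
  have hinj : Function.Injective (expNorm : (Fin n →₀ ℕ) → ℕ) := fun α β h =>
    congrArg Prod.fst (key_injective (ι := Unit) (a₁ := (α, ())) (a₂ := (β, ()))
      (by rw [key, key, h]))
  exact (Set.finite_lt_nat M).preimage hinj.injOn

/-- A series is a convergent series up to a series of high order. -/
theorem exists_convergent_sub (c : FormalSeries n) (M : ℕ) : ∃ d : convergentSeries n,
    (∀ α, MvPowerSeries.coeff α (d : FormalSeries n) ≠ 0 → MvPowerSeries.coeff α c ≠ 0) ∧
    ∀ α, MvPowerSeries.coeff α (c - (d : FormalSeries n)) ≠ 0 → M ≤ expNorm α := by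
  classical
  let d : FormalSeries n := fun α => if expNorm α < M then MvPowerSeries.coeff α c else 0
  have hd : ∀ α, MvPowerSeries.coeff α d = if expNorm α < M then MvPowerSeries.coeff α c else 0 :=
    fun _ => rfl
  have hconv : IsConvergent d := isConvergent_of_finite
    ((finite_setOf_expNorm_lt M).subset fun α hα => by
      by_contra h
      exact hα ((hd α).trans (if_neg h)))
  refine ⟨⟨d, hconv⟩, fun α hα h => hα ?_, fun α hα => ?_⟩
  · change MvPowerSeries.coeff α d = 0
    rw [hd, h, ite_self]
  · by_contra h
    refine hα ?_
    change MvPowerSeries.coeff α (c - d) = 0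
    rw [map_sub, hd, if_pos (not_le.1 h), sub_self]

/-- Truncating the formal scalars gives polynomials, which act within `N`; the error has large keys.
With `mem_span_of_mem_adicClosure` this identifies the closure with the extension of `N` to formal
scalars. -/
theorem span_le_adicClosure {v : ι → FormalSeries n}
    (hv : v ∈ Submodule.span (FormalSeries n) (N : Set (ι → FormalSeries n))) :
    v ∈ adicClosure N := by
  induction hv using Submodule.closure_induction with
  | zero => exact zero_mem _
  | add v w _ _ hv hw => exact add_mem hv hw
  | smul_mem c v hv =>
    intro M
    obtain ⟨d, -, hd⟩ := exists_convergent_sub c M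
    refine ⟨d • v, N.smul_mem d hv, ?_⟩
    have h : c • v - d • v = (c - (d : FormalSeries n)) • v := (sub_smul _ _ _).symm
    rw [h]
    exact smul_mem_lowSub_of_coeff hd v

/-- The leading exponents of the elements of `N`. -/
def leadSet (N : Submodule (convergentSeries n) (ι → FormalSeries n)) :
    Set ((Fin n →₀ ℕ) × ι) := {e | ∃ v ∈ N, IsLead e v}

/-- An element of `N` agreeing with `r` beyond the smallest key of `r` has the same leading
monomial; a constant normalizes its coefficient. So passing to the closure creates no new leading
exponents. -/
theorem exists_mem_leadSet {r : ι → FormalSeries n} (hr : r ∈ adicClosure N) (h0 : r ≠ 0) :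
    ∃ e ∈ leadSet N, MvPowerSeries.coeff e.1 (r e.2) ≠ 0 := by
  have hne : {e : (Fin n →₀ ℕ) × ι | MvPowerSeries.coeff e.1 (r e.2) ≠ 0}.Nonempty := by
    by_contra h
    refine h0 ?_
    ext j α
    by_contra h'
    exact h ⟨(α, j), h'⟩
  obtain ⟨e, he, hmin⟩ := WellFounded.has_min (InvImage.wf key Nat.lt_wfRel.wf) _ hne
  obtain ⟨w, hw, hrw⟩ := hr (key e + 1)
  have hwe : MvPowerSeries.coeff e.1 (w e.2) = MvPowerSeries.coeff e.1 (r e.2) :=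
    (coeff_eq_of_sub_mem_lowSub hrw (Nat.lt_succ_self _)).symm
  have hwe0 : MvPowerSeries.coeff e.1 (w e.2) ≠ 0 := by rw [hwe]; exact he
  refine ⟨e, ⟨(⟨MvPowerSeries.C (MvPowerSeries.coeff e.1 (w e.2))⁻¹, isConvergent_C _⟩ :
    convergentSeries n) • w, N.smul_mem _ hw, ?_, ?_⟩, he⟩
  · change MvPowerSeries.coeff e.1 (MvPowerSeries.C _ * w e.2) = 1
    rw [MvPowerSeries.coeff_C_mul, inv_mul_cancel₀ hwe0]
  · intro α j hne he'
    change MvPowerSeries.coeff α (MvPowerSeries.C _ * w j) ≠ 0 at hne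
    rw [MvPowerSeries.coeff_C_mul] at hne
    by_contra hlt
    have hlt' : key (α, j) < key e := lt_of_le_of_ne (not_lt.1 hlt) fun h => he' (key_injective h)
    have h1 := coeff_eq_of_sub_mem_lowSub hrw (hlt'.trans (Nat.lt_succ_self _))
    exact hmin (α, j) (by rw [Set.mem_ofPred_eq, h1]; exact right_ne_zero_of_mul hne) hlt'

/-- Dickson's lemma. -/
theorem exists_finite_dividing (S : Set ((Fin n →₀ ℕ) × ι)) :
    ∃ T : Set ((Fin n →₀ ℕ) × ι), T.Finite ∧ T ⊆ S ∧ ∀ e ∈ S, ∃ a ∈ T, a.1 ≤ e.1 ∧ a.2 = e.2 := by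
  refine ⟨⋃ j : ι, (fun α => (α, j)) '' {α | Minimal (fun α => (α, j) ∈ S) α}, ?_, ?_, ?_⟩
  · refine Set.finite_iUnion fun j => Set.Finite.image _ ?_
    exact WellQuasiOrderedLE.finite_of_isAntichain (setOfPred_minimal_antichain _)
  · refine Set.iUnion_subset fun j => ?_
    rintro _ ⟨α, hα, rfl⟩
    exact hα.1
  · rintro ⟨α, j⟩ he
    obtain ⟨β, hβ, hmin⟩ := exists_minimal_le_of_wellFoundedLT (fun α => (α, j) ∈ S) α he
    exact ⟨(β, j), Set.mem_iUnion.2 ⟨j, β, hmin, rfl⟩, hβ, rfl⟩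

variable (N) in
/-- Standard bases exist and their leading exponents control the whole closure. -/
theorem exists_standardBasis : ∃ (T : Finset ((Fin n →₀ ℕ) × ι)) (f : T → ι → FormalSeries n),
    (∀ k : T, IsLead k.1 (f k)) ∧ (∀ k, f k ∈ N) ∧
      ∀ r ∈ adicClosure N, (∀ (k : T) α, k.1.1 ≤ α → MvPowerSeries.coeff α (r k.1.2) = 0) →
        r = 0 := by
  obtain ⟨T, hT, hTS, hdiv⟩ := exists_finite_dividing (leadSet N)
  choose f hfN hf using fun e : hT.toFinset => hTS (hT.mem_toFinset.1 e.2)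
  refine ⟨hT.toFinset, f, hf, hfN, fun r hr h => ?_⟩
  by_contra h0
  obtain ⟨e, he, hne⟩ := exists_mem_leadSet hr h0
  obtain ⟨a, ha, hle, h2⟩ := hdiv e he
  exact hne (by rw [← h2]; exact h ⟨a, hT.mem_toFinset.2 ha⟩ e.1 hle)

theorem smul_mem_adicClosure (q : FormalSeries n) {f : ι → FormalSeries n} (hf : f ∈ N) :
    q • f ∈ adicClosure N :=
  span_le_adicClosure (Submodule.smul_mem _ _ (Submodule.subset_span hf))

/-- Division by a standard basis leaves a remainder that is in the closure and avoids all leading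
monomials, hence is zero. -/
theorem mem_span_of_mem_adicClosure {v : ι → FormalSeries n} (hv : v ∈ adicClosure N) :
    v ∈ Submodule.span (FormalSeries n) (N : Set (ι → FormalSeries n)) := by
  obtain ⟨T, f, hf, hfN, h0⟩ := exists_standardBasis N
  obtain ⟨q, r, rfl, hr, -, -⟩ := exists_division hf v
  have hsum : ∑ k, q k • f k ∈ adicClosure N := sum_mem fun k _ => smul_mem_adicClosure _ (hfN k)
  have hr0 := h0 r (by simpa using sub_mem hv hsum) hr
  rw [hr0, add_zero]
  exact sum_mem fun k _ => Submodule.smul_mem _ _ (Submodule.subset_span (hfN k))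

/-- A convergent vector in the closure of a submodule belongs to the submodule. -/
theorem mem_of_mem_adicClosure (hN : N ≤ convergentVec n ι) {v : ι → FormalSeries n}
    (hv : v ∈ adicClosure N) (hc : v ∈ convergentVec n ι) : v ∈ N := by
  obtain ⟨T, f, hf, hfN, h0⟩ := exists_standardBasis N
  obtain ⟨q, r, rfl, hr, -, hconv⟩ := exists_division hf v
  -- The only difference from the formal case: convergent data give convergent quotients, which are
  -- allowed scalars for `N`.
  have hq := (hconv (fun k => hN (hfN k)) hc).1
  have hsum : ∑ k, q k • f k ∈ adicClosure N := sum_mem fun k _ => smul_mem_adicClosure _ (hfN k)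
  have hr0 := h0 r (by simpa using sub_mem hv hsum) hr
  rw [hr0, add_zero]
  exact sum_mem fun k _ => N.smul_mem ⟨q k, hq k⟩ (hfN k)

/-- The closure commutes with intersections. -/
theorem mem_adicClosure_inf (h₁ : N₁ ≤ convergentVec n ι) (h₂ : N₂ ≤ convergentVec n ι)
    {v : ι → FormalSeries n} (hv₁ : v ∈ adicClosure N₁) (hv₂ : v ∈ adicClosure N₂) :
    v ∈ adicClosure (N₁ ⊓ N₂) := by
  obtain ⟨T, f, hf, hfN, h0⟩ := exists_standardBasis (N₁ ⊔ N₂)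
  choose p hp m hm hpm using fun k => Submodule.mem_sup.1 (hfN k)
  intro M
  -- Division by `f k` loses a factor `key k.1`, so this precision leaves quotients whose monomials
  -- have `expNorm` at least `M`; the summand `M` makes `M'` at least `M` as well.
  set M' := M * ∑ k : T, key k.1 + M with hM'
  obtain ⟨v₁, hN₁, hl₁⟩ := hv₁ M'
  obtain ⟨v₂, hN₂, hl₂⟩ := hv₂ M'
  have hg : v₁ - v₂ ∈ N₁ ⊔ N₂ :=
    sub_mem (Submodule.mem_sup_left hN₁) (Submodule.mem_sup_right hN₂)
  have hgl : v₁ - v₂ ∈ lowSub n ι M' := by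
    rw [← sub_sub_sub_cancel_left _ _ v]
    exact sub_mem hl₂ hl₁
  obtain ⟨q, r, hqr, hr, hq, hconv⟩ := exists_division hf (v₁ - v₂)
  have hsup : N₁ ⊔ N₂ ≤ convergentVec n ι := sup_le h₁ h₂
  have hqc := (hconv (fun k => hsup (hfN k)) (hsup hg)).1
  have hsum : ∑ k, q k • f k ∈ adicClosure (N₁ ⊔ N₂) :=
    sum_mem fun k _ => smul_mem_adicClosure _ (hfN k)
  have hr0 := h0 r (by
    have := sub_mem (le_adicClosure hg) hsum
    rwa [hqr, add_sub_cancel_left] at this) hr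
  have hqp : ∑ k, q k • p k ∈ N₁ := sum_mem fun k _ => N₁.smul_mem ⟨q k, hqc k⟩ (hp k)
  have hqm : ∑ k, q k • m k ∈ N₂ := sum_mem fun k _ => N₂.smul_mem ⟨q k, hqc k⟩ (hm k)
  have hqpm : v₁ - v₂ = ∑ k, q k • p k + ∑ k, q k • m k := by
    rw [hqr, hr0, add_zero, ← Finset.sum_add_distrib]
    exact Finset.sum_congr rfl fun k _ => by rw [← smul_add, hpm]
  -- The approximations `v₁` and `v₂` differ by a small element of the sum. Writing each basis
  -- element as `p k + m k` once and for all distributes this difference between the two modules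
  -- with small coefficients, so both corrected approximations coincide.
  refine ⟨v₁ - ∑ k, q k • p k, ⟨sub_mem hN₁ hqp, ?_⟩, ?_⟩
  · have : v₁ - ∑ k, q k • p k = v₂ + ∑ k, q k • m k := by linear_combination hqpm
    rw [this]
    exact add_mem hN₂ hqm
  · rw [sub_sub_eq_add_sub, add_sub_right_comm]
    refine add_mem (lowSub_anti (Nat.le_add_left _ _) hl₁) (sum_mem fun k _ => ?_)
    refine smul_mem_lowSub_of_coeff (fun β hβ => ?_) _
    have h1 := hq M' hgl k β hβ
    have h2 : key k.1 ≤ ∑ k : T, key k.1 :=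
      Finset.single_le_sum (f := fun k : T => key k.1) (fun _ _ => Nat.zero_le _) (Finset.mem_univ k)
    have h3 := Nat.mul_le_mul_left M h2
    have h4 : M * key k.1 ≤ expNorm β * key k.1 := by omega
    exact Nat.le_of_mul_le_mul_right h4 (key_pos _)

end Limits


/-! ### Flatness with prescribed supports -/

section ExponentSets

variable {n : ℕ} {ι : Type*}

/-- `A` is stable under multiplication by monomials. -/
def IsUpperExp (A : Set ((Fin n →₀ ℕ) × ι)) : Prop := ∀ α β j, (α, j) ∈ A → (β + α, j) ∈ A

/-- All the monomials of `v` belong to `A`. -/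
def SuppIn (A : Set ((Fin n →₀ ℕ) × ι)) (v : ι → FormalSeries n) : Prop :=
  ∀ α j, MvPowerSeries.coeff α (v j) ≠ 0 → (α, j) ∈ A

theorem SuppIn.add {A : Set ((Fin n →₀ ℕ) × ι)} {v w : ι → FormalSeries n} (hv : SuppIn A v)
    (hw : SuppIn A w) : SuppIn A (v + w) := by
  intro α j h
  by_cases h' : MvPowerSeries.coeff α (v j) = 0
  · exact hw α j (by simpa [h'] using h)
  · exact hv α j h'

/-- The convergent vectors with monomials in `A`. -/
def suppSub {A : Set ((Fin n →₀ ℕ) × ι)} (hA : IsUpperExp A) :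
    Submodule (convergentSeries n) (ι → FormalSeries n) where
  carrier := {v | v ∈ convergentVec n ι ∧ SuppIn A v}
  zero_mem' := ⟨zero_mem _, by intro α j h; simp at h⟩
  add_mem' hv hw := ⟨add_mem hv.1 hw.1, hv.2.add hw.2⟩
  smul_mem' := by
    classical
    rintro c v ⟨hv, hv'⟩
    refine ⟨(convergentVec n ι).smul_mem c hv, fun α j h => ?_⟩
    change MvPowerSeries.coeff α ((c : FormalSeries n) * v j) ≠ 0 at h
    rw [MvPowerSeries.coeff_mul] at h
    obtain ⟨p, hp, hne⟩ := Finset.exists_ne_zero_of_sum_ne_zero h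
    rw [← Finset.HasAntidiagonal.mem_antidiagonal.1 hp]
    exact hA _ _ _ (hv' _ _ (right_ne_zero_of_mul hne))

theorem suppSub_le {A : Set ((Fin n →₀ ℕ) × ι)} (hA : IsUpperExp A) :
    suppSub hA ≤ convergentVec n ι := fun _ h => h.1

variable [Fintype ι]

/-- Truncation does not enlarge the support. -/
theorem SuppIn.mem_adicClosure {A : Set ((Fin n →₀ ℕ) × ι)} (hA : IsUpperExp A)
    {v : ι → FormalSeries n} (hv : SuppIn A v) : v ∈ adicClosure (suppSub hA) := by
  intro M
  choose d hd hd' using fun j => exists_convergent_sub (v j) M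
  refine ⟨fun j => d j, ⟨fun j => (d j).2, fun α j h => hv α j (hd j α h)⟩, fun α j h => ?_⟩
  exact (hd' j α h).trans (Nat.le_mul_of_pos_right _ (coordPrime_pos j))

variable {N : Submodule (convergentSeries n) (ι → FormalSeries n)}

/-- Flatness of formal power series over convergent ones, for the vectors with prescribed
support. -/
theorem SuppIn.mem_span_inf (hN : N ≤ convergentVec n ι) {A : Set ((Fin n →₀ ℕ) × ι)}
    (hA : IsUpperExp A) {v : ι → FormalSeries n} (hv : SuppIn A v)
    (hvN : v ∈ Submodule.span (FormalSeries n) (N : Set (ι → FormalSeries n))) :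
    v ∈ Submodule.span (FormalSeries n) ((N ⊓ suppSub hA : Submodule (convergentSeries n)
      (ι → FormalSeries n)) : Set (ι → FormalSeries n)) :=
  mem_span_of_mem_adicClosure (mem_adicClosure_inf hN (suppSub_le hA)
    (span_le_adicClosure hvN) (hv.mem_adicClosure hA))

/-- Faithful flatness of formal power series over convergent ones, for the vectors with prescribed
support. -/
theorem exists_mem_sub_suppIn (hN : N ≤ convergentVec n ι) {A B : Set ((Fin n →₀ ℕ) × ι)}
    (hA : IsUpperExp A) (hB : IsUpperExp B) {p v : ι → FormalSeries n}
    (hp : p ∈ convergentVec n ι) (hv : SuppIn A v)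
    (hvN : v ∈ Submodule.span (FormalSeries n) (N : Set (ι → FormalSeries n)))
    (hpv : SuppIn B (p - v)) :
    ∃ w ∈ N, SuppIn A w ∧ SuppIn B (p - w) := by
  have h1 : v ∈ adicClosure (N ⊓ suppSub hA) := mem_adicClosure_inf hN (suppSub_le hA)
    (span_le_adicClosure hvN) (hv.mem_adicClosure hA)
  -- Being both formally a sum and convergent, `p` is a sum of convergent elements; the first
  -- summand is the desired `w`.
  have h2 : p ∈ adicClosure ((N ⊓ suppSub hA) ⊔ suppSub hB) := by
    rw [← add_sub_cancel v p]
    exact add_mem (adicClosure_mono le_sup_left h1)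
      (adicClosure_mono le_sup_right (hpv.mem_adicClosure hB))
  have h3 := mem_of_mem_adicClosure
    (sup_le (inf_le_left.trans hN) (suppSub_le hB)) h2 hp
  obtain ⟨w, hw, b, hb, rfl⟩ := Submodule.mem_sup.1 h3
  exact ⟨w, hw.1, hw.2.2, by rw [add_sub_cancel_left]; exact hb.2⟩

end ExponentSets

/-! ### Truncation by weight and finiteness of the set of weights -/

section Restrict

variable {n : ℕ}

open Classical in
/-- The part of a power series made of the monomials in `A`. -/
def restrictExp (A : Set (Fin n →₀ ℕ)) : FormalSeries n →ₗ[ℂ] FormalSeries n where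
  toFun f α := if α ∈ A then MvPowerSeries.coeff α f else 0
  map_add' f g := by
    funext α
    by_cases h : α ∈ A
    · exact (if_pos h).trans ((map_add _ _ _).trans
        (congrArg₂ (· + ·) (if_pos h).symm (if_pos h).symm))
    · exact (if_neg h).trans ((add_zero _).symm.trans
        (congrArg₂ (· + ·) (if_neg h).symm (if_neg h).symm))
  map_smul' z f := by
    funext α
    by_cases h : α ∈ A
    · exact (if_pos h).trans (congrArg (z * ·) (if_pos h).symm)
    · exact (if_neg h).trans ((mul_zero z).symm.trans (congrArg (z * ·) (if_neg h).symm))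

theorem coeff_restrictExp (A : Set (Fin n →₀ ℕ)) (f : FormalSeries n) (α : Fin n →₀ ℕ) :
    MvPowerSeries.coeff α (restrictExp A f) = open Classical in
      if α ∈ A then MvPowerSeries.coeff α f else 0 := rfl

theorem IsConvergent.restrictExp {f : FormalSeries n} (hf : IsConvergent f)
    (A : Set (Fin n →₀ ℕ)) : IsConvergent (restrictExp A f) := by
  obtain ⟨r, hr, h⟩ := hf
  refine ⟨r, hr, h.of_nonneg_of_le (fun α => by positivity) fun α => ?_⟩
  rw [coeff_restrictExp]
  split_ifs
  · exact le_rfl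
  · rw [norm_zero, zero_mul]
    positivity

open Classical in
/-- The geometric series `∑ xᵢ^k`. -/
def geomSeries (i : Fin n) : FormalSeries n :=
  fun α => if α ∈ Set.range (fun k : ℕ => Finsupp.single i k) then 1 else 0

theorem coeff_geomSeries_ne_zero {i : Fin n} {α : Fin n →₀ ℕ} :
    MvPowerSeries.coeff α (geomSeries i) ≠ 0 ↔ ∃ k, Finsupp.single i k = α := by
  classical
  change (if _ then (1 : ℂ) else 0) ≠ 0 ↔ _
  simp

theorem isConvergent_geomSeries (i : Fin n) : IsConvergent (geomSeries i) := by
  classical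
  refine ⟨2⁻¹, by norm_num, ?_⟩
  have hinj : Function.Injective (fun k : ℕ => Finsupp.single i k) := Finsupp.single_injective i
  rw [← hinj.summable_iff]
  · refine (summable_geometric_of_lt_one (by norm_num) (by norm_num : (2⁻¹ : ℝ) < 1)).congr ?_
    intro k
    have : MvPowerSeries.coeff (Finsupp.single i k) (geomSeries i) = 1 := if_pos ⟨k, rfl⟩
    simp [this]
  · intro α hα
    have : MvPowerSeries.coeff α (geomSeries i) = 0 := if_neg hα
    simp [this]

/-- Whether a family of local weights takes finitely many values on a set of exponents depends
only on the set of the zero weights. -/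
theorem finite_weight_image {X : Type*} {S : Set X} {α : X → Fin n →₀ ℕ} {g g' : X → ℝ}
    (hg : (g '' S).Finite) (hg' : (g' '' S).Finite) {u u' : Fin n → ℝ} (hu : ∀ i, u i ≤ 0)
    (huu : ∀ i, u i = 0 → u' i = 0)
    (h : ((fun x => ∑ i, u i * α x i + g x) '' S).Finite) :
    ((fun x => ∑ i, u' i * α x i + g' x) '' S).Finite := by
  classical
  obtain ⟨m, hm⟩ := h.bddBelow
  obtain ⟨M, hM⟩ := hg.bddAbove
  have hbound : ∀ i, ∃ B : ℕ, ∀ x ∈ S, u i ≠ 0 → α x i ≤ B := by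
    intro i
    by_cases hi : u i = 0
    · exact ⟨0, fun x _ h => absurd hi h⟩
    have hi' : u i < 0 := lt_of_le_of_ne (hu i) hi
    -- All terms `u j * α x j` are nonpositive, `g` is at most `M` and the total is at least `m`, so
    -- `u i * α x i ≥ m - M`; dividing by `u i < 0` bounds the exponent.
    obtain ⟨B, hB⟩ := exists_nat_ge ((m - M) / u i)
    refine ⟨B, fun x hx _ => ?_⟩
    have h1 := hm (Set.mem_image_of_mem _ hx)
    have h2 := hM (Set.mem_image_of_mem _ hx)
    have h3 : ∑ i, u i * α x i ≤ u i * α x i := by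
      rw [← Finset.add_sum_erase _ _ (Finset.mem_univ i)]
      have : ∑ j ∈ Finset.univ.erase i, u j * (α x j : ℝ) ≤ 0 :=
        Finset.sum_nonpos fun j _ => mul_nonpos_of_nonpos_of_nonneg (hu j) (Nat.cast_nonneg _)
      linarith
    have h4 : (α x i : ℝ) ≤ (m - M) / u i := by
      rw [le_div_iff_of_neg hi']
      linarith
    exact_mod_cast h4.trans hB
  choose B hB using hbound
  refine (((Set.finite_Iic B).prod hg').image
    fun p : (Fin n → ℕ) × ℝ => ∑ i, u' i * p.1 i + p.2).subset ?_
  rintro _ ⟨x, hx, rfl⟩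
  -- Coordinates with `u i = 0` are unbounded but invisible to `u'`, so they may be reset to 0.
  refine ⟨(fun i => if u i = 0 then 0 else α x i, g' x), ⟨?_, Set.mem_image_of_mem _ hx⟩, ?_⟩
  · intro i
    dsimp only
    split_ifs with hi
    · exact Nat.zero_le _
    · exact hB i x hx hi
  · dsimp only
    congr 1
    refine Finset.sum_congr rfl fun i _ => ?_
    split_ifs with hi
    · rw [huu i hi, zero_mul, zero_mul]
    · rfl

end Restrict

/-! ### An invariant of the graded ring -/

section SameGrAbstract

variable {R E : Type*} [Ring R] {c : R →+ (E → ℂ)} {wt wt' : E → ℝ} [IsWeight c wt]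
  [IsWeight c wt']

theorem SameGr.symm (h : SameGr c wt wt') : SameGr c wt' wt := by
  obtain ⟨φ, hφ⟩ := h
  exact ⟨φ.symm, fun y => by rw [← hφ, φ.apply_symm_apply]⟩

/-- Having finitely many weights is membership in the image of the graded ring, so equal graded
rings have the same such elements. Test series then recover information on the weight. -/
theorem SameGr.finLevels (h : SameGr c wt wt') (hl : HasLevels c wt) {p : R}
    (hp : FinLevels wt (c p)) : FinLevels wt' (c p) := by
  obtain ⟨φ, hφ⟩ := h
  obtain ⟨x, hx⟩ := hl.exists_normalForm_eq hp
  rw [← hx, ← hφ]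
  exact finLevels_normalForm _

end SameGrAbstract

/-! ### The commutative case -/

section PowerSeriesRings

variable {n : ℕ} {R : Type*} [Ring R] {c : R →+ ((Fin n →₀ ℕ) → ℂ)} {j : R →+* FormalSeries n}
  {u u' : Uloc n} [IsWeight c (weightO u)] [IsWeight c (weightO u')]

theorem weightO_single (u : Uloc n) (i : Fin n) (k : ℕ) :
    weightO u (Finsupp.single i k) = u.1 i * k := by
  classical
  rw [weightO, Finset.sum_eq_single i]
  · simp
  · intro j _ hj
    simp [Ne.symm hj]
  · simp

/-- Weights of exponents are additive, so the top part of a product is the ordinary product of the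
top parts, whatever the weight. -/
theorem isSymbolProduct_powerSeries (hc : ∀ a, c a = coeffO n (j a)) :
    IsSymbolProduct c (weightO u) fun p q => c (p * q) := by
  classical
  intro s t a b p q hp hq
  have hp' : ∀ e, c p e = if weightO u e = s then c a e else 0 := fun e => congrFun hp e
  have hq' : ∀ e, c q e = if weightO u e = t then c b e else 0 := fun e => congrFun hq e
  have hps : ∀ e, c p e ≠ 0 → weightO u e = s := fun e he => by
    by_contra h
    exact he (by rw [hp', if_neg h])
  have hqs : ∀ e, c q e ≠ 0 → weightO u e = t := fun e he => by
    by_contra h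
    exact he (by rw [hq', if_neg h])
  have hap : (a : R) - p ∈ filtLT c (weightO u) s := by
    intro e he
    rw [map_sub, Pi.sub_apply, hp'] at he
    by_cases h : weightO u e = s
    · simp [h] at he
    · rw [if_neg h, sub_zero] at he
      exact lt_of_le_of_ne (a.2 e he) h
  have hbq : (b : R) - q ∈ filtLT c (weightO u) t := by
    intro e he
    rw [map_sub, Pi.sub_apply, hq'] at he
    by_cases h : weightO u e = t
    · simp [h] at he
    · rw [if_neg h, sub_zero] at he
      exact lt_of_le_of_ne (b.2 e he) h
  have hsub : (a : R) * b - p * q ∈ filtLT c (weightO u) (s + t) := by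
    have h : (a : R) * b - p * q = a * (b - q) + (a - p) * q := by noncomm_ring
    rw [h]
    exact add_mem (mul_mem_filtLT_right _ _ a.2 hbq)
      (mul_mem_filtLT_left _ _ hap fun e he => (hqs e he).le)
  ext e
  rw [levelPart_apply]
  split_ifs with he
  · by_contra hne
    refine (hsub e ?_).ne he
    rw [map_sub, Pi.sub_apply]
    exact sub_ne_zero.2 hne
  · by_contra hne
    have hne' : MvPowerSeries.coeff e (j p * j q) ≠ 0 := by
      rw [← map_mul]
      exact fun h0 => hne ((congrFun (hc (p * q)) e).trans h0).symm
    rw [MvPowerSeries.coeff_mul] at hne'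
    obtain ⟨x, hx, hxne⟩ := Finset.exists_ne_zero_of_sum_ne_zero hne'
    refine he ?_
    rw [← Finset.HasAntidiagonal.mem_antidiagonal.1 hx, weightO_add, hps x.1, hqs x.2]
    · rw [hc]; exact right_ne_zero_of_mul hxne
    · rw [hc]; exact left_ne_zero_of_mul hxne

/-- The geometric series in `x_i` has a single weight if `u i = 0` and infinitely many otherwise,
which gives necessity. The ring `R` is kept general so that the criterion applies to convergent and
formal series alike. -/
theorem sameGr_powerSeries_iff (hc : ∀ a, c a = coeffO n (j a)) (hj : Function.Injective j)
    (hl : ∀ u : Uloc n, HasLevels c (weightO u)) (hgeom : ∀ i, ∃ a, j a = geomSeries i) :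
    SameGr c (weightO u) (weightO u') ↔ ∀ i, u.1 i = 0 ↔ u'.1 i = 0 := by
  have key : ∀ (u u' : Uloc n) [IsWeight c (weightO u)] [IsWeight c (weightO u')],
      SameGr c (weightO u) (weightO u') → ∀ i, u.1 i = 0 → u'.1 i = 0 := by
    intro u u' _ _ h i hi
    obtain ⟨a, ha⟩ := hgeom i
    have hca : ∀ α, c a α ≠ 0 ↔ ∃ k, Finsupp.single i k = α := by
      intro α
      rw [hc, ha]
      exact coeff_geomSeries_ne_zero
    have hfin : FinLevels (weightO u) (c a) := by
      refine (Set.finite_singleton 0).subset ?_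
      rintro _ ⟨α, hα, rfl⟩
      obtain ⟨k, rfl⟩ := (hca α).1 hα
      rw [Set.mem_singleton_iff, weightO_single, hi, zero_mul]
    have hfin' := h.finLevels (hl u) hfin
    by_contra hne
    refine Set.infinite_of_injective_forall_mem (f := fun k : ℕ => u'.1 i * (k : ℝ)) ?_ ?_ hfin'
    · intro k l hkl
      exact_mod_cast mul_left_cancel₀ hne hkl
    · intro k
      exact ⟨Finsupp.single i k, (hca _).2 ⟨k, rfl⟩, weightO_single u' i k⟩
  refine ⟨fun h i => ⟨key u u' h i, key u' u h.symm i⟩, fun h => ?_⟩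
  have hinj : Function.Injective c := by
    intro a b hab
    refine hj (MvPowerSeries.ext fun α => ?_)
    rw [hc, hc] at hab
    exact congrFun hab α
  have hfin : ∀ u u' : Uloc n, (∀ i, u.1 i = 0 → u'.1 i = 0) → ∀ p,
      FinLevels (weightO u) (c p) → FinLevels (weightO u') (c p) := by
    intro u u' h p hp
    have h0 : ((fun _ : Fin n →₀ ℕ => (0 : ℝ)) '' {e | c p e ≠ 0}).Finite :=
      (Set.finite_singleton 0).subset (by rintro _ ⟨_, _, rfl⟩; rfl)
    have := finite_weight_image (S := {e | c p e ≠ 0}) (α := id) h0 h0 u.2 h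
      (by simp only [add_zero]; exact hp)
    simp only [add_zero] at this
    exact this
  let star : R →+ R →+ ((Fin n →₀ ℕ) → ℂ) :=
    AddMonoidHom.mk' (fun p => c.comp (AddMonoidHom.mulLeft p)) (by
      intro p p'
      ext q
      simp [add_mul])
  exact sameGr_of_symbolProduct hinj (hl u) (hl u')
    (fun p => ⟨hfin u u' (fun i => (h i).1) p, hfin u' u (fun i => (h i).2) p⟩) star
    (isSymbolProduct_powerSeries hc) (isSymbolProduct_powerSeries hc)

theorem hasLevels_coeffO (u : Uloc n) : HasLevels (coeffO n) (weightO u) :=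
  fun t p => ⟨restrictExp {e | weightO u e = t} p, fun e => coeff_restrictExp _ p e⟩

theorem hasLevels_coeffO₀ (u : Uloc n) : HasLevels (coeffO₀ n) (weightO u) :=
  fun t p => ⟨⟨restrictExp {e | weightO u e = t} p, p.2.restrictExp _⟩,
    fun e => coeff_restrictExp _ p.1 e⟩

theorem sameGr_coeffO₀_iff :
    SameGr (coeffO₀ n) (weightO u) (weightO u') ↔ SameGr (coeffO n) (weightO u) (weightO u') := by
  rw [sameGr_powerSeries_iff (c := coeffO₀ n) (j := (convergentSeries n).subtype) (fun _ => rfl)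
      Subtype.val_injective hasLevels_coeffO₀ fun i => ⟨⟨_, isConvergent_geomSeries i⟩, rfl⟩,
    sameGr_powerSeries_iff (c := coeffO n) (j := RingHom.id _) (fun _ => rfl)
      Function.injective_id hasLevels_coeffO fun i => ⟨_, rfl⟩]

/-- Locality enters here: multiplication by a monomial cannot raise a weight with `u ≤ 0`. -/
theorem isUpperExp_weightO (u : Uloc n) {P : ℝ → Prop} (hP : ∀ s t, s ≤ t → P t → P s) :
    IsUpperExp {e : (Fin n →₀ ℕ) × Unit | P (weightO u e.1)} := by
  intro α β j h
  refine hP _ _ ?_ h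
  rw [weightO_add]
  have : weightO u β ≤ 0 :=
    Finset.sum_nonpos fun i _ => mul_nonpos_of_nonpos_of_nonneg (u.2 i) (Nat.cast_nonneg _)
  linarith

/-- The ideal is viewed as a submodule of the free module of rank one, and the two support
conditions are "weight ≤ t" and "weight < t". -/
theorem isCompatible_powerSeries (u : Uloc n) (I : Ideal (convergentSeries n)) :
    IsCompatible (coeffO₀ n) (coeffO n) (convergentSeries n).subtype (weightO u) I := by
  let N : Submodule (convergentSeries n) (Unit → FormalSeries n) :=
    { carrier := {v | ∃ a ∈ I, v = fun _ => (a : FormalSeries n)}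
      zero_mem' := ⟨0, I.zero_mem, rfl⟩
      add_mem' := by
        rintro _ _ ⟨a, ha, rfl⟩ ⟨b, hb, rfl⟩
        exact ⟨a + b, I.add_mem ha hb, rfl⟩
      smul_mem' := by
        rintro d _ ⟨a, ha, rfl⟩
        exact ⟨d * a, I.mul_mem_left d ha, rfl⟩ }
  have hN : N ≤ convergentVec n Unit := by
    rintro _ ⟨a, -, rfl⟩ _
    exact a.2
  have hspan : ∀ a ∈ I.map (convergentSeries n).subtype, (fun _ => a : Unit → FormalSeries n) ∈
      Submodule.span (FormalSeries n) (N : Set (Unit → FormalSeries n)) := by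
    intro a ha
    induction ha using Submodule.closure_induction with
    | zero => exact zero_mem _
    | add x y _ _ hx hy => exact add_mem hx hy
    | smul_mem r x hx =>
      obtain ⟨a, ha, rfl⟩ := hx
      exact Submodule.smul_mem _ r (Submodule.subset_span ⟨a, ha, rfl⟩)
  have hA : ∀ t, IsUpperExp {e : (Fin n →₀ ℕ) × Unit | weightO u e.1 ≤ t} := fun t =>
    isUpperExp_weightO u (P := fun x => x ≤ t) fun _ _ h h' => h.trans h'
  have hB : ∀ t, IsUpperExp {e : (Fin n →₀ ℕ) × Unit | weightO u e.1 < t} := fun t =>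
    isUpperExp_weightO u (P := fun x => x < t) fun _ _ h h' => h.trans_lt h'
  refine ⟨hasLevels_coeffO₀ u, fun t a ha hat => ?_, fun t p hp a ha hat hpa => ?_⟩
  · have h1 := SuppIn.mem_span_inf hN (hA t) (v := fun _ => a) (fun α _ h => hat α h) (hspan a ha)
    have key : ∀ v ∈ Submodule.span (FormalSeries n) ((N ⊓ suppSub (hA t) :
        Submodule (convergentSeries n) (Unit → FormalSeries n)) : Set (Unit → FormalSeries n)),
        v () ∈ AddSubgroup.closure {x | ∃ d ∈ filt (coeffO n) (weightO u) 0, ∃ a₀ ∈ I,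
          a₀ ∈ filt (coeffO₀ n) (weightO u) t ∧ x = d * (convergentSeries n).subtype a₀} := by
      intro v hv
      induction hv using Submodule.closure_induction with
      | zero => exact zero_mem _
      | add x y _ _ hx hy => exact add_mem hx hy
      | smul_mem r x hx =>
        obtain ⟨⟨a, ha, rfl⟩, -, hat⟩ := hx
        refine AddSubgroup.subset_closure ⟨r, fun e _ => ?_, a, ha, fun α h => hat α () h, rfl⟩
        exact Finset.sum_nonpos fun i _ =>
          mul_nonpos_of_nonpos_of_nonneg (u.2 i) (Nat.cast_nonneg _)
    exact key _ h1
  · obtain ⟨_, ⟨a₀, ha₀, rfl⟩, hw, hw'⟩ := exists_mem_sub_suppIn hN (hA t) (hB t)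
      (p := fun _ => p.1) (v := fun _ => a) (fun _ => p.2) (fun α _ h => hat α h) (hspan a ha)
      (fun α _ h => hpa α h)
    exact ⟨a₀, ha₀, fun α h => hw α () h, fun α h => hw' α () h⟩

theorem grobnerFan_powerSeries (I : Ideal (convergentSeries n)) :
    grobnerFan (coeffO₀ n) weightO I
      = grobnerFan (coeffO n) weightO (I.map (convergentSeries n).subtype) := by
  unfold grobnerFan
  congr 1
  funext u
  ext u'
  refine exists_congr fun h => ?_
  exact sameInitial_iff (isCompatible_powerSeries u I) (isCompatible_powerSeries ⟨u', h⟩ I)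
    (fun _ => rfl) sameGr_coeffO₀_iff

end PowerSeriesRings


/-! ### The grading of the ring of operators -/

namespace HD

variable {n : ℕ}

/-- The degree of `∂^β h^k`. -/
def bdeg (b : (Fin n →₀ ℕ) × ℕ) : ℕ := b.1.degree + b.2

theorem linearMap_apply_eq_sum {M : Type*} [AddCommMonoid M] [Module ℂ M] (A : HD n →ₗ[ℂ] M)
    (Q : HD n) : A Q = ∑ b ∈ Q.support, A (term b (coef Q b)) := by
  conv_lhs => rw [eq_sum_term Q]
  exact map_sum _ _ _

/-- `coef` as a linear map. -/
def coefL (b : (Fin n →₀ ℕ) × ℕ) : HD n →ₗ[ℂ] FormalSeries n := Finsupp.lapply b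

theorem coefL_apply (b : (Fin n →₀ ℕ) × ℕ) (P : HD n) : coefL b P = coef P b := rfl

theorem coef_sum {κ : Type*} (T : Finset κ) (P : κ → HD n) (b) :
    coef (∑ k ∈ T, P k) b = ∑ k ∈ T, coef (P k) b := map_sum (coefL b) P T

theorem coef_mulC (a : FormalSeries n) (P : HD n) (b) : coef (mulC a P) b = a * coef P b := by
  suffices h : (coefL b).comp (mulC a) = (LinearMap.mulLeft ℂ a).comp (coefL b) from
    LinearMap.congr_fun h P
  classical
  refine linearMap_ext fun b' c => ?_
  simp only [LinearMap.comp_apply, mulC_term, coefL_apply, coef_term, LinearMap.mulLeft_apply]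
  split_ifs <;> simp

/-- All the terms of `P` have degree `d`. -/
def IsHom (d : ℕ) (P : HD n) : Prop := ∀ b, coef P b ≠ 0 → bdeg b = d

theorem IsHom.sum {κ : Type*} {T : Finset κ} {P : κ → HD n} {d : ℕ}
    (h : ∀ k ∈ T, IsHom d (P k)) : IsHom d (∑ k ∈ T, P k) := by
  intro b hb
  rw [coef_sum] at hb
  obtain ⟨k, hk, hne⟩ := Finset.exists_ne_zero_of_sum_ne_zero hb
  exact h k hk b hne

theorem IsHom.add {P Q : HD n} {d : ℕ} (hP : IsHom d P) (hQ : IsHom d Q) : IsHom d (P + Q) := by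
  intro b hb
  by_cases h : coef P b = 0
  · exact hQ b (by simpa [h] using hb)
  · exact hP b h

theorem isHom_term (b) (c : FormalSeries n) : IsHom (bdeg b) (term b c) := by
  classical
  intro b' hb'
  rw [coef_term] at hb'
  split_ifs at hb' with h
  · rw [h]
  · exact absurd rfl hb'

/-- The operator `A` raises degrees by `s`. -/
def RaisesDeg (s : ℕ) (A : Module.End ℂ (HD n)) : Prop := ∀ b c, IsHom (bdeg b + s) (A (term b c))

theorem RaisesDeg.apply {s : ℕ} {A : Module.End ℂ (HD n)} (hA : RaisesDeg s A) {d : ℕ} {Q : HD n}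
    (hQ : IsHom d Q) : IsHom (d + s) (A Q) := by
  rw [linearMap_apply_eq_sum]
  refine IsHom.sum fun b hb => ?_
  rw [← hQ b (Finsupp.mem_support_iff.1 hb)]
  exact hA b _

theorem RaisesDeg.mul {s t : ℕ} {A B : Module.End ℂ (HD n)} (hA : RaisesDeg s A)
    (hB : RaisesDeg t B) : RaisesDeg (t + s) (A * B) := by
  intro b c
  rw [← add_assoc]
  exact hA.apply (hB b c)

theorem raisesDeg_one : RaisesDeg 0 (1 : Module.End ℂ (HD n)) := fun b c => isHom_term b c

theorem raisesDeg_mulC (a : FormalSeries n) : RaisesDeg 0 (mulC a) := by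
  intro b c
  rw [mulC_term]
  exact isHom_term b _

theorem raisesDeg_mulH : RaisesDeg 1 (mulH (n := n)) := by
  intro b c
  rw [mulH_term]
  exact isHom_term (b.1, b.2 + 1) c

theorem raisesDeg_mulD (i : Fin n) : RaisesDeg 1 (mulD i) := by
  intro b c
  rw [mulD_term]
  refine IsHom.add ?_ (isHom_term (b.1, b.2 + 1) _)
  have h : bdeg b + 1 = bdeg (b.1 + Finsupp.single i 1, b.2) := by
    simp only [bdeg, map_add, Finsupp.degree_single]
    omega
  rw [h]
  exact isHom_term _ _

theorem raisesDeg_mulH_pow (k : ℕ) : RaisesDeg k (mulH (n := n) ^ k) := by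
  induction k with
  | zero => exact raisesDeg_one
  | succ k ih =>
    rw [pow_succ, add_comm]
    exact ih.mul raisesDeg_mulH

theorem raisesDeg_mulDPow (β : Fin n →₀ ℕ) : RaisesDeg β.degree (mulDPow β) := by
  induction β using Finsupp.induction_linear with
  | zero => simpa using raisesDeg_one
  | add β β' h h' =>
    rw [mulDPow_add, map_add, add_comm]
    exact h.mul h'
  | single i m =>
    induction m with
    | zero => simpa using raisesDeg_one
    | succ m ih =>
      rw [Finsupp.single_add, mulDPow_add, mulDPow_single, map_add, Finsupp.degree_single i 1,
        add_comm]
      exact ih.mul (raisesDeg_mulD i)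

/-- The variable `h` makes the commutation relation homogeneous: both `c ∂_i` and `(∂c/∂x_i) h` have
degree 1. -/
theorem IsHom.mul {P Q : HD n} {d e : ℕ} (hP : IsHom d P) (hQ : IsHom e Q) :
    IsHom (d + e) (P * Q) := by
  have h : P * Q = ((LinearMap.applyₗ Q).comp mulLeft) P := rfl
  rw [h, linearMap_apply_eq_sum]
  refine IsHom.sum fun b hb => ?_
  have hb' := hP b (Finsupp.mem_support_iff.1 hb)
  rw [LinearMap.comp_apply, LinearMap.applyₗ_apply_apply, mulLeft_term]
  have := ((raisesDeg_mulC (coef P b)).mul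
    ((raisesDeg_mulDPow b.1).mul (raisesDeg_mulH_pow b.2))).apply hQ
  rw [add_zero] at this
  rw [← hb', bdeg, add_comm b.1.degree, add_comm]
  exact this

/-- The indices of the terms of degree `d`. -/
abbrev DegIndex (n d : ℕ) : Type := {b : (Fin n →₀ ℕ) × ℕ // bdeg b = d}

/-- This finiteness is what brings the theory of free modules of finite rank to bear on operators,
one degree at a time. -/
instance (d : ℕ) : Finite (DegIndex n d) := by
  have hle : ∀ (b : DegIndex n d) (i : Fin n), b.1.1 i < d + 1 := fun b i => by
    have h1 := Finsupp.le_degree i b.1.1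
    have h2 := b.2
    rw [bdeg] at h2
    omega
  refine Finite.of_injective (fun b : DegIndex n d => fun i => (⟨b.1.1 i, hle b i⟩ : Fin (d + 1)))
    fun b b' h => ?_
  have h1 : b.1.1 = b'.1.1 := by
    ext i
    exact congrArg Fin.val (congrFun h i)
  have h2 := b.2
  have h3 := b'.2
  rw [bdeg] at h2 h3
  exact Subtype.ext (Prod.ext h1 (by rw [h1] at h2; omega))

instance (d : ℕ) : Fintype (DegIndex n d) := Fintype.ofFinite _

/-- The terms of degree `d`. -/
def restr (d : ℕ) : HD n →+ (DegIndex n d → FormalSeries n) where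
  toFun P b := coef P b.1
  map_zero' := rfl
  map_add' _ _ := rfl

theorem restr_apply (d : ℕ) (P : HD n) (b : DegIndex n d) : restr d P b = coef P b.1 := rfl

/-- The element with given terms of degree `d`. -/
def embed (d : ℕ) : (DegIndex n d → FormalSeries n) →+ HD n where
  toFun v := ∑ b, term b.1 (v b)
  map_zero' := by simp
  map_add' v w := by simp [Finset.sum_add_distrib]

theorem coef_embed (d : ℕ) (v : DegIndex n d → FormalSeries n) (b) :
    coef (embed d v) b = if h : bdeg b = d then v ⟨b, h⟩ else 0 := by
  classical
  change coef (∑ b : DegIndex n d, term b.1 (v b)) b = _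
  rw [coef_sum]
  simp only [coef_term]
  split_ifs with h
  · rw [Finset.sum_eq_single ⟨b, h⟩]
    · simp
    · intro b' _ hb'
      exact if_neg fun h' => hb' (Subtype.ext h')
    · intro h'
      exact absurd (Finset.mem_univ _) h'
  · refine Finset.sum_eq_zero fun b' _ => ?_
    rw [if_neg]
    rintro rfl
    exact h b'.2

/-- The homogeneous component of degree `d`. -/
def comp (d : ℕ) : HD n →+ HD n := (embed d).comp (restr d)

theorem comp_apply (d : ℕ) (P : HD n) : comp d P = embed d (restr d P) := rfl

theorem coef_comp (d : ℕ) (P : HD n) (b) :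
    coef (comp d P) b = if bdeg b = d then coef P b else 0 := by
  rw [comp_apply, coef_embed]
  split_ifs <;> rfl

theorem isHom_comp (d : ℕ) (P : HD n) : IsHom d (comp d P) := by
  intro b hb
  rw [coef_comp] at hb
  by_contra h
  exact hb (if_neg h)

theorem IsHom.comp_eq {d : ℕ} {P : HD n} (h : IsHom d P) (e : ℕ) :
    comp e P = if d = e then P else 0 := by
  refine ext fun b => ?_
  rw [coef_comp]
  by_cases h0 : coef P b = 0
  · split_ifs <;> simp [h0]
  · rw [h b h0]
    split_ifs <;> rfl

theorem exists_sum_comp (P : HD n) : ∃ D, ∀ D', D ≤ D' → ∑ d ∈ Finset.range D', comp d P = P := by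
  refine ⟨P.support.sup bdeg + 1, fun D' hD' => ext fun b => ?_⟩
  rw [coef_sum]
  simp only [coef_comp]
  rw [Finset.sum_ite_eq]
  split_ifs with h
  · rfl
  · by_contra hne
    refine h (Finset.mem_range.2 (lt_of_lt_of_le (Nat.lt_succ_of_le ?_) hD'))
    exact Finset.le_sup (f := bdeg) (Finsupp.mem_support_iff.2 (Ne.symm hne))

theorem embed_smul (d : ℕ) (r : FormalSeries n) (v : DegIndex n d → FormalSeries n) :
    embed d (r • v) = C r * embed d v := by
  refine ext fun b => ?_
  rw [C_mul, coef_mulC, coef_embed, coef_embed]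
  split_ifs <;> simp

theorem restr_C_mul (d : ℕ) (r : FormalSeries n) (P : HD n) :
    restr d (C r * P) = r • restr d P := by
  funext b
  rw [C_mul, restr_apply, coef_mulC]
  rfl

theorem mul_eq_sum_C_mul (P Q : HD n) :
    P * Q = ∑ b ∈ P.support, C (coef P b) * (term b 1 * Q) := by
  conv_lhs => rw [eq_sum_term P, Finset.sum_mul]
  refine Finset.sum_congr rfl fun b _ => ?_
  rw [← mul_assoc, C_mul, mulC_term, mul_one]

end HD

/-! ### Compatibility for homogeneous left ideals -/

open HD

variable {n : ℕ}

theorem isConvergent_one : IsConvergent (1 : FormalSeries n) := (convergentSeries n).one_mem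

theorem C_mem_convergentHD {r : FormalSeries n} (hr : IsConvergent r) : C r ∈ convergentHD n :=
  term_mem_convergentAddHD 0 hr

theorem comp_mem_convergentHD (d : ℕ) {P : HD n} (hP : P ∈ convergentHD n) :
    comp d P ∈ convergentHD n := by
  intro b
  rw [coef_comp]
  split_ifs
  · exact hP b
  · exact (convergentSeries n).zero_mem

/-- The homogeneous component of degree `d`, for convergent coefficients. -/
def comp₀ (d : ℕ) : convergentHD n →+ convergentHD n where
  toFun P := ⟨comp d P, comp_mem_convergentHD d P.2⟩
  map_zero' := Subtype.ext (map_zero _)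
  map_add' _ _ := Subtype.ext (map_add _ _ _)

/-- The homogeneity hypothesis is used here: it turns a vector of `gradedPart I d` back into an
element of `I` with no terms in other degrees. -/
theorem comp₀_mem {I : Ideal (convergentHD n)} (hI : IsHomogeneousIdeal I) {P : convergentHD n}
    (hP : P ∈ I) (d : ℕ) : comp₀ d P ∈ I := by
  obtain ⟨S, hS, rfl⟩ := hI
  induction hP using Submodule.closure_induction with
  | zero => rw [map_zero]; exact zero_mem _
  | add x y _ _ hx hy => rw [map_add]; exact add_mem hx hy
  | smul_mem r s hs =>
    obtain ⟨e, he⟩ := hS s hs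
    have he' : IsHom e (s : HD n) := he
    obtain ⟨D, hD⟩ := exists_sum_comp (r : HD n)
    have hr : r = ∑ f ∈ Finset.range D, comp₀ f r := Subtype.ext (by
      rw [AddSubmonoidClass.coe_finsetSum]
      exact (hD D le_rfl).symm)
    rw [hr, Finset.sum_smul, map_sum]
    refine sum_mem fun f _ => ?_
    have h : comp₀ d (comp₀ f r • s) = if f + e = d then comp₀ f r • s else 0 := by
      refine Subtype.ext ((((isHom_comp f (r : HD n)).mul he').comp_eq d).trans ?_)
      split_ifs <;> rfl
    rw [h]
    split_ifs
    · exact Submodule.smul_mem _ _ (Ideal.subset_span hs)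
    · exact zero_mem _

/-- The homogeneous part of degree `d` of an ideal, as a submodule of a free module of finite
rank. -/
def gradedPart (I : Ideal (convergentHD n)) (d : ℕ) :
    Submodule (convergentSeries n) (DegIndex n d → FormalSeries n) where
  carrier := {v | ∃ P ∈ I, v = restr d (P : HD n)}
  zero_mem' := ⟨0, I.zero_mem, rfl⟩
  add_mem' := by
    rintro _ _ ⟨P, hP, rfl⟩ ⟨Q, hQ, rfl⟩
    exact ⟨P + Q, I.add_mem hP hQ, (map_add _ _ _).symm⟩
  smul_mem' := by
    rintro r _ ⟨P, hP, rfl⟩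
    refine ⟨⟨C r, C_mem_convergentHD r.2⟩ * P, I.mul_mem_left _ hP, ?_⟩
    rw [Subring.coe_mul, restr_C_mul, Subring.smul_def]

theorem gradedPart_le (I : Ideal (convergentHD n)) (d : ℕ) :
    gradedPart I d ≤ convergentVec n (DegIndex n d) := by
  rintro _ ⟨P, -, rfl⟩ b
  exact P.2 b.1

/-- Formal series can be kept on the left: `r * P` is a combination of the products `∂^β h^k * P`,
which still belong to the convergent ideal. Thus the noncommutative extension of `I` is an extension
of scalars in each degree. -/
theorem restr_mem_span_gradedPart {I : Ideal (convergentHD n)} {P : HD n}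
    (hP : P ∈ I.map (convergentHD n).subtype) (d : ℕ) :
    restr d P ∈ Submodule.span (FormalSeries n)
      (gradedPart I d : Set (DegIndex n d → FormalSeries n)) := by
  induction hP using Submodule.closure_induction with
  | zero => rw [map_zero]; exact zero_mem _
  | add x y _ _ hx hy => rw [map_add]; exact add_mem hx hy
  | smul_mem r x hx =>
    obtain ⟨P, hP, rfl⟩ := hx
    rw [smul_eq_mul, mul_eq_sum_C_mul, map_sum]
    refine sum_mem fun b _ => ?_
    rw [restr_C_mul]
    have hb : term b 1 ∈ convergentHD n := term_mem_convergentAddHD b isConvergent_one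
    refine Submodule.smul_mem _ _ (Submodule.subset_span
      ⟨⟨term b 1, hb⟩ * P, I.mul_mem_left _ hP, ?_⟩)
    rw [Subring.coe_mul]
    rfl

theorem weightD_add_left (w : Wloc n) (α β : Fin n →₀ ℕ) (b) :
    weightD w (β + α, b) = ∑ i, w.1.1 i * β i + weightD w (α, b) := by
  simp [weightD, mul_add, Finset.sum_add_distrib, add_assoc]

theorem sum_weight_nonpos (w : Wloc n) (β : Fin n →₀ ℕ) : ∑ i, w.1.1 i * (β i : ℝ) ≤ 0 :=
  Finset.sum_nonpos fun i _ => mul_nonpos_of_nonpos_of_nonneg (w.2 i).1 (Nat.cast_nonneg _)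

theorem isUpperExp_weightD (w : Wloc n) (d : ℕ) {P : ℝ → Prop} (hP : ∀ s t, s ≤ t → P t → P s) :
    IsUpperExp {e : (Fin n →₀ ℕ) × DegIndex n d | P (weightD w (e.1, e.2.1))} := by
  intro α β j h
  refine hP _ _ ?_ h
  rw [weightD_add_left]
  linarith [sum_weight_nonpos w β]

theorem C_mem_filt_zero (w : Wloc n) (r : FormalSeries n) : C r ∈ filt (coeffD n) (weightD w) 0 := by
  intro e he
  obtain ⟨h1, -⟩ := coeffD_term_ne (b := 0) he
  have : weightD w e = ∑ i, w.1.1 i * (e.1 i : ℝ) := by simp [weightD, h1]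
  rw [this]
  exact sum_weight_nonpos w e.1

/-- The part of weight `t`. -/
def levD (w : Wloc n) (t : ℝ) : Module.End ℂ (HD n) :=
  HD.lift fun b => (term b).comp (restrictExp {α | weightD w (α, b) = t})

theorem levD_term (w : Wloc n) (t : ℝ) (b) (c : FormalSeries n) :
    levD w t (term b c) = term b (restrictExp {α | weightD w (α, b) = t} c) := by
  simp [levD]

theorem coef_levD (w : Wloc n) (t : ℝ) (P : HD n) (b) :
    coef (levD w t P) b = restrictExp {α | weightD w (α, b) = t} (coef P b) := by
  classical
  suffices h : (coefL b).comp (levD w t) = (restrictExp {α | weightD w (α, b) = t}).comp (coefL b)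
    from LinearMap.congr_fun h P
  refine linearMap_ext fun b' c => ?_
  simp only [LinearMap.comp_apply, levD_term, coefL_apply, coef_term]
  split_ifs with h
  · rw [h]
  · rw [map_zero]

theorem coeffD_levD (w : Wloc n) (t : ℝ) (P : HD n) (e : ExpD n) :
    coeffD n (levD w t P) e = open Classical in if weightD w e = t then coeffD n P e else 0 := by
  rw [coeffD_apply, coef_levD, coeff_restrictExp]
  rfl

theorem hasLevels_coeffD (w : Wloc n) : HasLevels (coeffD n) (weightD w) :=
  fun t P => ⟨levD w t P, coeffD_levD w t P⟩

theorem hasLevels_coeffD₀ (w : Wloc n) : HasLevels (coeffD₀ n) (weightD w) :=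
  fun t P => ⟨⟨levD w t P, fun b => by rw [coef_levD]; exact (P.2 b).restrictExp _⟩,
    coeffD_levD w t P.1⟩

/-- Taking homogeneous components does not enlarge supports, so the order conditions may be checked
degree by degree; the results for supports are applied to each graded part. -/
theorem isCompatible_HD (w : Wloc n) {I : Ideal (convergentHD n)} (hI : IsHomogeneousIdeal I) :
    IsCompatible (coeffD₀ n) (coeffD n) (convergentHD n).subtype (weightD w) I := by
  have hA : ∀ t d, IsUpperExp {e : (Fin n →₀ ℕ) × DegIndex n d | weightD w (e.1, e.2.1) ≤ t} :=
    fun t d => isUpperExp_weightD w d (P := fun x => x ≤ t) fun _ _ h h' => h.trans h'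
  have hB : ∀ t d, IsUpperExp {e : (Fin n →₀ ℕ) × DegIndex n d | weightD w (e.1, e.2.1) < t} :=
    fun t d => isUpperExp_weightD w d (P := fun x => x < t) fun _ _ h h' => h.trans_lt h'
  have hcomp : ∀ (s : Set (ExpD n)) (d : ℕ) (P : HD n),
      (∀ α (b : DegIndex n d), MvPowerSeries.coeff α (restr d P b) ≠ 0 → (α, b.1) ∈ s) →
      ∀ e, coeffD n (comp d P) e ≠ 0 → e ∈ s := by
    intro s d P h e he
    rw [coeffD_apply, coef_comp] at he
    split_ifs at he with hd
    · exact h e.1 ⟨e.2, hd⟩ he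
    · exact absurd (map_zero _) he
  refine ⟨hasLevels_coeffD₀ w, fun t a ha hat => ?_, fun t p hp a ha hat hpa => ?_⟩
  · have key : ∀ d, ∀ v ∈ Submodule.span (FormalSeries n) ((gradedPart I d ⊓ suppSub (hA t d) :
        Submodule (convergentSeries n) (DegIndex n d → FormalSeries n)) :
          Set (DegIndex n d → FormalSeries n)),
        embed d v ∈ AddSubgroup.closure {x | ∃ r ∈ filt (coeffD n) (weightD w) 0, ∃ a₀ ∈ I,
          a₀ ∈ filt (coeffD₀ n) (weightD w) t ∧ x = r * (convergentHD n).subtype a₀} := by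
      intro d v hv
      induction hv using Submodule.closure_induction with
      | zero => rw [map_zero]; exact zero_mem _
      | add x y _ _ hx hy => rw [map_add]; exact add_mem hx hy
      | smul_mem r x hx =>
        obtain ⟨⟨P, hP, rfl⟩, -, hPt⟩ := hx
        refine AddSubgroup.subset_closure ⟨C r, C_mem_filt_zero w r, comp₀ d P, comp₀_mem hI hP d,
          ?_, embed_smul d r _⟩
        exact hcomp {e | weightD w e ≤ t} d P hPt
    obtain ⟨D, hD⟩ := exists_sum_comp a
    rw [← hD D le_rfl]
    refine sum_mem fun d _ => key d _ ?_
    exact SuppIn.mem_span_inf (gradedPart_le I d) (hA t d) (fun α b h => hat (α, b.1) h)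
      (restr_mem_span_gradedPart ha d)
  · have key : ∀ d, ∃ P ∈ I, (∀ e, coeffD n (comp d P) e ≠ 0 → weightD w e ≤ t) ∧
        ∀ e, coeffD n (comp d ((p : HD n) - P)) e ≠ 0 → weightD w e < t := by
      intro d
      obtain ⟨_, ⟨P, hP, rfl⟩, h1, h2⟩ := exists_mem_sub_suppIn (gradedPart_le I d) (hA t d)
        (hB t d) (p := restr d (p : HD n)) (v := restr d a) (fun b => p.2 b.1)
        (fun α b h => hat (α, b.1) h) (restr_mem_span_gradedPart ha d)
        (fun α b h => hpa (α, b.1) (by rwa [← map_sub] at h))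
      rw [← map_sub] at h2
      exact ⟨P, hP, hcomp {e | weightD w e ≤ t} d P h1, hcomp {e | weightD w e < t} d _ h2⟩
    choose P hP h1 h2 using key
    obtain ⟨D, hD⟩ := exists_sum_comp (p : HD n)
    have hp' : p = ∑ d ∈ Finset.range D, comp₀ d p := Subtype.ext (by
      rw [AddSubmonoidClass.coe_finsetSum]
      exact (hD D le_rfl).symm)
    -- Only the degrees occurring in `p` are needed. From each `P d` just the component of degree
    -- `d` is kept, as nothing is known about its other components.
    refine ⟨∑ d ∈ Finset.range D, comp₀ d (P d), sum_mem fun d _ => comp₀_mem hI (hP d) d,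
      sum_mem fun d _ => h1 d, ?_⟩
    nth_rewrite 1 [hp']
    rw [← Finset.sum_sub_distrib]
    refine sum_mem fun d _ => ?_
    rw [← map_sub]
    exact h2 d


/-! ### Symbols of products of operators -/

open HD

variable {n : ℕ}

theorem coeffD_injective : Function.Injective (coeffD n) := by
  intro P Q h
  refine HD.ext fun b => MvPowerSeries.ext fun α => ?_
  exact congrFun h (α, b)

/-- On the elements of order at most `t`, the part of weight `s + t` of the result of `A` is obtained
by applying `A'` to the part of weight `t`. -/
def IsSymbolOf (w : Wloc n) (s : ℝ) (A A' : Module.End ℂ (HD n)) : Prop :=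
  Shifts w s A ∧ ∀ t r, r = s + t → ∀ Q ∈ filt (coeffD n) (weightD w) t,
    levD w r (A Q) = A' (levD w t Q)

theorem Shifts.mem_filt {w : Wloc n} {s t r : ℝ} {A : Module.End ℂ (HD n)} (hA : Shifts w s A)
    (h : r = s + t) {Q : HD n} (hQ : Q ∈ filt (coeffD n) (weightD w) t) :
    A Q ∈ filt (coeffD n) (weightD w) r := by
  intro e he
  obtain ⟨e', h', hl⟩ := hA Q e he
  have := hQ e' h'
  linarith

theorem IsSymbolOf.mul {w : Wloc n} {s s' : ℝ} {A A' B B' : Module.End ℂ (HD n)}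
    (hA : IsSymbolOf w s A A') (hB : IsSymbolOf w s' B B') :
    IsSymbolOf w (s + s') (A * B) (A' * B') := by
  refine ⟨hA.1.mul hB.1, fun t r hr Q hQ => ?_⟩
  rw [Module.End.mul_apply, Module.End.mul_apply, ← hB.2 t (s' + t) rfl Q hQ]
  exact hA.2 (s' + t) r (by rw [hr, add_assoc]) _ (hB.1.mem_filt rfl hQ)

theorem term_coef_mem_filt {w : Wloc n} {t : ℝ} {Q : HD n}
    (hQ : Q ∈ filt (coeffD n) (weightD w) t) (b) :
    term b (coef Q b) ∈ filt (coeffD n) (weightD w) t := by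
  intro e he
  obtain ⟨rfl, h⟩ := coeffD_term_ne he
  exact hQ e h

theorem le_of_term_mem_filt {w : Wloc n} {t : ℝ} {b} {c : FormalSeries n}
    (h : term b c ∈ filt (coeffD n) (weightD w) t) {α : Fin n →₀ ℕ}
    (hα : MvPowerSeries.coeff α c ≠ 0) : weightD w (α, b) ≤ t := by
  refine h (α, b) ?_
  rw [coeffD_apply, coef_term, if_pos rfl]
  exact hα

theorem isSymbolOf_of_term {w : Wloc n} {s : ℝ} {A A' : Module.End ℂ (HD n)} (hA : Shifts w s A)
    (h : ∀ t b c, (∀ α, MvPowerSeries.coeff α c ≠ 0 → weightD w (α, b) ≤ t) →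
      levD w (s + t) (A (term b c)) = A' (levD w t (term b c))) : IsSymbolOf w s A A' := by
  refine ⟨hA, fun t r hr Q hQ => ?_⟩
  subst hr
  rw [eq_sum_term Q, map_sum, map_sum, map_sum, map_sum]
  exact Finset.sum_congr rfl fun b _ =>
    h t b _ fun α hα => le_of_term_mem_filt (term_coef_mem_filt hQ b) hα

theorem isSymbolOf_one (w : Wloc n) : IsSymbolOf w 0 1 1 :=
  ⟨Shifts.one w, fun t r hr Q _ => by rw [hr, zero_add]; rfl⟩

theorem isSymbolOf_mulH (w : Wloc n) : IsSymbolOf w 0 mulH mulH := by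
  refine isSymbolOf_of_term (shifts_mulH w) fun t b c _ => ?_
  rw [mulH_term, levD_term, levD_term, mulH_term, zero_add]
  rfl

/-- Multiplication by `∂ᵢ` in the commutative ring. -/
def shiftD (i : Fin n) : Module.End ℂ (HD n) := HD.lift fun b => term (b.1 + Finsupp.single i 1, b.2)

theorem shiftD_term (i : Fin n) (b) (c : FormalSeries n) :
    shiftD i (term b c) = term (b.1 + Finsupp.single i 1, b.2) c := by simp [shiftD]

theorem weightD_add_right (w : Wloc n) (α β γ : Fin n →₀ ℕ) (k : ℕ) :
    weightD w (α, (β + γ, k)) = weightD w (α, (β, k)) + ∑ i, w.1.2 i * γ i := by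
  simp [weightD, mul_add, Finset.sum_add_distrib, add_assoc]

theorem sum_mul_single (f : Fin n → ℝ) (i : Fin n) (m : ℕ) :
    ∑ j, f j * ((Finsupp.single i m : Fin n →₀ ℕ) j : ℝ) = f i * m := by
  classical
  rw [Finset.sum_eq_single i]
  · simp
  · intro j _ hj
    simp [Ne.symm hj]
  · simp

/-- The term with `∂c/∂x_i` loses one `x_i` while the other gains one `∂_i`, so their weights differ
by `u_i + v_i ≥ 0`. At 0 both terms survive; otherwise the derivative drops below the top level. -/
theorem isSymbolOf_mulD (w : Wloc n) (i : Fin n) :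
    IsSymbolOf w (w.1.2 i) (mulD i)
      (open Classical in if w.1.1 i + w.1.2 i = 0 then mulD i else shiftD i) := by
  refine isSymbolOf_of_term (shifts_mulD w i) fun t b c hc => ?_
  have h1 : {α | weightD w (α, (b.1 + Finsupp.single i 1, b.2)) = w.1.2 i + t}
      = {α | weightD w (α, b) = t} := by
    ext α
    rw [Set.mem_ofPred_eq, Set.mem_ofPred_eq, weightD_add_right, sum_mul_single, Nat.cast_one,
      mul_one, add_comm, add_left_cancel_iff]
  have h2 : ∀ α, weightD w (α + Finsupp.single i 1, b) = w.1.1 i + weightD w (α, b) := by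
    intro α
    rw [add_comm α, weightD_add_left, sum_mul_single, Nat.cast_one, mul_one]
  have h3 : ∀ α, weightD w (α, (b.1, b.2 + 1)) = weightD w (α, b) := fun _ => rfl
  rw [mulD_term, map_add, levD_term, levD_term, levD_term, h1]
  split_ifs with h
  · rw [mulD_term]
    congr 2
    ext α
    rw [coeff_restrictExp, MvPowerSeries.coeff_pderiv, MvPowerSeries.coeff_pderiv,
      coeff_restrictExp]
    have h4 : (α ∈ {α | weightD w (α, (b.1, b.2 + 1)) = w.1.2 i + t}) ↔
        α + Finsupp.single i 1 ∈ {α | weightD w (α, b) = t} := by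
      rw [Set.mem_ofPred_eq, Set.mem_ofPred_eq, h2, h3]
      constructor <;> intro <;> linarith
    simp only [h4]
    split_ifs <;> simp
  · rw [shiftD_term]
    -- A surviving coefficient would have weight `v_i + t`, whereas `c` bounds it by `t - u_i`; this
    -- forces `u_i + v_i = 0`.
    have h4 : restrictExp {α | weightD w (α, (b.1, b.2 + 1)) = w.1.2 i + t}
        (MvPowerSeries.pderiv ℂ i c) = 0 := by
      ext α
      rw [coeff_restrictExp, MvPowerSeries.coeff_pderiv]
      split_ifs with h5
      · by_contra hne
        have h6 := hc _ (left_ne_zero_of_mul hne)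
        rw [h2] at h6
        rw [Set.mem_ofPred_eq, h3] at h5
        have h7 := (w.2 i).2
        exact h (by linarith)
      · exact (map_zero _).symm
    rw [h4, map_zero, add_zero]

/-- The point is the common operator `A'`: the symbol of each `∂_i` depends on the weight only
through the vanishing of `u_i + v_i`. -/
theorem exists_symbol_mulDPow {w w' : Wloc n}
    (hw : ∀ i, w.1.1 i + w.1.2 i = 0 ↔ w'.1.1 i + w'.1.2 i = 0) (β : Fin n →₀ ℕ) :
    ∃ A', IsSymbolOf w (∑ i, w.1.2 i * β i) (mulDPow β) A' ∧
      IsSymbolOf w' (∑ i, w'.1.2 i * β i) (mulDPow β) A' := by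
  classical
  induction β using Finsupp.induction_linear with
  | zero => exact ⟨1, by simpa using isSymbolOf_one w, by simpa using isSymbolOf_one w'⟩
  | add β γ hβ hγ =>
    obtain ⟨A, h1, h2⟩ := hβ
    obtain ⟨B, h3, h4⟩ := hγ
    refine ⟨A * B, ?_, ?_⟩
    · simpa [mulDPow_add, mul_add, Finset.sum_add_distrib] using h1.mul h3
    · simpa [mulDPow_add, mul_add, Finset.sum_add_distrib] using h2.mul h4
  | single i m =>
    simp only [sum_mul_single]
    induction m with
    | zero => exact ⟨1, by simpa using isSymbolOf_one w, by simpa using isSymbolOf_one w'⟩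
    | succ m ih =>
      obtain ⟨A, h1, h2⟩ := ih
      refine ⟨A * if w.1.1 i + w.1.2 i = 0 then mulD i else shiftD i, ?_, ?_⟩
      · have := h1.mul (isSymbolOf_mulD w i)
        rw [Finsupp.single_add, mulDPow_add, mulDPow_single, Nat.cast_add, mul_add, Nat.cast_one,
          mul_one]
        exact this
      · have := h2.mul (isSymbolOf_mulD w' i)
        rw [Finsupp.single_add, mulDPow_add, mulDPow_single, Nat.cast_add, mul_add, Nat.cast_one,
          mul_one]
        simp only [hw]
        exact this

theorem exists_symbol_term {w w' : Wloc n}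
    (hw : ∀ i, w.1.1 i + w.1.2 i = 0 ↔ w'.1.1 i + w'.1.2 i = 0) (b : (Fin n →₀ ℕ) × ℕ) :
    ∃ A', IsSymbolOf w (∑ i, w.1.2 i * b.1 i) (mulDPow b.1 * mulH ^ b.2) A' ∧
      IsSymbolOf w' (∑ i, w'.1.2 i * b.1 i) (mulDPow b.1 * mulH ^ b.2) A' := by
  obtain ⟨A, h1, h2⟩ := exists_symbol_mulDPow hw b.1
  have hH : ∀ (w : Wloc n) k, IsSymbolOf w 0 (mulH ^ k) (mulH ^ k) := by
    intro w k
    induction k with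
    | zero => exact isSymbolOf_one w
    | succ k ih => simpa [pow_succ] using ih.mul (isSymbolOf_mulH w)
  exact ⟨A * mulH ^ b.2, by simpa using h1.mul (hH w b.2), by simpa using h2.mul (hH w' b.2)⟩

/-- Among pairs of monomials of weights at most `s` and at most `t`, the total `s + t` is reached
only when both bounds are attained. -/
theorem levD_mulC {w : Wloc n} {s t : ℝ} {c : FormalSeries n}
    (hc : ∀ α, MvPowerSeries.coeff α c ≠ 0 → ∑ i, w.1.1 i * (α i : ℝ) ≤ s) {Q : HD n}
    (hQ : Q ∈ filt (coeffD n) (weightD w) t) :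
    levD w (s + t) (mulC c Q)
      = mulC (restrictExp {α | ∑ i, w.1.1 i * (α i : ℝ) = s} c) (levD w t Q) := by
  classical
  refine HD.ext fun b => MvPowerSeries.ext fun α => ?_
  rw [coef_levD, coef_mulC, coef_mulC, coef_levD, coeff_restrictExp, MvPowerSeries.coeff_mul,
    MvPowerSeries.coeff_mul]
  have h : ∀ p ∈ Finset.HasAntidiagonal.antidiagonal α,
      (if weightD w (α, b) = s + t then
        MvPowerSeries.coeff p.1 c * MvPowerSeries.coeff p.2 (coef Q b) else 0) =
      MvPowerSeries.coeff p.1 (restrictExp {α | ∑ i, w.1.1 i * (α i : ℝ) = s} c) *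
        MvPowerSeries.coeff p.2 (restrictExp {α | weightD w (α, b) = t} (coef Q b)) := by
    intro p hp
    rw [coeff_restrictExp, coeff_restrictExp, ← Finset.HasAntidiagonal.mem_antidiagonal.1 hp,
      weightD_add_left]
    simp only [Set.mem_ofPred_eq]
    by_cases h1 : MvPowerSeries.coeff p.1 c = 0
    · simp [h1]
    by_cases h2 : MvPowerSeries.coeff p.2 (coef Q b) = 0
    · simp [h2]
    have h3 := hc _ h1
    have h4 := hQ (p.2, b) h2
    by_cases h5 : ∑ i, w.1.1 i * (p.1 i : ℝ) = s
    · by_cases h6 : weightD w (p.2, b) = t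
      · rw [if_pos h5, if_pos h6, if_pos (by rw [h5, h6])]
      · rw [if_neg h6, mul_zero, if_neg]
        intro h7
        exact h6 (by linarith)
    · rw [if_neg h5, zero_mul, if_neg]
      intro h7
      exact h5 (le_antisymm h3 (by linarith))
  rw [← Finset.sum_congr rfl h]
  simp only [Set.mem_ofPred_eq]
  split_ifs <;> simp

/-- The product determined by operators `B b` that replace the left multiplications by
`∂^β h^k`. -/
def symbolProd (B : ((Fin n →₀ ℕ) × ℕ) → Module.End ℂ (HD n)) : HD n →ₗ[ℂ] Module.End ℂ (HD n) :=
  HD.lift fun b => (LinearMap.mulRight ℂ (B b)).comp mulC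

theorem symbolProd_term (B : ((Fin n →₀ ℕ) × ℕ) → Module.End ℂ (HD n)) (b) (c : FormalSeries n) :
    symbolProd B (term b c) = mulC c * B b := by
  simp [symbolProd]

theorem levD_mul {w : Wloc n} {B : ((Fin n →₀ ℕ) × ℕ) → Module.End ℂ (HD n)}
    (hB : ∀ b, IsSymbolOf w (∑ i, w.1.2 i * b.1 i) (mulDPow b.1 * mulH ^ b.2) (B b)) {s t : ℝ}
    {P Q : HD n} (hP : P ∈ filt (coeffD n) (weightD w) s)
    (hQ : Q ∈ filt (coeffD n) (weightD w) t) :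
    levD w (s + t) (P * Q) = symbolProd B (levD w s P) (levD w t Q) := by
  conv_lhs => rw [eq_sum_term P, Finset.sum_mul, map_sum]
  conv_rhs => rw [eq_sum_term P, map_sum, map_sum, LinearMap.sum_apply]
  refine Finset.sum_congr rfl fun b _ => ?_
  have hb := fun α => le_of_term_mem_filt (term_coef_mem_filt hP b) (α := α)
  have hwt : ∀ α, weightD w (α, b) = ∑ i, w.1.1 i * (α i : ℝ) + ∑ i, w.1.2 i * (b.1 i : ℝ) :=
    fun _ => rfl
  rw [levD_term, symbolProd_term, mul_def, mulLeft_term,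
    Module.End.mul_apply (mulC (coef P b)), Module.End.mul_apply (mulC _) (B b), ← (hB b).2 t _ rfl Q hQ]
  -- The weight `v · β` of `∂^β` is moved from the left factor to the right one: the coefficient
  -- series has level `s - v · β`, and `∂^β h^k` raises the level of `Q` by `v · β`.
  have h1 : s + t = (s - ∑ i, w.1.2 i * (b.1 i : ℝ)) + (∑ i, w.1.2 i * (b.1 i : ℝ) + t) := by ring
  have h2 : {α : Fin n →₀ ℕ | weightD w (α, b) = s} =
      {α | ∑ i, w.1.1 i * (α i : ℝ) = s - ∑ i, w.1.2 i * (b.1 i : ℝ)} := by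
    ext α
    rw [Set.mem_ofPred_eq, Set.mem_ofPred_eq, hwt, eq_sub_iff_add_eq]
  rw [h1, h2, levD_mulC (fun α hα => ?_) ((hB b).1.mem_filt rfl hQ)]
  have := hb α hα
  rw [hwt] at this
  linarith

section Subrings

variable {R : Type*} [Ring R] {c : R →+ (ExpD n → ℂ)} {j : R →+* HD n} {w w' : Wloc n}
  [IsWeight c (weightD w)] [IsWeight c (weightD w')]

theorem isSymbolProduct_HD (hc : ∀ a, c a = coeffD n (j a))
    {B : ((Fin n →₀ ℕ) × ℕ) → Module.End ℂ (HD n)}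
    (hB : ∀ b, IsSymbolOf w (∑ i, w.1.2 i * b.1 i) (mulDPow b.1 * mulH ^ b.2) (B b)) :
    IsSymbolProduct c (weightD w) fun p q => coeffD n (symbolProd B (j p) (j q)) := by
  have hlev : ∀ s (a : filt c (weightD w) s) p, c p = levelPart c (weightD w) s a →
      j p = levD w s (j a) := by
    intro s a p hp
    refine coeffD_injective ?_
    ext e
    rw [← hc, hp, coeffD_levD, levelPart_apply, hc]
  have hmem : ∀ s (a : filt c (weightD w) s), j a ∈ filt (coeffD n) (weightD w) s :=
    fun s a e he => a.2 e (by rwa [hc])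
  intro s t a b p q hp hq
  dsimp only
  rw [hlev s a p hp, hlev t b q hq, ← levD_mul hB (hmem s a) (hmem t b)]
  ext e
  rw [coeffD_levD, levelPart_apply, hc, map_mul]

/-- An operator has finitely many pairs `(β, k)`, so `v · β` takes finitely many values and only the
`x`-exponents, hence only `u`, matter. -/
theorem finLevels_HD (hc : ∀ a, c a = coeffD n (j a)) (w w' : Wloc n)
    (h : ∀ i, w.1.1 i = 0 → w'.1.1 i = 0) {p : R} (hp : FinLevels (weightD w) (c p)) :
    FinLevels (weightD w') (c p) := by
  have hfin : ∀ v : Fin n → ℝ, ((fun e : ExpD n => ∑ i, v i * (e.2.1 i : ℝ)) ''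
      {e | c p e ≠ 0}).Finite := by
    intro v
    refine ((Finset.finite_toSet (j p).support).image
      fun b : (Fin n →₀ ℕ) × ℕ => ∑ i, v i * (b.1 i : ℝ)).subset ?_
    rintro _ ⟨e, he, rfl⟩
    refine ⟨e.2, ?_, rfl⟩
    rw [Finset.mem_coe]
    refine Finsupp.mem_support_iff.2 fun h0 => he ?_
    rw [hc]
    exact (congrArg (MvPowerSeries.coeff e.1) h0).trans (map_zero _)
  exact finite_weight_image (S := {e : ExpD n | c p e ≠ 0}) (α := fun e => e.1) (hfin w.1.2)
    (hfin w'.1.2) (fun i => (w.2 i).1) h hp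

theorem sameGr_HD_of (hc : ∀ a, c a = coeffD n (j a)) (hj : Function.Injective j)
    (hl : ∀ w : Wloc n, HasLevels c (weightD w)) (h1 : ∀ i, w.1.1 i = 0 ↔ w'.1.1 i = 0)
    (h2 : ∀ i, w.1.1 i + w.1.2 i = 0 ↔ w'.1.1 i + w'.1.2 i = 0) :
    SameGr c (weightD w) (weightD w') := by
  choose B hB hB' using fun b => exists_symbol_term h2 b
  have hinj : Function.Injective c := by
    intro a b hab
    rw [hc, hc] at hab
    exact hj (coeffD_injective hab)
  let star : R →+ R →+ (ExpD n → ℂ) :=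
    AddMonoidHom.mk' (fun p => ((coeffD n).comp (symbolProd B (j p)).toAddMonoidHom).comp
      j.toAddMonoidHom) (by
      intro p p'
      ext q
      simp)
  exact sameGr_of_symbolProduct hinj (hl w) (hl w')
    (fun p => ⟨finLevels_HD hc w w' fun i => (h1 i).1, finLevels_HD hc w' w fun i => (h1 i).2⟩)
    star (isSymbolProduct_HD hc hB) (isSymbolProduct_HD hc hB')

end Subrings

/-! ### What the graded ring remembers of the weight -/

section SameGrMul

variable {R E : Type*} [Ring R] {c : R →+ (E → ℂ)} {wt wt' : E → ℝ} [IsWeight c wt]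
  [IsWeight c wt']

/-- Equal graded rings have the same products of elements that are homogeneous for both
weights. -/
theorem SameGr.levelPart_mul (h : SameGr c wt wt') {s s' t t' : ℝ} {x y : R}
    (hx : ∀ e, c x e ≠ 0 → wt e = s) (hx' : ∀ e, c x e ≠ 0 → wt' e = s')
    (hy : ∀ e, c y e ≠ 0 → wt e = t) (hy' : ∀ e, c y e ≠ 0 → wt' e = t') (e : E)
    (he : c (x * y) e ≠ 0) (hwt : wt e = s + t) : wt' e = s' + t' := by
  classical
  obtain ⟨φ, hφ⟩ := h
  -- An element homogeneous for both weights is its own normal form in both graded rings, so the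
  -- isomorphism must match its two symbols.
  have hsymb : ∀ {s s' : ℝ} {x : R} (hx : ∀ e, c x e ≠ 0 → wt e = s)
      (hx' : ∀ e, c x e ≠ 0 → wt' e = s'),
      φ (DirectSum.of (GrPiece c wt) s (symb c wt s ⟨x, fun e he => (hx e he).le⟩)) =
        DirectSum.of (GrPiece c wt') s' (symb c wt' s' ⟨x, fun e he => (hx' e he).le⟩) := by
    intro s s' x hx hx'
    refine normalForm_injective c wt' ?_
    rw [hφ, normalForm_of_symb, normalForm_of_symb]
    ext e
    rw [levelPart_apply, levelPart_apply]
    by_cases h0 : c x e = 0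
    · simp [h0]
    · rw [if_pos (hx e h0), if_pos (hx' e h0)]
  have key := congrFun (hφ (DirectSum.of (GrPiece c wt) s (symb c wt s ⟨x, fun e he => (hx e he).le⟩)
    * DirectSum.of (GrPiece c wt) t (symb c wt t ⟨y, fun e he => (hy e he).le⟩))) e
  rw [map_mul, hsymb hx hx', hsymb hy hy', of_mul_of_symb, of_mul_of_symb, normalForm_of_symb,
    normalForm_of_symb, levelPart_apply, levelPart_apply, if_pos hwt] at key
  by_contra hne
  rw [if_neg hne] at key
  exact he key.symm

end SameGrMul

section Subrings

variable {R : Type*} [Ring R] {c : R →+ (ExpD n → ℂ)} {j : R →+* HD n} {w w' : Wloc n}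
  [IsWeight c (weightD w)] [IsWeight c (weightD w')]

theorem SameGr.fst_eq_zero (h : SameGr c (weightD w) (weightD w')) (hc : ∀ a, c a = coeffD n (j a))
    (hl : HasLevels c (weightD w)) {i : Fin n} (hgeom : ∃ a, j a = HD.C (geomSeries i))
    (hi : w.1.1 i = 0) : w'.1.1 i = 0 := by
  obtain ⟨a, ha⟩ := hgeom
  have hca : ∀ e, c a e ≠ 0 ↔ ∃ k, e = (Finsupp.single i k, 0) := by
    intro e
    rw [hc, ha]
    constructor
    · intro he
      obtain ⟨h1, h2⟩ := coeffD_term_ne (b := 0) he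
      obtain ⟨k, hk⟩ := coeff_geomSeries_ne_zero.1 h2
      exact ⟨k, Prod.ext hk.symm h1⟩
    · rintro ⟨k, rfl⟩
      change coeffD n (term 0 (geomSeries i)) (Finsupp.single i k, 0) ≠ 0
      rw [coeffD_apply, coef_term, if_pos rfl]
      exact coeff_geomSeries_ne_zero.2 ⟨k, rfl⟩
  have hwt : ∀ (w : Wloc n) (k : ℕ), weightD w (Finsupp.single i k, 0) = w.1.1 i * k := by
    intro w k
    rw [weightD, sum_mul_single]
    simp
  have hfin : FinLevels (weightD w) (c a) := by
    refine (Set.finite_singleton 0).subset ?_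
    rintro _ ⟨e, he, rfl⟩
    obtain ⟨k, rfl⟩ := (hca e).1 he
    rw [Set.mem_singleton_iff, hwt, hi, zero_mul]
  have hfin' := h.finLevels hl hfin
  by_contra hne
  refine Set.infinite_of_injective_forall_mem (f := fun k : ℕ => w'.1.1 i * (k : ℝ)) ?_ ?_ hfin'
  · intro k l hkl
    exact_mod_cast mul_left_cancel₀ hne hkl
  · intro k
    exact ⟨_, (hca _).2 ⟨k, rfl⟩, hwt w' k⟩

/-- In `∂_i x_i = x_i ∂_i + h` the monomial `h` has weight 0, while the product of the symbols sits
at level `u_i + v_i`. Hence `h` appears in that product exactly when this sum vanishes. -/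
theorem SameGr.add_eq_zero (h : SameGr c (weightD w) (weightD w')) (hc : ∀ a, c a = coeffD n (j a))
    {i : Fin n} (hx : ∃ a, j a = HD.C (MvPowerSeries.X i)) (hd : ∃ a, j a = HD.del i)
    (hi : w.1.1 i + w.1.2 i = 0) : w'.1.1 i + w'.1.2 i = 0 := by
  classical
  obtain ⟨x, hx⟩ := hx
  obtain ⟨y, hy⟩ := hd
  have h1 : ∀ (w : Wloc n) e, c x e ≠ 0 → weightD w e = w.1.1 i := by
    intro w e he
    rw [hc, hx] at he
    obtain ⟨h1, h2⟩ := coeffD_term_ne (b := 0) he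
    rw [MvPowerSeries.coeff_X] at h2
    have h3 : e.1 = Finsupp.single i 1 := by
      by_contra h
      exact h2 (if_neg h)
    rw [weightD, h1, h3, sum_mul_single]
    simp
  have h2 : ∀ (w : Wloc n) e, c y e ≠ 0 → weightD w e = w.1.2 i := by
    intro w e he
    rw [hc, hy] at he
    obtain ⟨h1, h2⟩ := coeffD_term_ne he
    rw [MvPowerSeries.coeff_one] at h2
    have h3 : e.1 = 0 := by
      by_contra h
      exact h2 (if_neg h)
    rw [weightD, h1, h3, sum_mul_single]
    simp
  have h3 : c (y * x) (0, (0, 1)) ≠ 0 := by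
    rw [hc, map_mul, hx, hy, del_mul]
    change coeffD n (mulD i (term 0 _)) _ ≠ 0
    rw [mulD_term, coeffD_apply, coef_add, coef_term, coef_term]
    simp
  have h4 : ∀ w : Wloc n, weightD w (0, (0, 1)) = 0 := by
    intro w
    simp [weightD]
  have := h.levelPart_mul (h2 w) (h2 w') (h1 w) (h1 w') _ h3 (by rw [h4]; linarith)
  rw [h4] at this
  linarith

theorem sameGr_HD_iff (hc : ∀ a, c a = coeffD n (j a)) (hj : Function.Injective j)
    (hl : ∀ w : Wloc n, HasLevels c (weightD w))
    (hgeom : ∀ i, ∃ a, j a = HD.C (geomSeries i)) (hx : ∀ i, ∃ a, j a = HD.C (MvPowerSeries.X i))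
    (hd : ∀ i, ∃ a, j a = HD.del i) :
    SameGr c (weightD w) (weightD w') ↔ (∀ i, w.1.1 i = 0 ↔ w'.1.1 i = 0) ∧
      ∀ i, w.1.1 i + w.1.2 i = 0 ↔ w'.1.1 i + w'.1.2 i = 0 :=
  ⟨fun h => ⟨fun i => ⟨h.fst_eq_zero hc (hl w) (hgeom i), h.symm.fst_eq_zero hc (hl w') (hgeom i)⟩,
    fun i => ⟨h.add_eq_zero hc (hx i) (hd i), h.symm.add_eq_zero hc (hx i) (hd i)⟩⟩,
    fun h => sameGr_HD_of hc hj hl h.1 h.2⟩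

end Subrings

theorem isConvergent_X (i : Fin n) : IsConvergent (MvPowerSeries.X i : FormalSeries n) := by
  classical
  refine isConvergent_of_finite ((Set.finite_singleton (Finsupp.single i 1)).subset fun α hα => ?_)
  rw [Set.mem_ofPred_eq, MvPowerSeries.coeff_X] at hα
  by_contra h
  exact hα (if_neg h)

/-- The test elements (geometric series, `x_i`, `∂_i`) all have convergent coefficients, so one
criterion serves both rings. -/
theorem sameGr_coeffD₀_iff (w w' : Wloc n) :
    SameGr (coeffD₀ n) (weightD w) (weightD w') ↔ SameGr (coeffD n) (weightD w) (weightD w') := by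
  rw [sameGr_HD_iff (c := coeffD₀ n) (j := (convergentHD n).subtype) (fun _ => rfl)
      Subtype.val_injective hasLevels_coeffD₀
      (fun i => ⟨⟨_, C_mem_convergentHD (isConvergent_geomSeries i)⟩, rfl⟩)
      (fun i => ⟨⟨_, C_mem_convergentHD (isConvergent_X i)⟩, rfl⟩)
      (fun i => ⟨⟨_, term_mem_convergentAddHD (Finsupp.single i 1, 0) isConvergent_one⟩, rfl⟩),
    sameGr_HD_iff (c := coeffD n) (j := RingHom.id _) (fun _ => rfl) Function.injective_id
      hasLevels_coeffD (fun i => ⟨_, rfl⟩) (fun i => ⟨_, rfl⟩) fun i => ⟨_, rfl⟩]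

theorem grobnerFan_HD {I : Ideal (convergentHD n)} (hI : IsHomogeneousIdeal I) :
    grobnerFan (coeffD₀ n) weightD I
      = grobnerFan (coeffD n) weightD (I.map (convergentHD n).subtype) := by
  unfold grobnerFan
  congr 1
  funext w
  ext w'
  refine exists_congr fun h => ?_
  exact sameInitial_iff (isCompatible_HD w hI) (isCompatible_HD ⟨w', h⟩ hI)
    (fun _ => rfl) (sameGr_coeffD₀_iff _ _)

end GrobnerFan

end

theorem mainTheorem5 (n : ℕ) (hn : 1 ≤ n) :
    (∀ I : Ideal (GrobnerFan.convergentSeries n),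
      GrobnerFan.grobnerFan (GrobnerFan.coeffO₀ n) GrobnerFan.weightO I
        = GrobnerFan.grobnerFan (GrobnerFan.coeffO n) GrobnerFan.weightO
            (I.map (GrobnerFan.convergentSeries n).subtype)) ∧
    (∀ I : Ideal (GrobnerFan.convergentHD n), GrobnerFan.IsHomogeneousIdeal I →
      GrobnerFan.grobnerFan (GrobnerFan.coeffD₀ n) GrobnerFan.weightD I
        = GrobnerFan.grobnerFan (GrobnerFan.coeffD n) GrobnerFan.weightD
            (I.map (GrobnerFan.convergentHD n).subtype)) :=
  ⟨GrobnerFan.grobnerFan_powerSeries, fun _ => GrobnerFan.grobnerFan_HD⟩
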